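/- Let $(M,\langle\cdot,\cdot\rangle,I)$ be an almost Hermitian manifold of dimension $2n$, $n\ge 2$ (a smooth Riemannian manifold with a smooth orthogonal almost complex structure), with Kähler form $\omega(X,Y)=\langle X,IY\rangle$ and Levi-Civita connection $\nabla$. Let $\xi_XY=-\tfrac12 I(\nabla_XI)Y$ be the intrinsic torsion, $\widetilde\nabla=\nabla+\xi$ the minimal $U(n)$-connection, and $\xi=\xi_1+\xi_2+\xi_3+\xi_4$ the decomposition of $\xi$ into its components in the Gray–Hervella modules $\mathcal W_1,\dots,\mathcal W_4$ of tensors $\zeta$ with every $\zeta_X$ skew-symmetric and anticommuting with $I$: in $\mathcal W_1$, $\zeta_XX=0$; in $\mathcal W_2$, the cyclic sum of $\langle\zeta_XY,IZ\rangle$ vanishes; in $\mathcal W_3$, $\zeta_{IX}IY=\zeta_XY$ and $\zeta_{e_i}e_i=0$; in $\mathcal W_4$, $\zeta_XY=\langle X,Y\rangle\theta-\langle\theta,Y\rangle X+\langle X,IY\rangle I\theta-\langle\theta,IY\rangle IX$ for some vector $\theta$. Here and below $(e_i)$ is any orthonormal basis of the tangent space at the given point and repeated indices are summed. Write $[[\lambda^{2,0}]]$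 for the space of $2$-forms $b$ with $b(IX,IY)=-b(X,Y)$, and define the $[[\lambda^{2,0}]]$-component of a $4$-form $\beta$ as $\tfrac12\bigl(c(X,Y)-c(IX,IY)\bigr)$, where $c(X,Y)=\omega(e_i,e_j)\,\beta(e_i,e_j,X,Y)$. Consider the eight terms $$t_1=\langle(\widetilde\nabla_{e_i}\xi_1)_{e_i}X,Y\rangle,\quad t_2=\langle(\widetilde\nabla_{e_i}\xi_3)_{e_i}X,Y\rangle,\quad t_3=\langle(\widetilde\nabla_{e_i}\xi_4)_{e_i}X,Y\rangle,$$ $$t_4=\langle{\xi_3}_Xe_i,{\xi_1}_{e_i}Y\rangle-\langle{\xi_3}_Ye_i,{\xi_1}_{e_i}X\rangle,\quad t_5=\langle{\xi_1}_{{\xi_4}_{e_i}e_i}X,Y\rangle,$$ $$t_6=\langle{\xi_3}_Xe_i,{\xi_2}_{e_i}Y\rangle-\langle{\xi_3}_Ye_i,{\xi_2}_{e_i}X\rangle,\quad t_7=\langle{\xi_2}_{{\xi_4}_{e_i}e_i}X,Y\rangle,\quad t_8=\langle{\xi_3}_{{\xi_4}_{e_i}e_i}X,Y\rangle,$$ which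 come from $\widetilde\nabla\xi_1$, $\widetilde\nabla\xi_3$, $\widetilde\nabla\xi_4$, $\xi_1\odot\xi_3$, $\xi_1\odot\xi_4$, $\xi_2\odot\xi_3$, $\xi_2\odot\xi_4$ and $\xi_3\odot\xi_4$, respectively. Each of them lies in $[[\lambda^{2,0}]]$. At every point of $M$, $d^2\omega=0$, the $[[\lambda^{2,0}]]$-component of $d^2\omega$ equals $4$ times the right-hand side below, and therefore $$0=3t_1-t_2+(n-2)\,t_3+t_4-\frac{n-5}{n-1}\,t_5+t_6-\frac{n-2}{n-1}\,t_7+t_8 .$$ For $n\ge3$ no coefficient of this relation vanishes, with the single exception of the coefficient of $t_5$ when $n=5$; a term whose coefficient is not zero is thereby a linear combination of the other seven. Moreover, put $t_0=\langle(\widetilde\nabla_{e_i}\xi_2)_{e_i}X,Y\rangle$ and let $A$ and $B$ be the two expressions (used for the anti-Hermitian part of the $*$-Ricci curvature, hence for the $\mathcal C_6$-component of the curvature) $$A(X,Y)=\tfrac12\bigl(a(X,Y)-a(Y,X)-a(IX,IY)+a(IY,IX)\bigr),$$ $$a(X,Y)=\langle(\widetilde\nabla_{e_i}\xi)_XY,e_i\rangle-\langle(\widetilde\nabla_X\xi)_{e_i}Y,e_i\rangle-\langle\xi_{\xi_Xe_i}Y,e_i\rangle,$$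 $$B(X,Y)=\langle(\widetilde\nabla_{e_i}\xi)_{Ie_i}IX,Y\rangle-\langle\xi_{I\xi_{e_i}e_i}IX,Y\rangle .$$ Then $$A=-t_0+2t_1+(n-1)t_3+t_4+\tfrac{4}{n-1}t_5+t_6+\tfrac1{n-1}t_7,\qquad B=-t_0-t_1+t_2+t_3+t_5+t_7-t_8 ,$$ the difference of these two expansions is, coefficient by coefficient, the right-hand side of the relation, so that $A=B$; and eliminating $t_1$ from $A$ by the relation gives $$A=-t_0+\tfrac23t_2+\tfrac{n+1}3t_3+\tfrac13t_4+\tfrac{2(n+1)}{3(n-1)}t_5+\tfrac13t_6+\tfrac{2n-1}{3(n-1)}t_7-\tfrac23t_8 ,$$ in which no displayed coefficient vanishes. -/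

import Mathlib

open Bundle Manifold
open scoped ContDiff

noncomputable section

namespace AlmostHermitian

/-! ### Linear algebra on one tangent space

`V` is a Euclidean vector space and `J` an endomorphism of it (later an orthogonal complex
structure).  A tensor `T : V →ₗ[ℝ] V →ₗ[ℝ] V` is read as `T u v = T_u v`. -/

section LinearAlgebra

variable {V : Type*} [NormedAddCommGroup V] [InnerProductSpace ℝ V]

/-- The space `V* ⊗ 𝔲(n)^⊥`: every `T_u` is skew-symmetric and anticommutes with `J`. -/
def torsionSpace (J : V →ₗ[ℝ] V) : Submodule ℝ (V →ₗ[ℝ] V →ₗ[ℝ] V) where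
  carrier := {T | (∀ u v w, inner ℝ (T u v) w = -inner ℝ v (T u w)) ∧
    ∀ u v, T u (J v) = -J (T u v)}
  zero_mem' := by simp
  add_mem' := by
    rintro S T ⟨h1, h2⟩ ⟨h3, h4⟩
    refine ⟨fun u v w ↦ ?_, fun u v ↦ ?_⟩
    · simp only [LinearMap.add_apply, inner_add_left, inner_add_right, h1, h3]; ring
    · simp only [LinearMap.add_apply, map_add, h2, h4]; abel
  smul_mem' := by
    rintro c T ⟨h1, h2⟩
    refine ⟨fun u v w ↦ ?_, fun u v ↦ ?_⟩
    · simp only [LinearMap.smul_apply, real_inner_smul_left, real_inner_smul_right, h1]; ring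
    · simp only [LinearMap.smul_apply, map_smul, h2, smul_neg]

/-- The Gray-Hervella module `𝒲₁`: `T_u u = 0`. -/
def W₁ (J : V →ₗ[ℝ] V) : Set (V →ₗ[ℝ] V →ₗ[ℝ] V) :=
  {T | T ∈ torsionSpace J ∧ ∀ u, T u u = 0}

/-- The Gray-Hervella module `𝒲₂`: the cyclic sum of `⟨T_u v, J w⟩` vanishes. -/
def W₂ (J : V →ₗ[ℝ] V) : Set (V →ₗ[ℝ] V →ₗ[ℝ] V) :=
  {T | T ∈ torsionSpace J ∧
    ∀ u v w, inner ℝ (T u v) (J w) + inner ℝ (T v w) (J u) + inner ℝ (T w u) (J v) = 0}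

/-- The vector `∑ i, T_{e_i} e_i`, for an orthonormal basis `e`. -/
def traceVector [FiniteDimensional ℝ V] (T : V →ₗ[ℝ] V →ₗ[ℝ] V) : V :=
  ∑ i, T (stdOrthonormalBasis ℝ V i) (stdOrthonormalBasis ℝ V i)

/-- The Gray-Hervella module `𝒲₃`: `T_{J u} J v = T_u v` and `∑ i, T_{e_i} e_i = 0`. -/
def W₃ [FiniteDimensional ℝ V] (J : V →ₗ[ℝ] V) : Set (V →ₗ[ℝ] V →ₗ[ℝ] V) :=
  {T | T ∈ torsionSpace J ∧ (∀ u v, T (J u) (J v) = T u v) ∧ traceVector T = 0}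

/-- The tensor of type `𝒲₄` determined by the vector `θ`:
`(u, v) ↦ ⟨u, v⟩ θ - ⟨θ, v⟩ u + ⟨u, J v⟩ J θ - ⟨θ, J v⟩ J u`. -/
def vectorTensor (J : V →ₗ[ℝ] V) (θ : V) : V →ₗ[ℝ] V →ₗ[ℝ] V :=
  LinearMap.mk₂ ℝ
    (fun u v ↦ inner ℝ u v • θ - inner ℝ θ v • u + inner ℝ u (J v) • J θ - inner ℝ θ (J v) • J u)
    (fun u u' v ↦ by simp only [inner_add_left, map_add]; module)
    (fun c u v ↦ by simp only [real_inner_smul_left, map_smul]; module)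
    (fun u v v' ↦ by simp only [inner_add_right, map_add]; module)
    (fun c u v ↦ by simp only [real_inner_smul_right, map_smul]; module)

/-- The Gray-Hervella module `𝒲₄`. -/
def W₄ (J : V →ₗ[ℝ] V) : Set (V →ₗ[ℝ] V →ₗ[ℝ] V) :=
  {T | ∃ θ : V, T = vectorTensor J θ}

/-- The part of `T` with `T_{J u} J v = -T_u v`, i.e. the component in `𝒲₁ + 𝒲₂`. -/
def part₁₂ (J : V →ₗ[ℝ] V) (T : V →ₗ[ℝ] V →ₗ[ℝ] V) : V →ₗ[ℝ] V →ₗ[ℝ] V :=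
  (1 / 2 : ℝ) • (T - T.compl₁₂ J J)

/-- The part of `T` with `T_{J u} J v = T_u v`, i.e. the component in `𝒲₃ + 𝒲₄`. -/
def part₃₄ (J : V →ₗ[ℝ] V) (T : V →ₗ[ℝ] V →ₗ[ℝ] V) : V →ₗ[ℝ] V →ₗ[ℝ] V :=
  (1 / 2 : ℝ) • (T + T.compl₁₂ J J)

/-- Total skew-symmetrisation of a tensor with all `T_u` skew: the tensor `A` with
`⟨A_u v, w⟩ = (⟨T_u v, w⟩ + ⟨T_v w, u⟩ + ⟨T_w u, v⟩) / 3`. -/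
def cyclicPart [FiniteDimensional ℝ V] (T : V →ₗ[ℝ] V →ₗ[ℝ] V) : V →ₗ[ℝ] V →ₗ[ℝ] V :=
  LinearMap.mk₂ ℝ (fun u v ↦ (1 / 3 : ℝ) • (T u v - T v u + LinearMap.adjoint (T.flip u) v))
    (fun u u' v ↦ by simp only [map_add, LinearMap.add_apply]; module)
    (fun c u v ↦ by
      simp only [map_smulₛₗ, LinearMap.smul_apply, RingHom.id_apply, conj_trivial]
      module)
    (fun u v v' ↦ by simp only [map_add, LinearMap.add_apply]; module)
    (fun c u v ↦ by simp only [map_smul, LinearMap.smul_apply]; module)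

/-- The component of `T` in `𝒲₁`. -/
def comp₁ [FiniteDimensional ℝ V] (J : V →ₗ[ℝ] V) (T : V →ₗ[ℝ] V →ₗ[ℝ] V) :
    V →ₗ[ℝ] V →ₗ[ℝ] V :=
  cyclicPart (part₁₂ J T)

/-- The component of `T` in `𝒲₂`. -/
def comp₂ [FiniteDimensional ℝ V] (J : V →ₗ[ℝ] V) (T : V →ₗ[ℝ] V →ₗ[ℝ] V) :
    V →ₗ[ℝ] V →ₗ[ℝ] V :=
  part₁₂ J T - comp₁ J T

/-- The component of `T` in `𝒲₄`, where `dim V = 2 n`. -/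
def comp₄ [FiniteDimensional ℝ V] (n : ℕ) (J : V →ₗ[ℝ] V) (T : V →ₗ[ℝ] V →ₗ[ℝ] V) :
    V →ₗ[ℝ] V →ₗ[ℝ] V :=
  (1 / (2 * ((n : ℝ) - 1))) • vectorTensor J (traceVector T)

/-- The component of `T` in `𝒲₃`, where `dim V = 2 n`. -/
def comp₃ [FiniteDimensional ℝ V] (n : ℕ) (J : V →ₗ[ℝ] V) (T : V →ₗ[ℝ] V →ₗ[ℝ] V) :
    V →ₗ[ℝ] V →ₗ[ℝ] V :=
  part₃₄ J T - comp₄ n J T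

/-- `⟦λ^{2,0}⟧`: the bilinear forms that are skew-symmetric and lie in the `(-1)`-eigenspace of
`b ↦ b(J ·, J ·)`. -/
def IsLambda20 (J : V →ₗ[ℝ] V) (b : V → V → ℝ) : Prop :=
  (∀ u v, b u v = -b v u) ∧ ∀ u v, b (J u) (J v) = -b u v

/-- The `⟦λ^{2,0}⟧`-component of a `4`-form: contract the first two arguments with
`ω(u, v) = ⟨u, J v⟩` and project to the `(-1)`-eigenspace of `b ↦ b(J ·, J ·)`. -/
def lambda20Part {ι : Type*} [Fintype ι] (J : V →ₗ[ℝ] V) (e : OrthonormalBasis ι ℝ V)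
    (β : V → V → V → V → ℝ) (u v : V) : ℝ :=
  1 / 2 * (∑ i, ∑ j, inner ℝ (e i) (J (e j)) * β (e i) (e j) u v
    - ∑ i, ∑ j, inner ℝ (e i) (J (e j)) * β (e i) (e j) (J u) (J v))

/-- `∑ i, ⟨(D_{e_i})_{e_i} X, Y⟩`, where `D u v w = (D_u)_v w`. -/
def divTerm {ι : Type*} [Fintype ι] (e : OrthonormalBasis ι ℝ V) (D : V → V → V → V)
    (X Y : V) : ℝ :=
  ∑ i, inner ℝ (D (e i) (e i) X) Y

/-- `∑ i, (⟨A_X e_i, B_{e_i} Y⟩ - ⟨A_Y e_i, B_{e_i} X⟩)`. -/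
def mixedTerm {ι : Type*} [Fintype ι] (e : OrthonormalBasis ι ℝ V) (A B : V →ₗ[ℝ] V →ₗ[ℝ] V)
    (X Y : V) : ℝ :=
  ∑ i, (inner ℝ (A X (e i)) (B (e i) Y) - inner ℝ (A Y (e i)) (B (e i) X))

/-- `∑ i, ⟨A_{B_{e_i} e_i} X, Y⟩`. -/
def traceTerm {ι : Type*} [Fintype ι] (e : OrthonormalBasis ι ℝ V) (A B : V →ₗ[ℝ] V →ₗ[ℝ] V)
    (X Y : V) : ℝ :=
  ∑ i, inner ℝ (A (B (e i) (e i)) X) Y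

/-- `∑ i, (⟨(D_{e_i})_X Y, e_i⟩ - ⟨(D_X)_{e_i} Y, e_i⟩ - ⟨T_{T_X e_i} Y, e_i⟩)`. -/
def ricciTerm {ι : Type*} [Fintype ι] (e : OrthonormalBasis ι ℝ V) (D : V → V → V → V)
    (T : V →ₗ[ℝ] V →ₗ[ℝ] V) (X Y : V) : ℝ :=
  ∑ i, (inner ℝ (D (e i) X Y) (e i) - inner ℝ (D X (e i) Y) (e i)
    - inner ℝ (T (T X (e i)) Y) (e i))

/-- With `D = ∇̃ξ` and `T = ξ`: the first of two expressions used for the anti-Hermitian part of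
the `*`-Ricci curvature, i.e. for the `𝒞₆`-component of the Riemannian curvature. -/
def ricciStarExpr {ι : Type*} [Fintype ι] (J : V →ₗ[ℝ] V) (e : OrthonormalBasis ι ℝ V)
    (D : V → V → V → V) (T : V →ₗ[ℝ] V →ₗ[ℝ] V) (X Y : V) : ℝ :=
  1 / 2 * (ricciTerm e D T X Y - ricciTerm e D T Y X
    - ricciTerm e D T (J X) (J Y) + ricciTerm e D T (J Y) (J X))

/-- With `D = ∇̃ξ` and `T = ξ`: the second of two expressions used for the anti-Hermitian part of
the `*`-Ricci curvature, i.e. for the `𝒞₆`-component of the Riemannian curvature. -/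
def ricciStarExpr' {ι : Type*} [Fintype ι] (J : V →ₗ[ℝ] V) (e : OrthonormalBasis ι ℝ V)
    (D : V → V → V → V) (T : V →ₗ[ℝ] V →ₗ[ℝ] V) (X Y : V) : ℝ :=
  ∑ i, (inner ℝ (D (e i) (J (e i)) (J X)) Y - inner ℝ (T (J (T (e i) (e i))) (J X)) Y)

end LinearAlgebra

/-- The coefficients of the relation among the eight terms of `relationTerm`. -/
def relationCoeff (n : ℕ) : Fin 8 → ℝ :=
  ![3, -1, (n : ℝ) - 2, 1, -(((n : ℝ) - 5) / ((n : ℝ) - 1)), 1,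
    -(((n : ℝ) - 2) / ((n : ℝ) - 1)), 1]

/-- The coefficients of the eight terms of `relationTerm` in `ricciStarExpr`. -/
def ricciStarCoeff (n : ℕ) : Fin 8 → ℝ :=
  ![2, 0, (n : ℝ) - 1, 1, 4 / ((n : ℝ) - 1), 1, 1 / ((n : ℝ) - 1), 0]

/-- The coefficients of the eight terms of `relationTerm` in `ricciStarExpr'`. -/
def ricciStarCoeff' : Fin 8 → ℝ :=
  ![-1, 1, 1, 0, 1, 0, 1, -1]

/-- The coefficients of the eight terms of `relationTerm` in `ricciStarExpr` after the
`∇̃ξ_1`-term has been eliminated by the relation. -/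
def ricciStarCoeffElim (n : ℕ) : Fin 8 → ℝ :=
  ![0, 2 / 3, ((n : ℝ) + 1) / 3, 1 / 3, 2 * ((n : ℝ) + 1) / (3 * ((n : ℝ) - 1)), 1 / 3,
    (2 * (n : ℝ) - 1) / (3 * ((n : ℝ) - 1)), -(2 / 3)]

/-! ### Almost Hermitian manifolds -/

section Geometry

variable {E : Type*} [NormedAddCommGroup E] [NormedSpace ℝ E]
  {H : Type*} [TopologicalSpace H] {I : ModelWithCorners ℝ E H}
  {M : Type*} [TopologicalSpace M] [ChartedSpace H M]

/-- The exterior derivative of a `2`-form, by the invariant formula applied to local extensions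
of the tangent vectors. -/
def extDeriv₂ [IsManifold I 1 M]
    (α : ∀ x : M, TangentSpace I x → TangentSpace I x → ℝ) (x : M)
    (u v w : TangentSpace I x) : ℝ :=
  let U := FiberBundle.extend E u
  let V := FiberBundle.extend E v
  let W := FiberBundle.extend E w
  mvfderiv I (fun y ↦ α y (V y) (W y)) x u
    - mvfderiv I (fun y ↦ α y (U y) (W y)) x v
    + mvfderiv I (fun y ↦ α y (U y) (V y)) x w
    - α x (VectorField.mlieBracket I U V x) w
    + α x (VectorField.mlieBracket I U W x) v
    - α x (VectorField.mlieBracket I V W x) u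

/-- The exterior derivative of a `3`-form, by the invariant formula applied to local extensions
of the tangent vectors. -/
def extDeriv₃ [IsManifold I 1 M]
    (α : ∀ x : M, TangentSpace I x → TangentSpace I x → TangentSpace I x → ℝ) (x : M)
    (t u v w : TangentSpace I x) : ℝ :=
  let T := FiberBundle.extend E t
  let U := FiberBundle.extend E u
  let V := FiberBundle.extend E v
  let W := FiberBundle.extend E w
  mvfderiv I (fun y ↦ α y (U y) (V y) (W y)) x t
    - mvfderiv I (fun y ↦ α y (T y) (V y) (W y)) x u
    + mvfderiv I (fun y ↦ α y (T y) (U y) (W y)) x v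
    - mvfderiv I (fun y ↦ α y (T y) (U y) (V y)) x w
    - α x (VectorField.mlieBracket I T U x) v w
    + α x (VectorField.mlieBracket I T V x) u w
    - α x (VectorField.mlieBracket I T W x) u v
    - α x (VectorField.mlieBracket I U V x) t w
    + α x (VectorField.mlieBracket I U W x) t v
    - α x (VectorField.mlieBracket I V W x) t u

/-- For a connection `D` on `TM` and a tensor field `S`, the value `(D_u S)_v w`, i.e.
`D_u (S_V W) - S_{D_u V} w - S_v (D_u W)` for local extensions `V`, `W` of `v`, `w`. -/
def tensorDeriv [IsManifold I 1 M] (D : CovariantDerivative I E (TangentSpace I : M → Type _))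
    (S : ∀ x : M, TangentSpace I x →ₗ[ℝ] TangentSpace I x →ₗ[ℝ] TangentSpace I x) (x : M)
    (u v w : TangentSpace I x) : TangentSpace I x :=
  let V := FiberBundle.extend E v
  let W := FiberBundle.extend E w
  D (fun y ↦ S y (V y) (W y)) x u - S x (D V x u) w - S x v (D W x u)

variable [FiniteDimensional ℝ E] [IsManifold I ∞ M]
  [RiemannianBundle (fun x : M ↦ TangentSpace I x)]

/-- Tangent spaces, with the metric given by the Riemannian structure, are finite-dimensional. -/
instance finiteDimensional_tangentSpace (x : M) :
    @FiniteDimensional ℝ (TangentSpace I x) _ _ (InnerProductSpace.toNormedSpace (𝕜 := ℝ)).toModule :=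
  inferInstanceAs (FiniteDimensional ℝ E)

variable (I M) in
/-- A smooth almost complex structure, orthogonal for the Riemannian metric of `M`. -/
structure OrthogonalComplexStructure where
  /-- The endomorphism of each tangent space. -/
  toFun : ∀ x : M, TangentSpace I x →L[ℝ] TangentSpace I x
  contMDiff : ContMDiff I (I.prod 𝓘(ℝ, E →L[ℝ] E)) ∞
    (fun x ↦ TotalSpace.mk' (E →L[ℝ] E) (E := fun x : M ↦ TangentSpace I x →L[ℝ] TangentSpace I x)
      x (toFun x))
  sq : ∀ (x : M) (v : TangentSpace I x), toFun x (toFun x v) = -v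
  orthogonal : ∀ (x : M) (v w : TangentSpace I x), inner ℝ (toFun x v) (toFun x w) = inner ℝ v w

variable (J : OrthogonalComplexStructure I M)

/-- `J` at the point `x`, as a linear map. -/
def OrthogonalComplexStructure.at (x : M) : TangentSpace I x →ₗ[ℝ] TangentSpace I x :=
  (J.toFun x).toLinearMap

/-- The Kähler form `ω(u, v) = ⟨u, J v⟩`. -/
def kahlerForm (x : M) (u v : TangentSpace I x) : ℝ := inner ℝ u (J.toFun x v)

/-- The Levi-Civita connection: `d⟨σ, τ⟩(u) = ⟨∇_u σ, τ⟩ + ⟨σ, ∇_u τ⟩` and no torsion. -/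
structure IsLeviCivita (nabla : CovariantDerivative I E (TangentSpace I : M → Type _)) : Prop where
  metric : ∀ (σ τ : ∀ x : M, TangentSpace I x) (x : M), MDiffAt (T% σ) x → MDiffAt (T% τ) x →
    ∀ u : TangentSpace I x, mvfderiv I (fun y ↦ (inner ℝ (σ y) (τ y) : ℝ)) x u
      = inner ℝ (nabla σ x u) (τ x) + inner ℝ (σ x) (nabla τ x u)
  torsion_free : nabla.torsion = 0

variable (nabla : CovariantDerivative I E (TangentSpace I : M → Type _))

/-- The operation `Y ↦ (X ↦ -½ J (∇_X J) Y)`, with `(∇_X J) Y = ∇_X (J Y) - J (∇_X Y)`. -/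
def torsionOp (Y : ∀ x : M, TangentSpace I x) (x : M) :
    TangentSpace I x →L[ℝ] TangentSpace I x :=
  (-(1 / 2) : ℝ) • (J.toFun x ∘L (nabla (fun y ↦ J.toFun y (Y y)) x - J.toFun x ∘L nabla Y x))

set_option linter.unusedSectionVars false in
theorem tensorialAt_torsionOp (x : M) :
    TensorialAt I E (fun Y ↦ torsionOp J nabla Y x) x := by
  have key : ∀ {Y : ∀ x : M, TangentSpace I x}, MDiffAt (T% Y) x →
      MDiffAt (T% (fun y ↦ J.toFun y (Y y))) x := by
    intro Y hY
    exact MDifferentiableAt.clm_bundle_apply (F₁ := E) (F₂ := E)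
      ((J.contMDiff x).mdifferentiableAt (by simp)) hY
  constructor
  · intro f Y hf hY
    have h1 : (fun y ↦ J.toFun y ((f • Y) y)) = f • (fun y ↦ J.toFun y (Y y)) := by
      funext y; simp
    simp only [torsionOp]
    rw [h1, nabla.isCovariantDerivativeOnUniv.leibniz hY hf,
      nabla.isCovariantDerivativeOnUniv.leibniz (key hY) hf]
    ext u
    simp
    module
  · intro Y Z hY hZ
    have h1 : (fun y ↦ J.toFun y ((Y + Z) y))
        = (fun y ↦ J.toFun y (Y y)) + (fun y ↦ J.toFun y (Z y)) := by
      funext y; simp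
    simp only [torsionOp]
    rw [h1, nabla.isCovariantDerivativeOnUniv.add hY hZ,
      nabla.isCovariantDerivativeOnUniv.add (key hY) (key hZ)]
    ext u
    simp
    module

/-- The intrinsic torsion as an endomorphism-valued one-form, with arguments in the order
`Y`, `X`: `torsionForm J ∇ x Y X = ξ_X Y = -½ J (∇_X J) Y`. -/
def torsionForm (x : M) :
    TangentSpace I x →L[ℝ] TangentSpace I x →L[ℝ] TangentSpace I x :=
  TensorialAt.mkHom (fun Y ↦ torsionOp J nabla Y x) x (tensorialAt_torsionOp J nabla x)

/-- The intrinsic torsion `ξ`, with `intrinsicTorsion J ∇ x X Y = ξ_X Y`. -/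
def intrinsicTorsion (x : M) :
    TangentSpace I x →ₗ[ℝ] TangentSpace I x →ₗ[ℝ] TangentSpace I x :=
  LinearMap.mk₂ ℝ (fun u v ↦ torsionForm J nabla x v u)
    (fun _ _ _ ↦ by simp) (fun _ _ _ ↦ by simp) (fun _ _ _ ↦ by simp) (fun _ _ _ ↦ by simp)

/-- The minimal `U(n)`-connection `∇̃ = ∇ + ξ`. -/
def minimalConnection : CovariantDerivative I E (TangentSpace I : M → Type _) :=
  nabla.addOneForm (torsionForm J nabla)

/-- The component `ξ_1` of the intrinsic torsion in `𝒲₁`. -/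
def xi₁ (x : M) :
    TangentSpace I x →ₗ[ℝ] TangentSpace I x →ₗ[ℝ] TangentSpace I x :=
  comp₁ (J.at x) (intrinsicTorsion J nabla x)

/-- The component `ξ_2` of the intrinsic torsion in `𝒲₂`. -/
def xi₂ (x : M) :
    TangentSpace I x →ₗ[ℝ] TangentSpace I x →ₗ[ℝ] TangentSpace I x :=
  comp₂ (J.at x) (intrinsicTorsion J nabla x)

/-- The component `ξ_3` of the intrinsic torsion in `𝒲₃`, where `dim M = 2 n`. -/
def xi₃ (n : ℕ) (x : M) :
    TangentSpace I x →ₗ[ℝ] TangentSpace I x →ₗ[ℝ] TangentSpace I x :=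
  comp₃ n (J.at x) (intrinsicTorsion J nabla x)

/-- The component `ξ_4` of the intrinsic torsion in `𝒲₄`, where `dim M = 2 n`. -/
def xi₄ (n : ℕ) (x : M) :
    TangentSpace I x →ₗ[ℝ] TangentSpace I x →ₗ[ℝ] TangentSpace I x :=
  comp₄ n (J.at x) (intrinsicTorsion J nabla x)

/-- The eight `⟦λ^{2,0}⟧`-terms, on a manifold of dimension `2 n`, coming from
`∇̃ξ_1`, `∇̃ξ_3`, `∇̃ξ_4`, `ξ_1 ⊙ ξ_3`, `ξ_1 ⊙ ξ_4`, `ξ_2 ⊙ ξ_3`, `ξ_2 ⊙ ξ_4`, `ξ_3 ⊙ ξ_4`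
in this order. -/
def relationTerm {ι : Type*} [Fintype ι] (n : ℕ) (x : M)
    (e : OrthonormalBasis ι ℝ (TangentSpace I x)) :
    Fin 8 → TangentSpace I x → TangentSpace I x → ℝ :=
  ![divTerm e (tensorDeriv (minimalConnection J nabla) (xi₁ J nabla) x),
    divTerm e (tensorDeriv (minimalConnection J nabla) (xi₃ J nabla n) x),
    divTerm e (tensorDeriv (minimalConnection J nabla) (xi₄ J nabla n) x),
    mixedTerm e (xi₃ J nabla n x) (xi₁ J nabla x),
    traceTerm e (xi₁ J nabla x) (xi₄ J nabla n x),
    mixedTerm e (xi₃ J nabla n x) (xi₂ J nabla x),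
    traceTerm e (xi₂ J nabla x) (xi₄ J nabla n x),
    traceTerm e (xi₃ J nabla n x) (xi₄ J nabla n x)]

/-- The `⟦λ^{2,0}⟧`-term `∑ i, ⟨(∇̃_{e_i} ξ_2)_{e_i} X, Y⟩` coming from `∇̃ξ_2`. -/
def divXi₂ {ι : Type*} [Fintype ι] (x : M) (e : OrthonormalBasis ι ℝ (TangentSpace I x)) :
    TangentSpace I x → TangentSpace I x → ℝ :=
  divTerm e (tensorDeriv (minimalConnection J nabla) (xi₂ J nabla) x)

end Geometry

end AlmostHermitian

end

open AlmostHermitian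

noncomputable section

namespace AlmostHermitian

/-! ### Sums over orthonormal bases -/

section Sums

variable {V : Type*} [NormedAddCommGroup V] [InnerProductSpace ℝ V]
  {ι κ : Type*} [Fintype ι] [Fintype κ]

/-! The two sides of the theorem are universal expressions in `ξ` and `∇̃ξ`, so the proof splits
into calculus, which reduces `d²ω` to such an expression, and linear algebra on a single tangent
space.

Calculus. The minimal connection preserves the metric and `J`, and its torsion is `(a, b) ↦ ξ_a b -
ξ_b a`. Since `ω` is parallel for it, `dω` consists of torsion alone: it is twice the cyclic sum of
`⟨ξ_u v, J w⟩` (`kahlerForm_extDeriv`). A second differentiation gives the alternation of `∇̃ξ` plus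
torsion insertions, the form `cyclicFormDeriv` (`extDeriv₃_extDeriv₂_kahlerForm`). The projections
to the modules `𝒲_i` are built from the metric and `J`, so they commute with `∇̃`, and `∇̃ξ_i` is
the `i`-th component of `∇̃ξ` (`relationTerm_eq`). The connection carries no regularity hypothesis;
differentiability of `ξ` comes from the Koszul formula in a smooth orthonormal frame.

Algebra. Contraction with `ω` inserts the pairs `(J e_i, e_i)`. Summing over `J e_i` instead of
`e_i` shows that, among the quadratic contractions, the projection to `⟦λ^{2,0}⟧` keeps only `𝒲₁ +
𝒲₂` against `𝒲₃ + 𝒲₄`. In the linear part the cyclic sum does not see `𝒲₂`, so `t_0` is absent from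
the relation. A tensor in `𝒲₄` is determined by its trace vector, up to the factor `2 (n - 1)`; this
is where the coefficients depending on `n` arise. The outcome is `lambda20Part_cyclicFormDeriv`, and
the same contractions expand the two curvature expressions (`ricciStarExpr_eq`,
`ricciStarExpr'_eq`).

Finally `d²ω = 0`, because local extensions of tangent vectors commute and second derivatives then
cancel in pairs. This is the relation; its coefficients are the differences of those of `A` and `B`,
so it is equivalent to `A = B`. -/

theorem sum_inner_smul_map {W : Type*} [AddCommGroup W] [Module ℝ W]
    (e : OrthonormalBasis ι ℝ V) (f : V →ₗ[ℝ] W) (u : V) :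
    ∑ i, inner ℝ (e i) u • f (e i) = f u := by
  conv_rhs => rw [← e.sum_repr' u]
  simp [map_sum]

/-- The metric contraction of a bilinear map does not depend on the orthonormal basis. -/
theorem sum_bilin_eq {W : Type*} [AddCommGroup W] [Module ℝ W]
    (e : OrthonormalBasis ι ℝ V) (b : OrthonormalBasis κ ℝ V) (f : V →ₗ[ℝ] V →ₗ[ℝ] W) :
    ∑ i, f (e i) (e i) = ∑ k, f (b k) (b k) := by
  have h1 : ∀ i, f (e i) (e i) = ∑ k, inner ℝ (b k) (e i) • f (b k) (e i) := fun i ↦ by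
    have := sum_inner_smul_map b (f.flip (e i)) (e i)
    simpa using this.symm
  simp_rw [h1]
  rw [Finset.sum_comm]
  refine Finset.sum_congr rfl fun k _ ↦ ?_
  simp_rw [real_inner_comm (e _) (b k)]
  exact sum_inner_smul_map e (f (b k)) (b k)

/-- `J` is an orthogonal complex structure on a Euclidean vector space. -/
structure IsOrthogonalComplex (J : V →ₗ[ℝ] V) : Prop where
  sq : ∀ v, J (J v) = -v
  inner_map : ∀ v w, inner ℝ (J v) (J w) = inner ℝ v w

variable {J : V →ₗ[ℝ] V}

theorem inner_J_left (hJ : IsOrthogonalComplex J) (v w : V) : inner ℝ (J v) w = -inner ℝ v (J w) := by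
  have := hJ.inner_map v (J w)
  rw [hJ.sq, inner_neg_right] at this
  linarith

/-- The orthonormal basis `J e_i`. -/
def rotatedBasis (hJ : IsOrthogonalComplex J) (e : OrthonormalBasis ι ℝ V) :
    OrthonormalBasis ι ℝ V :=
  e.map <| LinearIsometryEquiv.mk
    (LinearEquiv.ofLinearMap J (-J) (by ext v; simp [hJ.sq]) (by ext v; simp [hJ.sq])) fun v ↦ by
      have h : ‖J v‖ ^ 2 = ‖v‖ ^ 2 := by
        rw [← real_inner_self_eq_norm_sq, ← real_inner_self_eq_norm_sq, hJ.inner_map]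
      exact (pow_left_inj₀ (norm_nonneg (J v)) (norm_nonneg v) two_ne_zero).1 h

/-- The vectors `J e_i` form another orthonormal basis. Nearly all the vanishing and sign statements
for contractions come from this substitution. -/
theorem sum_bilin_J {W : Type*} [AddCommGroup W] [Module ℝ W]
    (hJ : IsOrthogonalComplex J)
    (e : OrthonormalBasis ι ℝ V) (f : V →ₗ[ℝ] V →ₗ[ℝ] W) :
    ∑ i, f (J (e i)) (J (e i)) = ∑ i, f (e i) (e i) :=
  sum_bilin_eq (rotatedBasis hJ e) e f

theorem sum_bilin_J_left {W : Type*} [AddCommGroup W] [Module ℝ W]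
    (hJ : IsOrthogonalComplex J)
    (e : OrthonormalBasis ι ℝ V) (f : V →ₗ[ℝ] V →ₗ[ℝ] W) :
    ∑ i, f (J (e i)) (e i) = -∑ i, f (e i) (J (e i)) := by
  have := sum_bilin_J hJ e (f.compl₁₂ LinearMap.id J)
  simp only [LinearMap.compl₁₂_apply, LinearMap.id_apply, hJ.sq, map_neg] at this
  rw [← this, Finset.sum_neg_distrib, neg_neg]

theorem traceVector_eq [FiniteDimensional ℝ V] (e : OrthonormalBasis ι ℝ V)
    (T : V →ₗ[ℝ] V →ₗ[ℝ] V) : traceVector T = ∑ i, T (e i) (e i) :=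
  sum_bilin_eq _ e T

end Sums

/-! ### The Gray-Hervella decomposition -/

section Decomposition

variable {V : Type*} [NormedAddCommGroup V] [InnerProductSpace ℝ V] {J : V →ₗ[ℝ] V}
  {T : V →ₗ[ℝ] V →ₗ[ℝ] V}

theorem inner_skew (hT : T ∈ torsionSpace J) (u v w : V) :
    inner ℝ (T u v) w = -inner ℝ (T u w) v := by
  rw [hT.1 u v w, real_inner_comm]

theorem map_J_right (hT : T ∈ torsionSpace J) (u v : V) : T u (J v) = -J (T u v) := hT.2 u v

theorem inner_J_right (hJ : IsOrthogonalComplex J) (hT : T ∈ torsionSpace J) (u v w : V) :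
    inner ℝ (T u v) (J w) = inner ℝ (T u (J v)) w := by
  rw [hT.2, inner_neg_left, inner_J_left hJ, neg_neg]

theorem part₁₂_apply (u v : V) :
    part₁₂ J T u v = (1 / 2 : ℝ) • (T u v - T (J u) (J v)) := by
  simp [part₁₂]

theorem part₃₄_apply (u v : V) :
    part₃₄ J T u v = (1 / 2 : ℝ) • (T u v + T (J u) (J v)) := by
  simp [part₃₄]

theorem part₁₂_add_part₃₄ : part₁₂ J T + part₃₄ J T = T := by
  ext u v
  simp only [LinearMap.add_apply, part₁₂_apply, part₃₄_apply]
  module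

theorem compl₁₂_mem_torsionSpace (hJ : IsOrthogonalComplex J) (hT : T ∈ torsionSpace J) :
    T.compl₁₂ J J ∈ torsionSpace J := by
  refine ⟨fun u v w ↦ ?_, fun u v ↦ ?_⟩
  · simp only [LinearMap.compl₁₂_apply]
    rw [hT.1, hT.2, inner_neg_right, inner_J_left hJ]
  · simp only [LinearMap.compl₁₂_apply, hT.2, map_neg]

theorem part₁₂_mem (hJ : IsOrthogonalComplex J) (hT : T ∈ torsionSpace J) :
    part₁₂ J T ∈ torsionSpace J :=
  Submodule.smul_mem _ _ (Submodule.sub_mem _ hT (compl₁₂_mem_torsionSpace hJ hT))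

theorem part₃₄_mem (hJ : IsOrthogonalComplex J) (hT : T ∈ torsionSpace J) :
    part₃₄ J T ∈ torsionSpace J :=
  Submodule.smul_mem _ _ (Submodule.add_mem _ hT (compl₁₂_mem_torsionSpace hJ hT))

theorem part₁₂_J (hJ : IsOrthogonalComplex J) (u v : V) :
    part₁₂ J T (J u) (J v) = -part₁₂ J T u v := by
  simp only [part₁₂_apply, hJ.sq, map_neg, LinearMap.neg_apply, neg_neg]
  module

theorem part₃₄_J (hJ : IsOrthogonalComplex J) (u v : V) :
    part₃₄ J T (J u) (J v) = part₃₄ J T u v := by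
  simp only [part₃₄_apply, hJ.sq, map_neg, LinearMap.neg_apply, neg_neg]
  module

theorem map_J_left_of_anti (hJ : IsOrthogonalComplex J)
    (h : ∀ u v, T (J u) (J v) = -T u v) (u v : V) : T (J u) v = T u (J v) := by
  have := h u (J v)
  simpa [hJ.sq] using this

theorem map_J_left_of_inv (hJ : IsOrthogonalComplex J)
    (h : ∀ u v, T (J u) (J v) = T u v) (u v : V) : T (J u) v = -T u (J v) := by
  have := h u (J v)
  simp only [hJ.sq, map_neg] at this
  rw [← this, neg_neg]

theorem vectorTensor_apply (θ u v : V) :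
    vectorTensor J θ u v = inner ℝ u v • θ - inner ℝ θ v • u + inner ℝ u (J v) • J θ
      - inner ℝ θ (J v) • J u := rfl

theorem vectorTensor_mem (hJ : IsOrthogonalComplex J) (θ : V) :
    vectorTensor J θ ∈ torsionSpace J := by
  refine ⟨fun u v w ↦ ?_, fun u v ↦ ?_⟩
  · simp only [vectorTensor_apply, inner_add_left, inner_sub_left, real_inner_smul_left,
      inner_add_right, inner_sub_right, real_inner_smul_right]
    rw [inner_J_left hJ θ w, inner_J_left hJ u w, real_inner_comm u v, real_inner_comm θ v,
      real_inner_comm (J θ) v, real_inner_comm (J u) v, inner_J_left hJ θ v, inner_J_left hJ u v]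
    ring
  · simp only [vectorTensor_apply, map_add, map_sub, map_smul, hJ.sq, inner_neg_right]
    module

theorem vectorTensor_inv (hJ : IsOrthogonalComplex J) (θ u v : V) :
    vectorTensor J θ (J u) (J v) = vectorTensor J θ u v := by
  simp only [vectorTensor_apply, hJ.sq, inner_neg_right, hJ.inner_map]
  rw [inner_J_left hJ u v]
  module

theorem vectorTensor_self (θ u : V) :
    vectorTensor J θ θ u = 0 := by
  simp only [vectorTensor_apply]
  module

theorem vectorTensor_smul (c : ℝ) (θ : V) : vectorTensor J (c • θ) = c • vectorTensor J θ := by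
  ext u v
  simp only [vectorTensor_apply, LinearMap.smul_apply, real_inner_smul_left, map_smul]
  module

theorem sum_J_skew {ι : Type*} [Fintype ι] (hJ : IsOrthogonalComplex J)
    (e : OrthonormalBasis ι ℝ V) (u : V) : ∑ i, inner ℝ u (J (e i)) • J (e i) = u := by
  simp_rw [real_inner_comm (J (e _)) u]
  exact sum_inner_smul_map (rotatedBasis hJ e) LinearMap.id u

theorem inner_J_self (hJ : IsOrthogonalComplex J) (u : V) : inner ℝ u (J u) = 0 := by
  have := inner_J_left hJ u u
  rw [real_inner_comm] at this
  linarith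

variable [FiniteDimensional ℝ V]

/-- The adjoint in the definition contributes `⟨v, T_w u⟩`, and skewness of `T_v` turns the
subtracted term into the remaining cyclic one. -/
theorem inner_cyclicPart (hT : T ∈ torsionSpace J) (u v w : V) :
    inner ℝ (cyclicPart T u v) w
      = 1 / 3 * (inner ℝ (T u v) w + inner ℝ (T v w) u + inner ℝ (T w u) v) := by
  simp only [cyclicPart, LinearMap.mk₂_apply, real_inner_smul_left, inner_add_left, inner_sub_left,
    LinearMap.adjoint_inner_left, LinearMap.flip_apply]
  rw [inner_skew hT v u w, real_inner_comm v]
  ring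

theorem cyclicPart_skew (hT : T ∈ torsionSpace J) (u v w : V) :
    inner ℝ (cyclicPart T u v) w = -inner ℝ (cyclicPart T u w) v := by
  rw [inner_cyclicPart hT, inner_cyclicPart hT, inner_skew hT u v w, inner_skew hT v w u,
    inner_skew hT w u v]
  ring

theorem cyclicPart_cyclic (hT : T ∈ torsionSpace J) (u v w : V) :
    inner ℝ (cyclicPart T u v) w = inner ℝ (cyclicPart T v w) u := by
  rw [inner_cyclicPart hT, inner_cyclicPart hT]
  ring

/-- For a tensor with `T_{J u} J v = -T_u v`, `J` passes freely between the three slots of `⟨T_u v,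
w⟩`. The cyclic sum inherits this, which keeps the total skew-symmetrisation inside the torsion
space. -/
theorem inner_cyclicPart_J (hJ : IsOrthogonalComplex J) (hT : T ∈ torsionSpace J)
    (h : ∀ u v, T (J u) (J v) = -T u v) (u v w : V) :
    inner ℝ (cyclicPart T u (J v)) w = inner ℝ (cyclicPart T u v) (J w) := by
  rw [inner_cyclicPart hT, inner_cyclicPart hT, inner_J_right hJ hT u v w,
    map_J_left_of_anti hJ h v w, map_J_left_of_anti hJ h w u, inner_J_right hJ hT w u v]

theorem cyclicPart_mem (hJ : IsOrthogonalComplex J) (hT : T ∈ torsionSpace J)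
    (h : ∀ u v, T (J u) (J v) = -T u v) : cyclicPart T ∈ torsionSpace J := by
  refine ⟨fun u v w ↦ ?_, fun u v ↦ ext_inner_right ℝ fun w ↦ ?_⟩
  · rw [cyclicPart_skew hT, real_inner_comm]
  · rw [inner_cyclicPart_J hJ hT h, inner_neg_left, inner_J_left hJ, neg_neg]

theorem cyclicPart_anti (hJ : IsOrthogonalComplex J) (hT : T ∈ torsionSpace J)
    (h : ∀ u v, T (J u) (J v) = -T u v) (u v : V) :
    cyclicPart T (J u) (J v) = -cyclicPart T u v := by
  refine ext_inner_right ℝ fun w ↦ ?_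
  rw [inner_neg_left, inner_cyclicPart_J hJ hT h, cyclicPart_cyclic hT,
    inner_cyclicPart_J hJ hT h, hJ.sq, inner_neg_right, ← cyclicPart_cyclic hT]

theorem cyclicPart_self (hT : T ∈ torsionSpace J) (u : V) : cyclicPart T u u = 0 := by
  refine ext_inner_right ℝ fun w ↦ ?_
  have h := cyclicPart_cyclic hT w u u
  have h' := cyclicPart_skew hT w u u
  rw [inner_zero_left, ← h]
  linarith

/-! #### The components -/

theorem comp₁_mem (hJ : IsOrthogonalComplex J) (hT : T ∈ torsionSpace J) :
    comp₁ J T ∈ torsionSpace J :=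
  cyclicPart_mem hJ (part₁₂_mem hJ hT) (part₁₂_J hJ)

theorem comp₁_anti (hJ : IsOrthogonalComplex J) (hT : T ∈ torsionSpace J) (u v : V) :
    comp₁ J T (J u) (J v) = -comp₁ J T u v :=
  cyclicPart_anti hJ (part₁₂_mem hJ hT) (part₁₂_J hJ) u v

theorem comp₁_cyclic (hJ : IsOrthogonalComplex J) (hT : T ∈ torsionSpace J) (u v w : V) :
    inner ℝ (comp₁ J T u v) w = inner ℝ (comp₁ J T v w) u :=
  cyclicPart_cyclic (part₁₂_mem hJ hT) u v w

theorem comp₁_mem_W₁ (hJ : IsOrthogonalComplex J) (hT : T ∈ torsionSpace J) :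
    comp₁ J T ∈ W₁ J :=
  ⟨comp₁_mem hJ hT, cyclicPart_self (part₁₂_mem hJ hT)⟩

theorem comp₂_mem (hJ : IsOrthogonalComplex J) (hT : T ∈ torsionSpace J) :
    comp₂ J T ∈ torsionSpace J :=
  Submodule.sub_mem _ (part₁₂_mem hJ hT) (comp₁_mem hJ hT)

theorem comp₂_anti (hJ : IsOrthogonalComplex J) (hT : T ∈ torsionSpace J) (u v : V) :
    comp₂ J T (J u) (J v) = -comp₂ J T u v := by
  simp only [comp₂, LinearMap.sub_apply, part₁₂_J hJ, comp₁_anti hJ hT]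
  abel

theorem comp₂_cyclic (hJ : IsOrthogonalComplex J) (hT : T ∈ torsionSpace J) (u v w : V) :
    inner ℝ (comp₂ J T u v) w + inner ℝ (comp₂ J T v w) u + inner ℝ (comp₂ J T w u) v = 0 := by
  have h := part₁₂_mem hJ hT
  simp only [comp₂, LinearMap.sub_apply, inner_sub_left, comp₁, inner_cyclicPart h]
  ring

/-- As `J` moves freely between slots, the cyclic sum with `J` on the rotating third argument is the
plain cyclic sum at `(u, v, J w)`. -/
theorem comp₂_mem_W₂ (hJ : IsOrthogonalComplex J) (hT : T ∈ torsionSpace J) :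
    comp₂ J T ∈ W₂ J := by
  refine ⟨comp₂_mem hJ hT, fun u v w ↦ ?_⟩
  rw [inner_J_right hJ (comp₂_mem hJ hT) v w u,
    inner_J_right hJ (comp₂_mem hJ hT) w u v,
    ← map_J_left_of_anti hJ (comp₂_anti hJ hT) w u]
  exact comp₂_cyclic hJ hT u v (J w)

theorem traceVector_add (S T : V →ₗ[ℝ] V →ₗ[ℝ] V) :
    traceVector (S + T) = traceVector S + traceVector T := by
  simp [traceVector, Finset.sum_add_distrib]

theorem traceVector_smul (c : ℝ) (T : V →ₗ[ℝ] V →ₗ[ℝ] V) :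
    traceVector (c • T) = c • traceVector T := by
  simp [traceVector, Finset.smul_sum]

theorem traceVector_sub (S T : V →ₗ[ℝ] V →ₗ[ℝ] V) :
    traceVector (S - T) = traceVector S - traceVector T := by
  simp [traceVector]

/-- The term `⟨e_i, e_i⟩ θ` sums to `dim V` copies of `θ`; `⟨θ, e_i⟩ e_i` and `⟨θ, J e_i⟩ J e_i`
each remove one. With `dim V = 2 n` this explains the normalisation `1 / (2 (n - 1))` of the
`𝒲₄`-component. -/
theorem traceVector_vectorTensor (hJ : IsOrthogonalComplex J) (θ : V) :
    traceVector (vectorTensor J θ) = ((Module.finrank ℝ V : ℝ) - 2) • θ := by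
  have h := sum_inner_smul_map (stdOrthonormalBasis ℝ V) LinearMap.id θ
  simp only [LinearMap.id_apply, real_inner_comm θ] at h
  simp only [traceVector, vectorTensor_apply, inner_J_self hJ, zero_smul, add_zero,
    Finset.sum_sub_distrib, sum_J_skew hJ]
  rw [h]
  simp only [real_inner_self_eq_norm_sq, OrthonormalBasis.norm_eq_one, one_pow, one_smul,
    Finset.sum_const, Finset.card_univ, Fintype.card_fin, ← Nat.cast_smul_eq_nsmul ℝ]
  module

theorem traceVector_compl₁₂ (hJ : IsOrthogonalComplex J) :
    traceVector (T.compl₁₂ J J) = traceVector T :=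
  sum_bilin_J hJ (stdOrthonormalBasis ℝ V) T

theorem traceVector_part₃₄ (hJ : IsOrthogonalComplex J) :
    traceVector (part₃₄ J T) = traceVector T := by
  rw [part₃₄, traceVector_smul, traceVector_add, traceVector_compl₁₂ hJ]
  module

variable {n : ℕ}

theorem comp₄_mem (hJ : IsOrthogonalComplex J) : comp₄ n J T ∈ torsionSpace J :=
  Submodule.smul_mem _ _ (vectorTensor_mem hJ _)

theorem comp₄_inv (hJ : IsOrthogonalComplex J) (u v : V) :
    comp₄ n J T (J u) (J v) = comp₄ n J T u v := by
  simp only [comp₄, LinearMap.smul_apply, vectorTensor_inv hJ]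

theorem comp₄_mem_W₄ : comp₄ n J T ∈ W₄ J :=
  ⟨(1 / (2 * ((n : ℝ) - 1))) • traceVector T, (vectorTensor_smul _ _).symm⟩

theorem traceVector_comp₄ (hJ : IsOrthogonalComplex J) (hn : 2 ≤ n)
    (hV : Module.finrank ℝ V = 2 * n) : traceVector (comp₄ n J T) = traceVector T := by
  have : (2 : ℝ) ≤ n := by exact_mod_cast hn
  rw [comp₄, traceVector_smul, traceVector_vectorTensor hJ, hV, smul_smul]
  push_cast
  rw [show (1 / (2 * ((n : ℝ) - 1))) * (2 * (n : ℝ) - 2) = 1 by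
    have : (n : ℝ) - 1 ≠ 0 := by linarith
    field_simp, one_smul]

theorem comp₃_mem (hJ : IsOrthogonalComplex J) (hT : T ∈ torsionSpace J) :
    comp₃ n J T ∈ torsionSpace J :=
  Submodule.sub_mem _ (part₃₄_mem hJ hT) (comp₄_mem hJ)

theorem comp₃_inv (hJ : IsOrthogonalComplex J) (u v : V) :
    comp₃ n J T (J u) (J v) = comp₃ n J T u v := by
  simp only [comp₃, LinearMap.sub_apply, part₃₄_J hJ, comp₄_inv hJ]

theorem comp₃_mem_W₃ (hJ : IsOrthogonalComplex J) (hT : T ∈ torsionSpace J) (hn : 2 ≤ n)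
    (hV : Module.finrank ℝ V = 2 * n) : comp₃ n J T ∈ W₃ J := by
  refine ⟨comp₃_mem hJ hT, comp₃_inv hJ, ?_⟩
  rw [comp₃, traceVector_sub, traceVector_part₃₄ hJ, traceVector_comp₄ hJ hn hV, sub_self]

theorem comp₁_add_comp₂ : comp₁ J T + comp₂ J T = part₁₂ J T := by
  rw [comp₂, add_sub_cancel]

theorem comp₃_add_comp₄ : comp₃ n J T + comp₄ n J T = part₃₄ J T := by
  rw [comp₃, sub_add_cancel]

theorem sum_comp : T = comp₁ J T + comp₂ J T + comp₃ n J T + comp₄ n J T := by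
  rw [comp₁_add_comp₂, add_assoc, comp₃_add_comp₄, part₁₂_add_part₃₄]

end Decomposition

/-! ### Contractions of two torsion tensors -/

section Contraction

variable {V : Type*} [NormedAddCommGroup V] [InnerProductSpace ℝ V] {J : V →ₗ[ℝ] V}
  {ι : Type*} [Fintype ι] (e : OrthonormalBasis ι ℝ V) {P Q A B T : V →ₗ[ℝ] V →ₗ[ℝ] V}

/-- The contraction `∑ i, ⟨P_{Q_X e_i} e_i, Y⟩`. -/
def contraction (P Q : V →ₗ[ℝ] V →ₗ[ℝ] V) (X Y : V) : ℝ :=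
  ∑ i, inner ℝ (P (Q X (e i)) (e i)) Y

theorem contraction_add_left (P P' Q : V →ₗ[ℝ] V →ₗ[ℝ] V) (X Y : V) :
    contraction e (P + P') Q X Y = contraction e P Q X Y + contraction e P' Q X Y := by
  simp [contraction, inner_add_left, Finset.sum_add_distrib]

theorem contraction_add_right (P Q Q' : V →ₗ[ℝ] V →ₗ[ℝ] V) (X Y : V) :
    contraction e P (Q + Q') X Y = contraction e P Q X Y + contraction e P Q' X Y := by
  simp [contraction, inner_add_left, Finset.sum_add_distrib]

theorem contraction_smul_right (c : ℝ) (P Q : V →ₗ[ℝ] V →ₗ[ℝ] V) (X Y : V) :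
    contraction e P (c • Q) X Y = c * contraction e P Q X Y := by
  simp [contraction, real_inner_smul_left, Finset.mul_sum]

/-- The bilinear form `(a, b) ↦ ⟨P_{Q_X a} b, Y⟩`. -/
def contractionForm (P Q : V →ₗ[ℝ] V →ₗ[ℝ] V) (X Y : V) : V →ₗ[ℝ] V →ₗ[ℝ] ℝ :=
  LinearMap.mk₂ ℝ (fun a b ↦ inner ℝ (P (Q X a) b) Y)
    (fun _ _ _ ↦ by simp [inner_add_left]) (fun _ _ _ ↦ by simp [real_inner_smul_left])
    (fun _ _ _ ↦ by simp [inner_add_left]) (fun _ _ _ ↦ by simp [real_inner_smul_left])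

theorem sum_contractionForm_J (hJ : IsOrthogonalComplex J) (X Y : V) :
    ∑ i, inner ℝ (P (Q X (J (e i))) (J (e i))) Y = contraction e P Q X Y :=
  sum_bilin_J hJ e (contractionForm P Q X Y)

/-- The two outer `J`'s migrate inwards, one through `Q` and one through `P`, and turn both copies
of `e_i` into `J e_i`. The sign is decided by the `J`-type of `Q` alone. -/
theorem contraction_J_of_anti (hJ : IsOrthogonalComplex J) (hP : P ∈ torsionSpace J)
    (hQ : ∀ u v, Q (J u) (J v) = -Q u v) (X Y : V) :
    contraction e P Q (J X) (J Y) = contraction e P Q X Y := by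
  rw [← sum_contractionForm_J e hJ X Y]
  exact Finset.sum_congr rfl fun i _ ↦ by
    rw [inner_J_right hJ hP, map_J_left_of_anti hJ hQ]

theorem contraction_J_of_inv (hJ : IsOrthogonalComplex J) (hP : P ∈ torsionSpace J)
    (hQ : ∀ u v, Q (J u) (J v) = Q u v) (X Y : V) :
    contraction e P Q (J X) (J Y) = -contraction e P Q X Y := by
  rw [← sum_contractionForm_J e hJ X Y, contraction, ← Finset.sum_neg_distrib]
  exact Finset.sum_congr rfl fun i _ ↦ by
    rw [inner_J_right hJ hP, map_J_left_of_inv hJ hQ, map_neg, LinearMap.neg_apply, inner_neg_left]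

/-- Passing to the basis `J e_i` changes the sign once, because `Q_X` anticommutes with `J` while
`P` absorbs a pair of `J`'s. -/
theorem contraction_eq_zero (hJ : IsOrthogonalComplex J)
    (hP : ∀ u v, P (J u) (J v) = P u v) (hQ : Q ∈ torsionSpace J) (X Y : V) :
    contraction e P Q X Y = 0 := by
  have h : contraction e P Q X Y = -contraction e P Q X Y := by
    nth_rewrite 1 [← sum_contractionForm_J e hJ X Y]
    rw [contraction, ← Finset.sum_neg_distrib]
    exact Finset.sum_congr rfl fun i _ ↦ by
      rw [map_J_right hQ, map_neg, LinearMap.neg_apply, hP, inner_neg_left]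
  linarith

theorem contraction_eq_sum_sum (X Y : V) : contraction e P Q X Y
    = ∑ i, ∑ j, inner ℝ (Q X (e i)) (e j) * inner ℝ (P (e j) (e i)) Y := by
  refine Finset.sum_congr rfl fun i _ ↦ ?_
  have := sum_inner_smul_map e
    ((innerₗ V Y).comp (P.flip (e i))) (Q X (e i))
  simp only [LinearMap.comp_apply, LinearMap.flip_apply, innerₗ_apply_apply, smul_eq_mul] at this
  rw [real_inner_comm, ← this]
  exact Finset.sum_congr rfl fun j _ ↦ by rw [real_inner_comm (e j), real_inner_comm Y]

/-- Expand both vectors in the basis: skewness is used once for `A` and once for `B`, and the two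
signs cancel. This brings the mixed terms and the curvature terms to one kind of contraction. -/
theorem sum_inner_eq_contraction (hA : A ∈ torsionSpace J) (hB : B ∈ torsionSpace J) (X Y : V) :
    ∑ i, inner ℝ (A X (e i)) (B (e i) Y) = contraction e B A X Y := by
  rw [contraction_eq_sum_sum, Finset.sum_comm]
  refine Finset.sum_congr rfl fun i _ ↦ ?_
  rw [← e.sum_inner_mul_inner]
  refine Finset.sum_congr rfl fun j _ ↦ ?_
  rw [inner_skew hA X (e i) (e j), real_inner_comm (B (e i) Y), inner_skew hB (e i) Y (e j)]
  ring

theorem mixedTerm_eq (hA : A ∈ torsionSpace J) (hB : B ∈ torsionSpace J) (X Y : V) :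
    mixedTerm e A B X Y = contraction e B A X Y - contraction e B A Y X := by
  rw [mixedTerm, Finset.sum_sub_distrib, sum_inner_eq_contraction e hA hB,
    sum_inner_eq_contraction e hA hB]

/-- Both sides equal minus the double sum of `⟨T_{e_i} X, e_j⟩ ⟨T_{e_j} Y, e_i⟩`, which is symmetric
in `X` and `Y`. Hence this contraction disappears from skew-symmetrised expressions. -/
theorem sum_inner_comm (hT : T ∈ torsionSpace J) (X Y : V) :
    ∑ i, inner ℝ (T (T (e i) X) (e i)) Y = ∑ i, inner ℝ (T (T (e i) Y) (e i)) X := by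
  have h : ∀ X Y, ∑ i, inner ℝ (T (T (e i) X) (e i)) Y
      = -∑ i, ∑ j, inner ℝ (T (e i) X) (e j) * inner ℝ (T (e j) Y) (e i) := by
    intro X Y
    rw [← Finset.sum_neg_distrib]
    refine Finset.sum_congr rfl fun i _ ↦ ?_
    have := sum_inner_smul_map e ((innerₗ V Y).comp (T.flip (e i))) (T (e i) X)
    simp only [LinearMap.comp_apply, LinearMap.flip_apply, innerₗ_apply_apply, smul_eq_mul] at this
    rw [real_inner_comm, ← this, ← Finset.sum_neg_distrib]
    refine Finset.sum_congr rfl fun j _ ↦ ?_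
    rw [real_inner_comm (e j), real_inner_comm (T (e j) (e i)) Y, inner_skew hT (e j) (e i) Y]
    ring
  rw [h, h, Finset.sum_comm]
  simp_rw [mul_comm]

/-- Each summand of the `𝒲₄`-tensor collapses the sum over the basis. The two summands containing
`J` reproduce the other two, since `P_{J u} J v = -P_u v`; hence the factor `2`. -/
theorem contraction_vectorTensor (hJ : IsOrthogonalComplex J)
    (hP' : ∀ u v, P (J u) (J v) = -P u v) (θ X Y : V) :
    contraction e P (vectorTensor J θ) X Y
      = 2 * (inner ℝ (P θ X) Y - inner ℝ (P X θ) Y) := by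
  have key : ∀ u v : V, ∑ i, inner ℝ (e i) u * inner ℝ (P v (e i)) Y = inner ℝ (P v u) Y := by
    intro u v
    have := sum_inner_smul_map e ((innerₗ V Y).comp (P v)) u
    simp only [LinearMap.comp_apply, innerₗ_apply_apply, smul_eq_mul] at this
    rw [real_inner_comm, ← this]
    simp_rw [real_inner_comm Y]
  have h : ∀ i, inner ℝ (P (vectorTensor J θ X (e i)) (e i)) Y
      = inner ℝ (e i) X * inner ℝ (P θ (e i)) Y - inner ℝ (e i) θ * inner ℝ (P X (e i)) Y
      - inner ℝ (e i) (J X) * inner ℝ (P (J θ) (e i)) Y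
      + inner ℝ (e i) (J θ) * inner ℝ (P (J X) (e i)) Y := by
    intro i
    have h1 : inner ℝ X (J (e i)) = -inner ℝ (e i) (J X) := by
      rw [real_inner_comm, inner_J_left hJ]
    have h2 : inner ℝ θ (J (e i)) = -inner ℝ (e i) (J θ) := by
      rw [real_inner_comm, inner_J_left hJ]
    simp only [vectorTensor_apply, map_add, map_sub, map_smul, LinearMap.add_apply,
      LinearMap.sub_apply, LinearMap.smul_apply, inner_add_left, inner_sub_left,
      real_inner_smul_left, h1, h2, real_inner_comm (e i) X, real_inner_comm (e i) θ]
    rw [real_inner_comm X, real_inner_comm θ]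
    ring
  rw [contraction, Finset.sum_congr rfl fun i _ ↦ h i, Finset.sum_add_distrib,
    Finset.sum_sub_distrib, Finset.sum_sub_distrib, key, key, key, key, hP', hP']
  simp only [inner_neg_left]
  ring

end Contraction

/-! ### The two curvature expressions in terms of the components of the torsion -/

section Expansion

set_option linter.unusedSectionVars false

variable {V : Type*} [NormedAddCommGroup V] [InnerProductSpace ℝ V] [FiniteDimensional ℝ V]
  {J : V →ₗ[ℝ] V} {T : V →ₗ[ℝ] V →ₗ[ℝ] V} {D : V →ₗ[ℝ] V →ₗ[ℝ] V →ₗ[ℝ] V}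
  {ι : Type*} [Fintype ι] (e : OrthonormalBasis ι ℝ V) {n : ℕ}

/-! #### Linearity of the components -/

theorem cyclicPart_add (S T : V →ₗ[ℝ] V →ₗ[ℝ] V) :
    cyclicPart (S + T) = cyclicPart S + cyclicPart T := by
  ext u v
  simp only [cyclicPart, LinearMap.mk₂_apply, LinearMap.add_apply]
  rw [show (S + T).flip u = S.flip u + T.flip u from rfl, map_add, LinearMap.add_apply]
  module

theorem cyclicPart_smul (c : ℝ) (T : V →ₗ[ℝ] V →ₗ[ℝ] V) :
    cyclicPart (c • T) = c • cyclicPart T := by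
  ext u v
  simp only [cyclicPart, LinearMap.mk₂_apply, LinearMap.smul_apply]
  rw [show (c • T).flip u = c • T.flip u from rfl, map_smulₛₗ, LinearMap.smul_apply, conj_trivial]
  module

theorem part₁₂_add (S T : V →ₗ[ℝ] V →ₗ[ℝ] V) : part₁₂ J (S + T) = part₁₂ J S + part₁₂ J T := by
  ext u v
  simp only [part₁₂_apply, LinearMap.add_apply]
  module

theorem part₁₂_smul (c : ℝ) (T : V →ₗ[ℝ] V →ₗ[ℝ] V) : part₁₂ J (c • T) = c • part₁₂ J T := by
  ext u v
  simp only [part₁₂_apply, LinearMap.smul_apply]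
  module

/-- `comp₁` as a linear map. -/
def comp₁Linear (J : V →ₗ[ℝ] V) : (V →ₗ[ℝ] V →ₗ[ℝ] V) →ₗ[ℝ] (V →ₗ[ℝ] V →ₗ[ℝ] V) where
  toFun := comp₁ J
  map_add' S T := by rw [comp₁, part₁₂_add, cyclicPart_add]; rfl
  map_smul' c T := by rw [comp₁, part₁₂_smul, cyclicPart_smul]; rfl

/-- `part₃₄` as a linear map. -/
def part₃₄Linear (J : V →ₗ[ℝ] V) : (V →ₗ[ℝ] V →ₗ[ℝ] V) →ₗ[ℝ] (V →ₗ[ℝ] V →ₗ[ℝ] V) where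
  toFun := part₃₄ J
  map_add' S T := by
    ext u v
    simp only [part₃₄_apply, LinearMap.add_apply]
    module
  map_smul' c T := by
    ext u v
    simp only [part₃₄_apply, LinearMap.smul_apply, RingHom.id_apply]
    module

/-- The bilinear form `(a, b) ↦ ⟨(D_a)_b X, Y⟩`. -/
def divForm (D : V →ₗ[ℝ] V →ₗ[ℝ] V →ₗ[ℝ] V) (X Y : V) : V →ₗ[ℝ] V →ₗ[ℝ] ℝ :=
  LinearMap.mk₂ ℝ (fun a b ↦ inner ℝ (D a b X) Y)
    (fun _ _ _ ↦ by simp [inner_add_left]) (fun _ _ _ ↦ by simp [real_inner_smul_left])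
    (fun _ _ _ ↦ by simp [inner_add_left]) (fun _ _ _ ↦ by simp [real_inner_smul_left])

theorem divTerm_J (hJ : IsOrthogonalComplex J) (X Y : V) :
    ∑ i, inner ℝ (D (J (e i)) (J (e i)) X) Y = divTerm e (fun u v w ↦ D u v w) X Y :=
  sum_bilin_J hJ e (divForm D X Y)

/-! #### The terms -/

theorem traceTerm_eq (hJ : IsOrthogonalComplex J) (hn : 2 ≤ n)
    (hV : Module.finrank ℝ V = 2 * n) (A : V →ₗ[ℝ] V →ₗ[ℝ] V) (X Y : V) :
    traceTerm e A (comp₄ n J T) X Y = inner ℝ (A (traceVector T) X) Y := by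
  rw [traceTerm, ← sum_inner, ← LinearMap.sum_apply, ← map_sum, ← traceVector_eq,
    traceVector_comp₄ hJ hn hV]

/-- The skew-symmetrised contraction of the `𝒲₁ + 𝒲₂`-part with the `𝒲₃ + 𝒲₄`-part. -/
theorem contraction_part_skew (hJ : IsOrthogonalComplex J) (hT : T ∈ torsionSpace J) (hn : 2 ≤ n)
    (hV : Module.finrank ℝ V = 2 * n) (X Y : V) :
    contraction e (part₁₂ J T) (part₃₄ J T) X Y - contraction e (part₁₂ J T) (part₃₄ J T) Y X
      = mixedTerm e (comp₃ n J T) (comp₁ J T) X Y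
        + 4 / ((n : ℝ) - 1) * traceTerm e (comp₁ J T) (comp₄ n J T) X Y
        + mixedTerm e (comp₃ n J T) (comp₂ J T) X Y
        + 1 / ((n : ℝ) - 1) * traceTerm e (comp₂ J T) (comp₄ n J T) X Y := by
  have hn' : (n : ℝ) - 1 ≠ 0 := by
    have : (2 : ℝ) ≤ n := by exact_mod_cast hn
    linarith
  -- With `θ` the trace vector, `𝒲₄` contributes `(2⟨P_θ X, Y⟩ - ⟨P_X θ, Y⟩ + ⟨P_Y θ, X⟩) / (n -
  -- 1)`. For `P` in `𝒲₁` total skewness makes the bracket `4⟨P_θ X, Y⟩`; for `P` in `𝒲₂` the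
  -- vanishing cyclic sum makes it `2 - 1 = 1` times `⟨P_θ X, Y⟩`.
  have h1 := comp₁_cyclic hJ hT (traceVector T) X Y
  have h1' := comp₁_cyclic hJ hT X Y (traceVector T)
  have h1s := inner_skew (comp₁_mem hJ hT) X Y (traceVector T)
  have h2 := comp₂_cyclic hJ hT (traceVector T) X Y
  have h2s := inner_skew (comp₂_mem hJ hT) X Y (traceVector T)
  simp only [mixedTerm_eq e (comp₃_mem hJ hT) (comp₁_mem hJ hT),
    mixedTerm_eq e (comp₃_mem hJ hT) (comp₂_mem hJ hT), traceTerm_eq e hJ hn hV]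
  rw [← comp₁_add_comp₂, ← comp₃_add_comp₄ (n := n)]
  simp only [contraction_add_left, contraction_add_right]
  simp only [comp₄, contraction_smul_right,
    contraction_vectorTensor e hJ (comp₁_anti hJ hT),
    contraction_vectorTensor e hJ (comp₂_anti hJ hT)]
  have h1t := inner_skew (comp₁_mem hJ hT) (traceVector T) X Y
  have h2t := inner_skew (comp₂_mem hJ hT) (traceVector T) X Y
  field_simp
  linarith

/-- The signs are the `J`-types of the components. The `𝒲₄`-component drops out because its tensor
vanishes when its own vector is inserted first. -/
theorem inner_trace_J (hJ : IsOrthogonalComplex J) (hT : T ∈ torsionSpace J) (hn : 2 ≤ n)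
    (hV : Module.finrank ℝ V = 2 * n) (X Y : V) :
    inner ℝ (T (J (traceVector T)) X) (J Y)
      = -traceTerm e (comp₁ J T) (comp₄ n J T) X Y - traceTerm e (comp₂ J T) (comp₄ n J T) X Y
        + traceTerm e (comp₃ n J T) (comp₄ n J T) X Y := by
  simp only [traceTerm_eq e hJ hn hV]
  rw [inner_J_right hJ hT]
  nth_rewrite 1 [sum_comp (T := T) (J := J) (n := n)]
  have h4 : comp₄ n J T (traceVector T) X = 0 := by
    rw [comp₄, LinearMap.smul_apply, LinearMap.smul_apply, vectorTensor_self, smul_zero]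
  simp only [LinearMap.add_apply, comp₁_anti hJ hT, comp₂_anti hJ hT, comp₃_inv hJ, comp₄_inv hJ,
    h4, inner_add_left, inner_neg_left, inner_zero_left]
  ring

/-- The divergence of a `𝒲₄`-tensor field only sees the derivative of its trace vector, in the
directions `X`, `Y`, `J X`, `J Y`. It is used from right to left, to recognise traces of `∇̃_X ξ` as
multiples of `t_3`. -/
theorem divTerm_comp₄ (hJ : IsOrthogonalComplex J) (hn : 2 ≤ n) (X Y : V) :
    2 * ((n : ℝ) - 1) * divTerm e (fun u v w ↦ comp₄ n J (D u) v w) X Y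
      = inner ℝ (traceVector (D X)) Y - inner ℝ (traceVector (D Y)) X
        - inner ℝ (traceVector (D (J X))) (J Y) + inner ℝ (traceVector (D (J Y))) (J X) := by
  have hn' : (n : ℝ) - 1 ≠ 0 := by
    have : (2 : ℝ) ≤ n := by exact_mod_cast hn
    linarith
  let t : V →ₗ[ℝ] V :=
    { toFun := fun u ↦ traceVector (D u)
      map_add' := fun u v ↦ by rw [map_add, traceVector_add]
      map_smul' := fun c u ↦ by rw [map_smul, traceVector_smul, RingHom.id_apply] }
  have key : ∀ u v : V, ∑ i, inner ℝ (e i) u * inner ℝ (t (e i)) v = inner ℝ (t u) v := by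
    intro u v
    have := sum_inner_smul_map e ((innerₗ V v).comp t) u
    simp only [LinearMap.comp_apply, innerₗ_apply_apply, smul_eq_mul] at this
    rw [real_inner_comm, ← this]
    simp_rw [real_inner_comm v]
  have h : ∀ i, inner ℝ (comp₄ n J (D (e i)) (e i) X) Y = 1 / (2 * ((n : ℝ) - 1)) *
      (inner ℝ (e i) X * inner ℝ (t (e i)) Y - inner ℝ (e i) Y * inner ℝ (t (e i)) X
        - inner ℝ (e i) (J X) * inner ℝ (t (e i)) (J Y)
        + inner ℝ (e i) (J Y) * inner ℝ (t (e i)) (J X)) := by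
    intro i
    change inner ℝ ((1 / (2 * ((n : ℝ) - 1))) • vectorTensor J (t (e i)) (e i) X) Y = _
    simp only [vectorTensor_apply, real_inner_smul_left, inner_add_left, inner_sub_left,
      inner_J_left hJ]
    ring
  rw [divTerm, Finset.sum_congr rfl fun i _ ↦ h i, ← Finset.mul_sum, Finset.sum_add_distrib,
    Finset.sum_sub_distrib, Finset.sum_sub_distrib, key, key, key, key]
  simp only [t, LinearMap.coe_mk, AddHom.coe_mk]
  field_simp

/-! #### The two expressions for the `*`-Ricci curvature -/

/-- Of the four blocks of `T ⊗ T`, those with right factor in `𝒲₁ + 𝒲₂` are `J`-invariant and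
cancel, and `𝒲₃ + 𝒲₄` against itself contracts to zero. The remaining block changes sign, hence is
doubled. -/
theorem contraction_proj (hJ : IsOrthogonalComplex J) (hT : T ∈ torsionSpace J) (X Y : V) :
    contraction e T T X Y - contraction e T T (J X) (J Y)
      = 2 * contraction e (part₁₂ J T) (part₃₄ J T) X Y := by
  have hP := part₁₂_mem hJ hT
  have hQ := part₃₄_mem hJ hT
  conv_lhs => rw [← part₁₂_add_part₃₄ (J := J) (T := T)]
  simp only [contraction_add_left, contraction_add_right,
    contraction_J_of_anti e hJ hP (part₁₂_J hJ (T := T)),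
    contraction_J_of_anti e hJ hQ (part₁₂_J hJ (T := T)),
    contraction_J_of_inv e hJ hP (part₃₄_J hJ (T := T)),
    contraction_eq_zero e hJ (part₃₄_J hJ (T := T)) hQ]
  ring

theorem ricciTerm_eq (hT : T ∈ torsionSpace J) (hD : ∀ u, D u ∈ torsionSpace J) (X Y : V) :
    ricciTerm e (fun u v w ↦ D u v w) T X Y
      = ∑ i, inner ℝ (D (e i) X Y) (e i) + inner ℝ (traceVector (D X)) Y
        + contraction e T T X Y := by
  rw [ricciTerm, traceVector_eq e, sum_inner, contraction, ← Finset.sum_add_distrib,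
    ← Finset.sum_add_distrib]
  refine Finset.sum_congr rfl fun i _ ↦ ?_
  rw [inner_skew (hD X) (e i) Y, inner_skew hT _ Y]
  ring

/-- The `J`-projection leaves twice the `𝒲₁ + 𝒲₂`-part. Skew-symmetrising in `X`, `Y` doubles a
totally skew tensor, whereas a vanishing cyclic sum turns it into minus the tensor with `u` in
front; hence `4` and `-2`. -/
theorem inner_cyclic_proj (hJ : IsOrthogonalComplex J) (hT : T ∈ torsionSpace J) (u X Y : V) :
    inner ℝ (T X Y) u - inner ℝ (T Y X) u - inner ℝ (T (J X) (J Y)) u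
      + inner ℝ (T (J Y) (J X)) u
      = 4 * inner ℝ (comp₁ J T u X) Y - 2 * inner ℝ (comp₂ J T u X) Y := by
  have h : ∀ X Y, inner ℝ (T X Y) u - inner ℝ (T (J X) (J Y)) u
      = 2 * inner ℝ (comp₁ J T X Y) u + 2 * inner ℝ (comp₂ J T X Y) u := by
    intro X Y
    rw [← mul_add, ← inner_add_left, ← LinearMap.add_apply, ← LinearMap.add_apply,
      comp₁_add_comp₂, part₁₂_apply, real_inner_smul_left, inner_sub_left]
    ring
  have a1 := comp₁_cyclic hJ hT u X Y
  have a2 := comp₁_cyclic hJ hT X Y u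
  have a3 := comp₁_cyclic hJ hT Y u X
  have a4 := inner_skew (comp₁_mem hJ hT) Y X u
  have b1 := comp₂_cyclic hJ hT u X Y
  have b2 := inner_skew (comp₂_mem hJ hT) Y X u
  linarith [h X Y, h Y X]

theorem ricciStarExpr_eq (hJ : IsOrthogonalComplex J) (hT : T ∈ torsionSpace J)
    (hD : ∀ u, D u ∈ torsionSpace J) (hn : 2 ≤ n) (hV : Module.finrank ℝ V = 2 * n) (X Y : V) :
    ricciStarExpr J e (fun u v w ↦ D u v w) T X Y
      = -divTerm e (fun u v w ↦ comp₂ J (D u) v w) X Y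
        + 2 * divTerm e (fun u v w ↦ comp₁ J (D u) v w) X Y
        + ((n : ℝ) - 1) * divTerm e (fun u v w ↦ comp₄ n J (D u) v w) X Y
        + mixedTerm e (comp₃ n J T) (comp₁ J T) X Y
        + 4 / ((n : ℝ) - 1) * traceTerm e (comp₁ J T) (comp₄ n J T) X Y
        + mixedTerm e (comp₃ n J T) (comp₂ J T) X Y
        + 1 / ((n : ℝ) - 1) * traceTerm e (comp₂ J T) (comp₄ n J T) X Y := by
  have h1 := contraction_part_skew e hJ hT hn hV X Y
  have h2 := divTerm_comp₄ (D := D) e hJ hn X Y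
  have h3 := contraction_proj e hJ hT X Y
  have h4 := contraction_proj e hJ hT Y X
  have h5 : ∑ i, inner ℝ (D (e i) X Y) (e i) - ∑ i, inner ℝ (D (e i) Y X) (e i)
      - ∑ i, inner ℝ (D (e i) (J X) (J Y)) (e i) + ∑ i, inner ℝ (D (e i) (J Y) (J X)) (e i)
      = 4 * divTerm e (fun u v w ↦ comp₁ J (D u) v w) X Y
        - 2 * divTerm e (fun u v w ↦ comp₂ J (D u) v w) X Y := by
    simp only [divTerm, Finset.mul_sum, ← Finset.sum_sub_distrib, ← Finset.sum_add_distrib]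
    exact Finset.sum_congr rfl fun i _ ↦ inner_cyclic_proj hJ (hD _) _ _ _
  simp only [ricciStarExpr, ricciTerm_eq e hT hD]
  linarith

/-- The inserted pair `(J e_i, J X)` acts on the components with signs `-, -, +, +`; the quadratic
term is the trace contraction of `inner_trace_J`. -/
theorem ricciStarExpr'_eq (hJ : IsOrthogonalComplex J) (hT : T ∈ torsionSpace J)
    (hD : ∀ u, D u ∈ torsionSpace J) (hn : 2 ≤ n) (hV : Module.finrank ℝ V = 2 * n) (X Y : V) :
    ricciStarExpr' J e (fun u v w ↦ D u v w) T X Y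
      = -divTerm e (fun u v w ↦ comp₂ J (D u) v w) X Y
        - divTerm e (fun u v w ↦ comp₁ J (D u) v w) X Y
        + divTerm e (fun u v w ↦ comp₃ n J (D u) v w) X Y
        + divTerm e (fun u v w ↦ comp₄ n J (D u) v w) X Y
        + traceTerm e (comp₁ J T) (comp₄ n J T) X Y + traceTerm e (comp₂ J T) (comp₄ n J T) X Y
        - traceTerm e (comp₃ n J T) (comp₄ n J T) X Y := by
  have h1 := inner_trace_J e hJ hT hn hV X Y
  have h2 : ∑ i, inner ℝ (D (e i) (J (e i)) (J X)) Y
      = -divTerm e (fun u v w ↦ comp₂ J (D u) v w) X Y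
        - divTerm e (fun u v w ↦ comp₁ J (D u) v w) X Y
        + divTerm e (fun u v w ↦ comp₃ n J (D u) v w) X Y
        + divTerm e (fun u v w ↦ comp₄ n J (D u) v w) X Y := by
    simp only [divTerm, ← Finset.sum_neg_distrib, ← Finset.sum_sub_distrib,
      ← Finset.sum_add_distrib]
    refine Finset.sum_congr rfl fun i _ ↦ ?_
    rw [sum_comp (T := D (e i)) (J := J) (n := n)]
    have h := hD (e i)
    simp only [LinearMap.add_apply, comp₁_anti hJ h, comp₂_anti hJ h, comp₃_inv hJ, comp₄_inv hJ,
      inner_add_left, inner_neg_left]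
    rw [← sum_comp]
    ring
  have h3 : ∑ i, inner ℝ (T (J (T (e i) (e i))) (J X)) Y
      = inner ℝ (T (J (traceVector T)) X) (J Y) := by
    rw [inner_J_right hJ hT, traceVector_eq e, map_sum, map_sum, LinearMap.sum_apply, sum_inner]
  rw [ricciStarExpr', Finset.sum_sub_distrib, h2, h3]
  linarith

end Expansion

/-! ### The second exterior derivative of the Kähler form, algebraically -/

section CyclicForm

variable {V : Type*} [NormedAddCommGroup V] [InnerProductSpace ℝ V]
  {J : V →ₗ[ℝ] V} {S T : V →ₗ[ℝ] V →ₗ[ℝ] V} {D : V →ₗ[ℝ] V →ₗ[ℝ] V →ₗ[ℝ] V}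
  {ι : Type*} [Fintype ι] (e : OrthonormalBasis ι ℝ V)

/-- Twice the cyclic sum of `⟨S_u v, J w⟩`; for the intrinsic torsion this is the exterior
derivative of the Kähler form. -/
def cyclicForm (J : V →ₗ[ℝ] V) (S : V →ₗ[ℝ] V →ₗ[ℝ] V) (u v w : V) : ℝ :=
  2 * (inner ℝ (S u v) (J w) + inner ℝ (S v w) (J u) + inner ℝ (S w u) (J v))

/-- `cyclicForm` as a function of its first argument. -/
def cyclicFormLeft (J : V →ₗ[ℝ] V) (S : V →ₗ[ℝ] V →ₗ[ℝ] V) (v w : V) : V →ₗ[ℝ] ℝ where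
  toFun u := cyclicForm J S u v w
  map_add' _ _ := by
    simp only [cyclicForm, map_add, LinearMap.add_apply, inner_add_left, inner_add_right]; ring
  map_smul' _ _ := by
    simp only [cyclicForm, map_smul, LinearMap.smul_apply, real_inner_smul_left,
      real_inner_smul_right, RingHom.id_apply, smul_eq_mul]
    ring

theorem cyclicForm_rotate (u v w : V) : cyclicForm J S u v w = cyclicForm J S v w u := by
  rw [cyclicForm, cyclicForm]; ring

/-- The exterior derivative of the `3`-form `cyclicForm J T` in terms of a connection with torsion
`(a, b) ↦ T_a b - T_b a` for which the derivative of `T` is `D`. -/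
def cyclicFormDeriv (J : V →ₗ[ℝ] V) (D : V →ₗ[ℝ] V →ₗ[ℝ] V →ₗ[ℝ] V) (T : V →ₗ[ℝ] V →ₗ[ℝ] V)
    (t u v w : V) : ℝ :=
  cyclicForm J (D t) u v w - cyclicForm J (D u) t v w
    + cyclicForm J (D v) t u w - cyclicForm J (D w) t u v
    + cyclicForm J T (T t u - T u t) v w - cyclicForm J T (T t v - T v t) u w
    + cyclicForm J T (T t w - T w t) u v + cyclicForm J T (T u v - T v u) t w
    - cyclicForm J T (T u w - T w u) t v + cyclicForm J T (T v w - T w v) t u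

/-- `cyclicFormDeriv` as a function of its first argument. -/
def cyclicFormDerivLeft (J : V →ₗ[ℝ] V) (D : V →ₗ[ℝ] V →ₗ[ℝ] V →ₗ[ℝ] V)
    (T : V →ₗ[ℝ] V →ₗ[ℝ] V) (u v w : V) : V →ₗ[ℝ] ℝ where
  toFun t := cyclicFormDeriv J D T t u v w
  map_add' _ _ := by
    simp only [cyclicFormDeriv, cyclicForm, map_add, map_sub, LinearMap.add_apply,
      LinearMap.sub_apply, inner_add_left, inner_sub_left, inner_add_right, inner_sub_right]
    ring
  map_smul' _ _ := by
    simp only [cyclicFormDeriv, cyclicForm, map_smul, map_sub, LinearMap.smul_apply,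
      LinearMap.sub_apply, inner_sub_left, inner_sub_right, real_inner_smul_left,
      real_inner_smul_right, RingHom.id_apply, smul_eq_mul]
    ring

/-- Summing over `i` reassembles `J (e j)`, so contracting with `ω` amounts to inserting the pairs
`(J e_j, e_j)`. -/
theorem sum_sum_inner_mul (f : V → V →ₗ[ℝ] ℝ) :
    ∑ i, ∑ j, inner ℝ (e i) (J (e j)) * f (e j) (e i) = ∑ j, f (e j) (J (e j)) := by
  rw [Finset.sum_comm]
  exact Finset.sum_congr rfl fun j _ ↦ sum_inner_smul_map e (f (e j)) (J (e j))

theorem sum_torsion_left (hJ : IsOrthogonalComplex J) (hT : T ∈ torsionSpace J) :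
    ∑ i, (T (J (e i)) (e i) - T (e i) (J (e i))) = (2 : ℝ) • J (∑ i, T (e i) (e i)) := by
  rw [Finset.sum_sub_distrib, sum_bilin_J_left hJ e T, map_sum, two_smul]
  simp only [map_J_right hT, Finset.sum_neg_distrib]
  abel

/-- The bilinear form `(a, b) ↦ cyclicForm J (D a) b X Y`. -/
def cyclicFormDiv (J : V →ₗ[ℝ] V) (D : V →ₗ[ℝ] V →ₗ[ℝ] V →ₗ[ℝ] V) (X Y : V) :
    V →ₗ[ℝ] V →ₗ[ℝ] ℝ :=
  LinearMap.mk₂ ℝ (fun a b ↦ cyclicForm J (D a) b X Y)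
    (fun _ _ _ ↦ by simp only [cyclicForm, map_add, LinearMap.add_apply, inner_add_left]; ring)
    (fun _ _ _ ↦ by
      simp only [cyclicForm, map_smul, LinearMap.smul_apply, real_inner_smul_left, smul_eq_mul]
      ring)
    (fun a _ _ ↦ (cyclicFormLeft J (D a) X Y).map_add _ _)
    (fun _ a _ ↦ (cyclicFormLeft J (D a) X Y).map_smul _ _)

/-- The bilinear form `(a, b) ↦ cyclicForm J T (T_a X - T_X a) b Y`. -/
def cyclicFormTorsion (J : V →ₗ[ℝ] V) (T : V →ₗ[ℝ] V →ₗ[ℝ] V) (X Y : V) :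
    V →ₗ[ℝ] V →ₗ[ℝ] ℝ :=
  LinearMap.mk₂ ℝ (fun a b ↦ cyclicForm J T (T a X - T X a) b Y)
    (fun a a' b ↦ (congrArg (cyclicFormLeft J T b Y)
      (by simp only [map_add, LinearMap.add_apply]; abel)).trans
      ((cyclicFormLeft J T b Y).map_add (T a X - T X a) (T a' X - T X a')))
    (fun c a b ↦ (congrArg (cyclicFormLeft J T b Y)
      (by simp only [map_smul, LinearMap.smul_apply, smul_sub])).trans
      ((cyclicFormLeft J T b Y).map_smul c (T a X - T X a)))
    (fun a b b' ↦ by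
      simp only [cyclicForm_rotate (T a X - T X a)]
      exact (cyclicFormLeft J T Y (T a X - T X a)).map_add _ _)
    (fun c a b ↦ by
      simp only [cyclicForm_rotate (T a X - T X a)]
      exact (cyclicFormLeft J T Y (T a X - T X a)).map_smul _ _)

/-- Most of the expanded sum is symmetric in `X`, `Y` and cancels. In particular, the contractions
of `T` with `T` at `(X, Y)` and at `(Y, X)` enter with equal sign. What survives is the term with
both `e_i` and `Y` rotated by `J`, where `-T_{J u} J v` is the `𝒲₁ + 𝒲₂`-part minus the `𝒲₃ +
𝒲₄`-part. -/
theorem sum_cyclicFormTorsion (hJ : IsOrthogonalComplex J) (hT : T ∈ torsionSpace J) (X Y : V) :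
    ∑ i, cyclicForm J T (T (e i) X - T X (e i)) (J (e i)) Y
        - ∑ i, cyclicForm J T (T (e i) Y - T Y (e i)) (J (e i)) X
      = 2 * (contraction e (part₁₂ J T) T X Y - contraction e (part₃₄ J T) T X Y
        - (contraction e (part₁₂ J T) T Y X - contraction e (part₃₄ J T) T Y X)) := by
  have term : ∀ X Y i, cyclicForm J T (T (e i) X - T X (e i)) (J (e i)) Y
      = 2 * (-inner ℝ (T (T (e i) X) (e i)) Y + inner ℝ (T (T X (e i)) (e i)) Y
        + inner ℝ (T (J (e i)) (J Y)) (T (e i) X)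
        + (inner ℝ (T X (e i)) (part₁₂ J T (e i) Y) - inner ℝ (T X (e i)) (part₃₄ J T (e i) Y))
        + inner ℝ (T Y (e i)) (T (e i) X) - inner ℝ (T Y (e i)) (T X (e i))) := by
    intro X Y i
    have h1 : ∀ a, inner ℝ (T a (J (e i))) (J Y) = -inner ℝ (T a (e i)) Y := fun a ↦ by
      rw [inner_J_right hJ hT, hJ.sq, map_neg, inner_neg_left]
    have h2 : ∀ a, inner ℝ (T (J (e i)) Y) (J a) = inner ℝ (T (J (e i)) (J Y)) a := fun a ↦
      inner_J_right hJ hT _ _ _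
    have h3 : ∀ a, inner ℝ (T Y a) (J (J (e i))) = inner ℝ (T Y (e i)) a := fun a ↦ by
      rw [hJ.sq, inner_neg_right, inner_skew hT, neg_neg]
    have h4 : inner ℝ (T X (e i)) (part₁₂ J T (e i) Y) - inner ℝ (T X (e i)) (part₃₄ J T (e i) Y)
        = -inner ℝ (T (J (e i)) (J Y)) (T X (e i)) := by
      rw [part₁₂_apply, part₃₄_apply, real_inner_comm (T X (e i)) (T (J (e i)) (J Y))]
      simp only [real_inner_smul_right, inner_sub_right, inner_add_right]
      ring
    rw [cyclicForm, h1, h2, h3, h4, map_sub, LinearMap.sub_apply, inner_sub_left, inner_sub_right,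
      inner_sub_right]
    ring
  -- Another symmetric term: moving `J` from one basis vector to the other costs a sign, and
  -- shifting it across the inner product costs a second one.
  have hr : ∑ i, inner ℝ (T (J (e i)) (J Y)) (T (e i) X)
      = ∑ i, inner ℝ (T (J (e i)) (J X)) (T (e i) Y) := by
    have := sum_bilin_J_left hJ e (LinearMap.mk₂ ℝ (fun a b ↦ inner ℝ (T a (J Y)) (T b X))
      (fun _ _ _ ↦ by simp [inner_add_left]) (fun _ _ _ ↦ by simp [real_inner_smul_left])
      (fun _ _ _ ↦ by simp [inner_add_right]) (fun _ _ _ ↦ by simp [real_inner_smul_right]))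
    simp only [LinearMap.mk₂_apply] at this
    rw [this, ← Finset.sum_neg_distrib]
    refine Finset.sum_congr rfl fun i _ ↦ ?_
    rw [map_J_right hT, map_J_right hT, inner_neg_left, inner_neg_left, inner_J_left hJ,
      inner_J_left hJ, real_inner_comm, neg_neg, neg_neg]
    have := inner_J_left hJ (T (J (e i)) X) (T (e i) Y)
    rw [← neg_eq_iff_eq_neg] at this
    rw [← this]
  have hP := part₁₂_mem hJ hT
  have hQ := part₃₄_mem hJ hT
  have hs := sum_inner_comm e hT X Y
  have hm := sum_inner_eq_contraction e hT hT
  have hP' := sum_inner_eq_contraction e hT hP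
  have hQ' := sum_inner_eq_contraction e hT hQ
  simp only [term, ← Finset.mul_sum, Finset.sum_add_distrib, Finset.sum_sub_distrib,
    Finset.sum_neg_distrib, hm, hP', hQ', hr, hs]
  simp only [real_inner_comm (T X (e _)) (T Y (e _)), contraction]
  ring

/-! #### Membership in `⟦λ^{2,0}⟧` -/

theorem isLambda20_inner (hJ : IsOrthogonalComplex J) (hS : S ∈ torsionSpace J) (u : V) :
    IsLambda20 J fun X Y ↦ inner ℝ (S u X) Y := by
  refine ⟨fun X Y ↦ inner_skew hS u X Y, fun X Y ↦ ?_⟩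
  change inner ℝ (S u (J X)) (J Y) = -inner ℝ (S u X) Y
  rw [inner_J_right hJ hS, hJ.sq, map_neg, inner_neg_left]

theorem isLambda20_sum {b : ι → V → V → ℝ} (h : ∀ i, IsLambda20 J (b i)) :
    IsLambda20 J fun X Y ↦ ∑ i, b i X Y := by
  refine ⟨fun X Y ↦ ?_, fun X Y ↦ ?_⟩ <;> simp only [← Finset.sum_neg_distrib]
  · exact Finset.sum_congr rfl fun i _ ↦ (h i).1 X Y
  · exact Finset.sum_congr rfl fun i _ ↦ (h i).2 X Y

theorem isLambda20_divTerm (hJ : IsOrthogonalComplex J) {D : V → V →ₗ[ℝ] V →ₗ[ℝ] V}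
    (hD : ∀ u, D u ∈ torsionSpace J) : IsLambda20 J (divTerm e fun u v w ↦ D u v w) :=
  isLambda20_sum fun i ↦ isLambda20_inner hJ (hD (e i)) (e i)

theorem isLambda20_traceTerm (hJ : IsOrthogonalComplex J) (hS : S ∈ torsionSpace J)
    (B : V →ₗ[ℝ] V →ₗ[ℝ] V) : IsLambda20 J (traceTerm e S B) :=
  isLambda20_sum fun i ↦ isLambda20_inner hJ hS (B (e i) (e i))

theorem isLambda20_mixedTerm (hJ : IsOrthogonalComplex J) (hS : S ∈ torsionSpace J)
    (hS' : ∀ u v, S (J u) (J v) = S u v) (hT : T ∈ torsionSpace J) :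
    IsLambda20 J (mixedTerm e S T) := by
  refine ⟨fun X Y ↦ ?_, fun X Y ↦ ?_⟩ <;>
    simp only [mixedTerm_eq e hS hT, contraction_J_of_inv e hJ hT hS'] <;> ring

/-! ### The `ω`-contraction of the 4-form and its `⟦λ^{2,0}⟧`-component -/

variable [FiniteDimensional ℝ V] {n : ℕ}

/-- One cyclic term vanishes by skewness of `S_Y`; the other two are the trace vector, computed in
the bases `J e_i` and `e_i`. -/
theorem sum_cyclicForm_trace (hJ : IsOrthogonalComplex J) (hS : S ∈ torsionSpace J) (Y : V) :
    ∑ i, cyclicForm J S (J (e i)) (e i) Y = 4 * inner ℝ (traceVector S) Y := by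
  have h : ∀ i, cyclicForm J S (J (e i)) (e i) Y
      = 2 * (inner ℝ (S (J (e i)) (J (e i))) Y + inner ℝ (S (e i) (e i)) Y) := by
    intro i
    have h0 := inner_skew hS Y (J (e i)) (J (e i))
    rw [cyclicForm, inner_J_right hJ hS, hJ.sq, inner_neg_right, inner_skew hS (e i) Y (e i),
      show inner ℝ (S Y (J (e i))) (J (e i)) = 0 by linarith]
    ring
  rw [Finset.sum_congr rfl fun i _ ↦ h i, ← Finset.mul_sum, Finset.sum_add_distrib, ← sum_inner,
    ← sum_inner, sum_bilin_J hJ e S, ← traceVector_eq e S]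
  ring

/-- On the `𝒲₁ + 𝒲₂`-part the cyclic sum is three times the `𝒲₁`-component and already of type
`⟦λ^{2,0}⟧`, so `2 · 3` is doubled. On the `𝒲₃ + 𝒲₄`-part two of the cyclic terms are `J`-invariant
in `(X, Y)` and cancel, leaving one. -/
theorem cyclicForm_proj (hJ : IsOrthogonalComplex J) (hS : S ∈ torsionSpace J) (u X Y : V) :
    cyclicForm J S u X Y - cyclicForm J S u (J X) (J Y)
      = 12 * inner ℝ (comp₁ J S (J u) X) Y - 4 * inner ℝ (part₃₄ J S (J u) X) Y := by
  have hP := part₁₂_mem hJ hS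
  have hQ := part₃₄_mem hJ hS
  have hPa := map_J_left_of_anti hJ (part₁₂_J hJ (T := S))
  have hQa := map_J_left_of_inv hJ (part₃₄_J hJ (T := S))
  have h1 : ∀ X Y, cyclicForm J (part₁₂ J S) u X Y = 6 * inner ℝ (comp₁ J S (J u) X) Y := by
    intro X Y
    rw [map_J_left_of_anti hJ (comp₁_anti hJ hS), ← inner_J_right hJ (comp₁_mem hJ hS), comp₁,
      inner_cyclicPart hP, cyclicForm, inner_J_right hJ hP X Y u, hPa Y u,
      inner_J_right hJ hP Y u X]
    ring
  have h2 : cyclicForm J (part₃₄ J S) u X Y - cyclicForm J (part₃₄ J S) u (J X) (J Y)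
      = -4 * inner ℝ (part₃₄ J S (J u) X) Y := by
    rw [cyclicForm, cyclicForm, part₃₄_J hJ, hQa Y u, hQa u X, hJ.sq, hJ.sq,
      inner_J_right hJ hQ u X Y, inner_J_right hJ hQ Y u X]
    simp only [inner_neg_left, inner_neg_right]
    ring
  have h3 : ∀ X Y, cyclicForm J S u X Y
      = cyclicForm J (part₁₂ J S) u X Y + cyclicForm J (part₃₄ J S) u X Y := by
    intro X Y
    nth_rewrite 1 [← part₁₂_add_part₃₄ (J := J) (T := S)]
    simp only [cyclicForm, LinearMap.add_apply, inner_add_left]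
    ring
  have h4 : inner ℝ (comp₁ J S (J u) (J X)) (J Y) = -inner ℝ (comp₁ J S (J u) X) Y := by
    rw [inner_J_right hJ (comp₁_mem hJ hS), hJ.sq, map_neg, inner_neg_left]
  rw [h3 X Y, h3 (J X) (J Y), h1, h1, h4]
  linarith

theorem sum_cyclicFormDeriv (hJ : IsOrthogonalComplex J) (hT : T ∈ torsionSpace J)
    (hD : ∀ u, D u ∈ torsionSpace J) (X Y : V) :
    ∑ i, cyclicFormDeriv J D T (J (e i)) (e i) X Y
      = 2 * ∑ i, cyclicForm J (D (J (e i))) (e i) X Y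
        + 4 * inner ℝ (traceVector (D X)) Y - 4 * inner ℝ (traceVector (D Y)) X
        + 4 * inner ℝ (T (J (traceVector T)) X) (J Y)
        + 4 * (contraction e (part₁₂ J T) T X Y - contraction e (part₃₄ J T) T X Y
          - (contraction e (part₁₂ J T) T Y X - contraction e (part₃₄ J T) T Y X)) := by
  have h1 : ∑ i, cyclicForm J (D (J (e i))) (e i) X Y
      = -∑ i, cyclicForm J (D (e i)) (J (e i)) X Y :=
    sum_bilin_J_left hJ e (cyclicFormDiv J D X Y)
  have h2 : ∀ X Y, ∑ i, cyclicForm J T (T (J (e i)) X - T X (J (e i))) (e i) Y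
      = -∑ i, cyclicForm J T (T (e i) X - T X (e i)) (J (e i)) Y := fun X Y ↦
    sum_bilin_J_left hJ e (cyclicFormTorsion J T X Y)
  have h4 := sum_cyclicForm_trace e hJ (hD X) Y
  have h5 := sum_cyclicForm_trace e hJ (hD Y) X
  have h6 := sum_cyclicForm_trace e hJ hT (T X Y - T Y X)
  have h7 : ∑ i, cyclicForm J T (T (J (e i)) (e i) - T (e i) (J (e i))) X Y
      = 2 * cyclicForm J T (J (traceVector T)) X Y := by
    have := map_sum (cyclicFormLeft J T X Y)
      (fun i ↦ T (J (e i)) (e i) - T (e i) (J (e i))) Finset.univ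
    rw [sum_torsion_left e hJ hT, map_smul, ← traceVector_eq] at this
    exact this.symm
  have h8 := sum_cyclicFormTorsion e hJ hT X Y
  -- The trace vector enters through the torsion of the pairs `(J e_i, e_i)` and through that of
  -- `(X, Y)`; the second contribution removes all but one cyclic term of the first.
  have h9 : 2 * cyclicForm J T (J (traceVector T)) X Y
        + 4 * inner ℝ (traceVector T) (T X Y - T Y X)
      = 4 * inner ℝ (T (J (traceVector T)) X) (J Y) := by
    rw [cyclicForm, hJ.sq, inner_neg_right, inner_sub_right, inner_J_right hJ hT Y,
      hJ.sq, map_neg, inner_neg_left, inner_skew hT Y (traceVector T) X,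
      real_inner_comm (T X Y), real_inner_comm (T Y X)]
    ring
  have h10 : ∀ i, cyclicForm J T (T X Y - T Y X) (J (e i)) (e i)
      = cyclicForm J T (J (e i)) (e i) (T X Y - T Y X) := fun i ↦ cyclicForm_rotate _ _ _
  simp only [cyclicFormDeriv, Finset.sum_add_distrib, Finset.sum_sub_distrib, h10]
  linarith [h2 X Y, h2 Y X]

theorem lambda20Part_cyclicFormDeriv (hJ : IsOrthogonalComplex J) (hT : T ∈ torsionSpace J)
    (hD : ∀ u, D u ∈ torsionSpace J) (hn : 2 ≤ n) (hV : Module.finrank ℝ V = 2 * n) (X Y : V) :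
    lambda20Part J e (cyclicFormDeriv J D T) X Y
      = 4 * (3 * divTerm e (fun u v w ↦ comp₁ J (D u) v w) X Y
        - divTerm e (fun u v w ↦ comp₃ n J (D u) v w) X Y
        + ((n : ℝ) - 2) * divTerm e (fun u v w ↦ comp₄ n J (D u) v w) X Y
        + mixedTerm e (comp₃ n J T) (comp₁ J T) X Y
        - ((n : ℝ) - 5) / ((n : ℝ) - 1) * traceTerm e (comp₁ J T) (comp₄ n J T) X Y
        + mixedTerm e (comp₃ n J T) (comp₂ J T) X Y
        - ((n : ℝ) - 2) / ((n : ℝ) - 1) * traceTerm e (comp₂ J T) (comp₄ n J T) X Y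
        + traceTerm e (comp₃ n J T) (comp₄ n J T) X Y) := by
  have hn' : (n : ℝ) - 1 ≠ 0 := by
    have : (2 : ℝ) ≤ n := by exact_mod_cast hn
    linarith
  have hc : ∀ X Y, ∑ i, ∑ j, inner ℝ (e i) (J (e j)) * cyclicFormDeriv J D T (e i) (e j) X Y
      = ∑ i, cyclicFormDeriv J D T (J (e i)) (e i) X Y := fun X Y ↦
    sum_sum_inner_mul e fun u ↦ cyclicFormDerivLeft J D T u X Y
  have hlin : ∑ i, cyclicForm J (D (J (e i))) (e i) X Y
      - ∑ i, cyclicForm J (D (J (e i))) (e i) (J X) (J Y)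
      = 12 * divTerm e (fun u v w ↦ comp₁ J (D u) v w) X Y
        - 4 * (divTerm e (fun u v w ↦ comp₃ n J (D u) v w) X Y
          + divTerm e (fun u v w ↦ comp₄ n J (D u) v w) X Y) := by
    have d1 := divTerm_J (D := (comp₁Linear J).comp D) e hJ X Y
    have d2 := divTerm_J (D := (part₃₄Linear J).comp D) e hJ X Y
    have d3 : divTerm e (fun u v w ↦ ((part₃₄Linear J).comp D) u v w) X Y
        = divTerm e (fun u v w ↦ comp₃ n J (D u) v w) X Y
          + divTerm e (fun u v w ↦ comp₄ n J (D u) v w) X Y := by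
      simp only [divTerm, ← Finset.sum_add_distrib]
      refine Finset.sum_congr rfl fun i _ ↦ ?_
      rw [← inner_add_left, ← LinearMap.add_apply, ← LinearMap.add_apply, comp₃_add_comp₄]
      rfl
    rw [← d3, ← d2]
    change _ = 12 * divTerm e (fun u v w ↦ ((comp₁Linear J).comp D) u v w) X Y - _
    rw [← d1, ← Finset.sum_sub_distrib, Finset.mul_sum, Finset.mul_sum, ← Finset.sum_sub_distrib]
    exact Finset.sum_congr rfl fun i _ ↦ cyclicForm_proj hJ (hD _) _ _ _
  have hq : ∀ X Y, contraction e (part₁₂ J T) T X Y - contraction e (part₃₄ J T) T X Y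
      - (contraction e (part₁₂ J T) T (J X) (J Y) - contraction e (part₃₄ J T) T (J X) (J Y))
      = 2 * contraction e (part₁₂ J T) (part₃₄ J T) X Y := by
    intro X Y
    have hP := part₁₂_mem hJ hT
    have hQ := part₃₄_mem hJ hT
    have hr : ∀ P X Y, contraction e P T X Y
        = contraction e P (part₁₂ J T) X Y + contraction e P (part₃₄ J T) X Y := by
      intro P X Y
      rw [← contraction_add_right, part₁₂_add_part₃₄]
    simp only [hr,
      contraction_J_of_anti e hJ hP (part₁₂_J hJ (T := T)),
      contraction_J_of_anti e hJ hQ (part₁₂_J hJ (T := T)),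
      contraction_J_of_inv e hJ hP (part₃₄_J hJ (T := T)),
      contraction_eq_zero e hJ (part₃₄_J hJ (T := T)) hQ]
    ring
  have h1 := divTerm_comp₄ (D := D) e hJ hn X Y
  have h2 := contraction_part_skew e hJ hT hn hV X Y
  have h3 := inner_trace_J e hJ hT hn hV X Y
  have h4 : inner ℝ (T (J (traceVector T)) (J X)) (J (J Y))
      = -inner ℝ (T (J (traceVector T)) X) (J Y) := by
    rw [hJ.sq, inner_neg_right, ← inner_J_right hJ hT]
  rw [lambda20Part, hc, hc, sum_cyclicFormDeriv e hJ hT hD, sum_cyclicFormDeriv e hJ hT hD, h4]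
  -- The coefficients of `t_5` and `t_7` combine `-1` from `inner_trace_J` with `4 / (n - 1)`,
  -- respectively `1 / (n - 1)`, from `contraction_part_skew`.
  have e1 : ((n : ℝ) - 5) / ((n : ℝ) - 1) = 1 - 4 / ((n : ℝ) - 1) := by field_simp; ring
  have e2 : ((n : ℝ) - 2) / ((n : ℝ) - 1) = 1 - 1 / ((n : ℝ) - 1) := by field_simp; ring
  rw [e1, e2]
  linarith [hq X Y, hq Y X]

end CyclicForm

/-! ### The minimal connection -/

section Connection

set_option linter.unusedSectionVars false

variable {E : Type*} [NormedAddCommGroup E] [NormedSpace ℝ E]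
  {H : Type*} [TopologicalSpace H] {I : ModelWithCorners ℝ E H}
  {M : Type*} [TopologicalSpace M] [ChartedSpace H M]
  [FiniteDimensional ℝ E] [IsManifold I ∞ M]
  [RiemannianBundle (fun x : M ↦ TangentSpace I x)]
  {J : OrthogonalComplexStructure I M}
  {nabla : CovariantDerivative I E (TangentSpace I : M → Type _)} {x : M}

theorem isOrthogonalComplex_at (J : OrthogonalComplexStructure I M) (x : M) :
    IsOrthogonalComplex (J.at x) :=
  ⟨J.sq x, J.orthogonal x⟩

theorem inner_toFun_left (J : OrthogonalComplexStructure I M) (x : M) (v w : TangentSpace I x) :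
    inner ℝ (J.toFun x v) w = -inner ℝ v (J.toFun x w) :=
  inner_J_left (isOrthogonalComplex_at J x) v w

theorem mdifferentiableAt_J (J : OrthogonalComplexStructure I M) {Y : ∀ x : M, TangentSpace I x}
    (hY : MDiffAt (T% Y) x) : MDiffAt (T% (fun y ↦ J.toFun y (Y y))) x :=
  MDifferentiableAt.clm_bundle_apply (F₁ := E) (F₂ := E)
    ((J.contMDiff x).mdifferentiableAt (by simp)) hY

theorem contMDiffAt_J (J : OrthogonalComplexStructure I M) {Y : ∀ x : M, TangentSpace I x}
    (hY : CMDiffAt ∞ (T% Y) x) : CMDiffAt ∞ (T% (fun y ↦ J.toFun y (Y y))) x :=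
  ContMDiffAt.clm_bundle_apply (F₁ := E) (F₂ := E) (J.contMDiff x) hY

theorem intrinsicTorsion_apply (u : TangentSpace I x) {Y : ∀ x : M, TangentSpace I x}
    (hY : MDiffAt (T% Y) x) :
    intrinsicTorsion J nabla x u (Y x)
      = (-(1 / 2) : ℝ) • (J.toFun x (nabla (fun y ↦ J.toFun y (Y y)) x u) + nabla Y x u) := by
  change torsionForm J nabla x (Y x) u = _
  rw [torsionForm, TensorialAt.mkHom_apply _ hY]
  simp only [torsionOp, smul_apply, ContinuousLinearMap.comp_apply,
    sub_apply, map_sub, J.sq, sub_neg_eq_add]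

theorem minimalConnection_eq_add (u : TangentSpace I x) (Y : ∀ x : M, TangentSpace I x) :
    minimalConnection J nabla Y x u = nabla Y x u + intrinsicTorsion J nabla x u (Y x) := rfl

/-- As `J⁻¹ = -J`, this is the average of `∇` and its conjugate by `J`. Both preserve the metric
when `∇` does, and the average commutes with `J`. -/
theorem minimalConnection_apply (u : TangentSpace I x) {Y : ∀ x : M, TangentSpace I x}
    (hY : MDiffAt (T% Y) x) :
    minimalConnection J nabla Y x u
      = (1 / 2 : ℝ) • (nabla Y x u - J.toFun x (nabla (fun y ↦ J.toFun y (Y y)) x u)) := by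
  rw [minimalConnection_eq_add, intrinsicTorsion_apply u hY]
  module

/-- The covariant derivative `D` preserves the metric. -/
def IsMetricConnection (D : CovariantDerivative I E (TangentSpace I : M → Type _)) : Prop :=
  ∀ (σ τ : ∀ x : M, TangentSpace I x) (x : M), MDiffAt (T% σ) x → MDiffAt (T% τ) x →
    ∀ u : TangentSpace I x, mvfderiv I (fun y ↦ (inner ℝ (σ y) (τ y) : ℝ)) x u
      = inner ℝ (D σ x u) (τ x) + inner ℝ (σ x) (D τ x u)

/-- The covariant derivative `D` preserves the almost complex structure. -/
def IsComplexConnection (J : OrthogonalComplexStructure I M)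
    (D : CovariantDerivative I E (TangentSpace I : M → Type _)) : Prop :=
  ∀ (σ : ∀ x : M, TangentSpace I x) (x : M), MDiffAt (T% σ) x →
    ∀ u : TangentSpace I x, D (fun y ↦ J.toFun y (σ y)) x u = J.toFun x (D σ x u)

theorem isMetricConnection_minimal (h : IsLeviCivita nabla) :
    IsMetricConnection (minimalConnection J nabla) := by
  intro σ τ x hσ hτ u
  have h1 := h.metric σ τ x hσ hτ u
  have h2 := h.metric _ _ x (mdifferentiableAt_J J hσ) (mdifferentiableAt_J J hτ) u
  simp only [J.orthogonal] at h2
  rw [minimalConnection_apply u hσ, minimalConnection_apply u hτ]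
  simp only [real_inner_smul_left, real_inner_smul_right, inner_sub_left, inner_sub_right]
  have h4 := inner_toFun_left J x (nabla (fun y ↦ J.toFun y (σ y)) x u) (τ x)
  have h5 := inner_toFun_left J x (σ x) (nabla (fun y ↦ J.toFun y (τ y)) x u)
  linarith

theorem isComplexConnection_minimal : IsComplexConnection J (minimalConnection J nabla) := by
  intro σ x hσ u
  rw [minimalConnection_apply u hσ, minimalConnection_apply u (mdifferentiableAt_J J hσ)]
  have : (fun y ↦ J.toFun y (J.toFun y (σ y))) = (-1 : ℝ) • σ := by
    funext y; simp [J.sq]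
  rw [this, nabla.isCovariantDerivativeOnUniv.smul_const _ hσ]
  simp only [neg_smul, one_smul, neg_apply, map_neg, map_smul, map_sub, J.sq]
  module

/-- A difference of two metric connections is skew; anticommutation with `J` follows by
differentiating `J² = -1`. -/
theorem intrinsicTorsion_mem (h : IsLeviCivita nabla) (x : M) :
    intrinsicTorsion J nabla x ∈ torsionSpace (J.at x) := by
  have hext : ∀ v : TangentSpace I x, MDiffAt (T% (FiberBundle.extend E v)) x := fun v ↦
    FiberBundle.mdifferentiableAt_extend ..
  refine ⟨fun u v w ↦ ?_, fun u v ↦ ?_⟩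
  · have h1 := isMetricConnection_minimal (J := J) h _ _ x (hext v) (hext w) u
    have h2 := h.metric _ _ x (hext v) (hext w) u
    simp only [minimalConnection_eq_add, FiberBundle.extend_apply_self, inner_add_left,
      inner_add_right] at h1 h2
    linarith
  · have h1 := isComplexConnection_minimal (J := J) (nabla := nabla) _ x (hext v) u
    have h2 := intrinsicTorsion_apply (J := J) (nabla := nabla) u (hext v)
    have h3 := intrinsicTorsion_apply (J := J) (nabla := nabla) u (mdifferentiableAt_J J (hext v))
    simp only [FiberBundle.extend_apply_self] at h2 h3
    change intrinsicTorsion J nabla x u (J.toFun x v)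
      = -J.toFun x (intrinsicTorsion J nabla x u v)
    have : (fun y ↦ J.toFun y (J.toFun y (FiberBundle.extend E v y)))
        = (-1 : ℝ) • FiberBundle.extend E v := by
      funext y; simp [J.sq]
    rw [h2, h3, this, nabla.isCovariantDerivativeOnUniv.smul_const _ (hext v)]
    simp only [neg_smul, one_smul, neg_apply, map_neg, map_smul, map_add, J.sq]
    module

theorem mlieBracket_eq (h : IsLeviCivita nabla) {X Y : ∀ x : M, TangentSpace I x}
    (hX : MDiffAt (T% X) x) (hY : MDiffAt (T% Y) x) :
    VectorField.mlieBracket I X Y x = nabla Y x (X x) - nabla X x (Y x) :=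
  ((nabla.torsion_eq_zero_iff.1 h.torsion_free) hX hY).symm

end Connection

/-! ### Orthonormal frames and smoothness of the intrinsic torsion -/

section Frame

set_option linter.unusedSectionVars false

open Filter Topology InnerProductSpace

variable {E : Type*} [NormedAddCommGroup E] [NormedSpace ℝ E]
  {H : Type*} [TopologicalSpace H] {I : ModelWithCorners ℝ E H}
  {M : Type*} [TopologicalSpace M] [ChartedSpace H M]
  [FiniteDimensional ℝ E] [IsManifold I ∞ M]
  [RiemannianBundle (fun x : M ↦ TangentSpace I x)]
  {J : OrthogonalComplexStructure I M}
  {nabla : CovariantDerivative I E (TangentSpace I : M → Type _)} {x : M}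
  {κ : Type*} [Fintype κ]

/-- `F` is a family of vector fields that is smooth at `x` and orthonormal near `x`. -/
structure IsOrthonormalFrameAt (F : κ → ∀ y : M, TangentSpace I y) (x : M) : Prop where
  contMDiffAt : ∀ i, CMDiffAt ∞ (T% (F i)) x
  basis : ∀ᶠ y in 𝓝 x, ∃ b : OrthonormalBasis κ ℝ (TangentSpace I y), ∀ i, b i = F i y

theorem contMDiffAt_mlieBracket {X Y : ∀ y : M, TangentSpace I y} (hX : CMDiffAt ∞ (T% X) x)
    (hY : CMDiffAt ∞ (T% Y) x) : CMDiffAt ∞ (T% (VectorField.mlieBracket I X Y)) x := by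
  have : IsManifold I (minSmoothness ℝ 2) M := by
    rw [minSmoothness_of_isRCLikeNormedField]; infer_instance
  have : IsManifold I (((⊤ : ℕ∞) : ℕ∞ω) + 1) M := by
    change IsManifold I ∞ M; infer_instance
  exact ContMDiffAt.mlieBracket_vectorField (m := ⊤) (n := ⊤) hX hY
    (by rw [minSmoothness_of_isRCLikeNormedField]; rfl)

theorem mdifferentiableAt_of_smooth {X : ∀ y : M, TangentSpace I y} (hX : CMDiffAt ∞ (T% X) x) :
    MDiffAt (T% X) x := hX.mdifferentiableAt (by simp)

theorem eventually_mdifferentiableAt {X : ∀ y : M, TangentSpace I y} (hX : CMDiffAt ∞ (T% X) x) :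
    ∀ᶠ y in 𝓝 x, MDiffAt (T% X) y := by
  have h1 : CMDiffAt 1 (T% X) x := hX.of_le (by simp)
  filter_upwards [(contMDiffAt_iff_contMDiffAt_nhds (by simp)).1 h1] with y hy using hy.mdifferentiableAt (by simp)

theorem eventually_mdifferentiableAt_fun {f : M → ℝ} (hf : CMDiffAt ∞ f x) :
    ∀ᶠ y in 𝓝 x, MDiffAt f y := by
  have h1 : CMDiffAt 1 f x := hf.of_le (by simp)
  filter_upwards [(contMDiffAt_iff_contMDiffAt_nhds (by simp)).1 h1] with y hy using hy.mdifferentiableAt (by simp)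

theorem mvfderiv_congr {f g : M → ℝ} (h : f =ᶠ[𝓝 x] g) : mvfderiv I f x = mvfderiv I g x := by
  ext u
  simp only [mvfderiv, h.mfderiv_eq]
  rfl

variable [IsContMDiffRiemannianBundle I ∞ E (fun x : M ↦ TangentSpace I x)]

theorem contMDiffAt_inner {X Y : ∀ y : M, TangentSpace I y} (hX : CMDiffAt ∞ (T% X) x)
    (hY : CMDiffAt ∞ (T% Y) x) : CMDiffAt ∞ (fun y ↦ (inner ℝ (X y) (Y y) : ℝ)) x :=
  ContMDiffAt.inner_bundle hX hY

theorem mdifferentiableAt_inner {X Y : ∀ y : M, TangentSpace I y} (hX : MDiffAt (T% X) x)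
    (hY : MDiffAt (T% Y) x) : MDiffAt (fun y ↦ (inner ℝ (X y) (Y y) : ℝ)) x :=
  MDifferentiableAt.inner_bundle (F := E) (E := fun x : M ↦ TangentSpace I x) (IB := I) hX hY

/-- Induct along the recursion: the denominators are squared norms of earlier vectors, nonzero at
`x` by independence there. -/
theorem contMDiffAt_gramSchmidt {N : ℕ} {s : Fin N → ∀ y : M, TangentSpace I y}
    (hs : ∀ i, CMDiffAt ∞ (T% (s i)) x) (hli : LinearIndependent ℝ fun i ↦ s i x) (i : Fin N) :
    CMDiffAt ∞ (T% (fun y ↦ gramSchmidt ℝ (fun j ↦ s j y) i)) x := by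
  induction i using WellFoundedLT.induction with
  | ind i ih =>
  have h : ∀ y, gramSchmidt ℝ (fun j ↦ s j y) i = s i y - ∑ j ∈ Finset.Iio i,
      (inner ℝ (gramSchmidt ℝ (fun j ↦ s j y) j) (s i y)
        / inner ℝ (gramSchmidt ℝ (fun j ↦ s j y) j) (gramSchmidt ℝ (fun j ↦ s j y) j) : ℝ)
        • gramSchmidt ℝ (fun j ↦ s j y) j := by
    intro y
    rw [gramSchmidt_def]
    simp only [Submodule.starProjection_singleton, real_inner_self_eq_norm_sq]
    rfl
  refine ContMDiffAt.congr_of_eventuallyEq ?_ (.of_forall fun y ↦ congrArg _ (h y))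
  refine (hs i).sub_section (ContMDiffAt.sum_section fun j hj ↦ ?_)
  have hj' := ih j (Finset.mem_Iio.1 hj)
  refine ContMDiffAt.smul_section (ContMDiffAt.div₀ (contMDiffAt_inner hj' (hs i))
    (contMDiffAt_inner hj' hj') ?_) hj'
  rw [inner_self_ne_zero]
  exact gramSchmidt_ne_zero j hli

theorem exists_orthonormalFrameAt (x : M) :
    ∃ F : Fin (Module.finrank ℝ E) → ∀ y : M, TangentSpace I y, IsOrthonormalFrameAt F x := by
  let t := trivializationAt E (TangentSpace I : M → Type _) x
  have hx : x ∈ t.baseSet := FiberBundle.mem_baseSet_trivializationAt' x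
  let b := Module.finBasis ℝ E
  let s := t.localFrame b
  have hli : ∀ y ∈ t.baseSet, LinearIndependent ℝ fun i ↦ s i y := fun y hy ↦
    (t.isLocalFrameOn_localFrame_baseSet I ∞ b).linearIndependent hy
  have hs : ∀ i, CMDiffAt ∞ (T% (s i)) x := fun i ↦ contMDiffAt_localFrame_of_mem ∞ t b i hx
  refine ⟨fun i y ↦ gramSchmidtNormed ℝ (fun j ↦ s j y) i, fun i ↦ ?_, ?_⟩
  · have hG := contMDiffAt_gramSchmidt hs (hli x hx) i
    have h0 : (inner ℝ (gramSchmidt ℝ (fun j ↦ s j x) i) (gramSchmidt ℝ (fun j ↦ s j x) i) : ℝ)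
        ≠ 0 := by
      rw [inner_self_ne_zero]
      exact gramSchmidt_ne_zero i (hli x hx)
    have h : ∀ y, gramSchmidtNormed ℝ (fun j ↦ s j y) i =
        (√(inner ℝ (gramSchmidt ℝ (fun j ↦ s j y) i) (gramSchmidt ℝ (fun j ↦ s j y) i) : ℝ))⁻¹
          • gramSchmidt ℝ (fun j ↦ s j y) i := by
      intro y
      rw [real_inner_self_eq_norm_sq, Real.sqrt_sq (norm_nonneg _)]
      rfl
    refine ContMDiffAt.congr_of_eventuallyEq ?_ (.of_forall fun y ↦ congrArg _ (h y))
    refine ContMDiffAt.smul_section ?_ hG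
    have h1 := (Real.contDiffAt_sqrt (n := ∞) h0).inv (by
      rw [Real.sqrt_ne_zero']
      exact lt_of_le_of_ne real_inner_self_nonneg h0.symm)
    exact ContMDiffAt.comp (g := fun r : ℝ ↦ (√r)⁻¹) x h1.contMDiffAt (contMDiffAt_inner hG hG)
  · filter_upwards [t.open_baseSet.mem_nhds hx] with y hy
    have ho := gramSchmidtNormed_orthonormal (hli y hy)
    have hc : Fintype.card (Fin (Module.finrank ℝ E)) = Module.finrank ℝ (TangentSpace I y) := by
      rw [Fintype.card_fin]; rfl
    exact ⟨OrthonormalBasis.mk ho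
      (ho.linearIndependent.span_eq_top_of_card_eq_finrank' hc).ge, fun i ↦ by simp⟩

variable {F : κ → ∀ y : M, TangentSpace I y}

theorem IsOrthonormalFrameAt.expand (hF : IsOrthonormalFrameAt F x) :
    ∀ᶠ y in 𝓝 x, ∀ v : TangentSpace I y, v = ∑ i, (inner ℝ (F i y) v : ℝ) • F i y := by
  filter_upwards [hF.basis] with y ⟨b, hb⟩ v
  simp_rw [← hb]
  exact (b.sum_repr' v).symm

theorem IsOrthonormalFrameAt.mdifferentiableAt (hF : IsOrthonormalFrameAt F x)
    {σ : ∀ y : M, TangentSpace I y} (h : ∀ i, MDiffAt (fun y ↦ (inner ℝ (F i y) (σ y) : ℝ)) x) :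
    MDiffAt (T% σ) x := by
  have h1 : MDiffAt (T% (fun y ↦ ∑ i, (inner ℝ (F i y) (σ y) : ℝ) • F i y)) x :=
    MDifferentiableAt.sum_section fun i _ ↦
      (h i).smul_section (mdifferentiableAt_of_smooth (hF.contMDiffAt i))
  refine h1.congr_of_eventuallyEq ?_
  filter_upwards [hF.expand] with y hy
  exact congrArg _ (hy (σ y))

theorem IsOrthonormalFrameAt.contMDiffAt_of_inner (hF : IsOrthonormalFrameAt F x)
    {σ : ∀ y : M, TangentSpace I y} (h : ∀ i, CMDiffAt ∞ (fun y ↦ (inner ℝ (F i y) (σ y) : ℝ)) x) :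
    CMDiffAt ∞ (T% σ) x := by
  have h1 : CMDiffAt ∞ (T% (fun y ↦ ∑ i, (inner ℝ (F i y) (σ y) : ℝ) • F i y)) x :=
    ContMDiffAt.sum_section fun i _ ↦ (h i).smul_section (hF.contMDiffAt i)
  refine h1.congr_of_eventuallyEq ?_
  filter_upwards [hF.expand] with y hy
  exact congrArg _ (hy (σ y))

theorem IsOrthonormalFrameAt.inner_eventuallyEq (hF : IsOrthonormalFrameAt F x) (i j : κ) :
    ∃ c : ℝ, ∀ᶠ y in 𝓝 x, (inner ℝ (F i y) (F j y) : ℝ) = c := by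
  classical
  refine ⟨if i = j then 1 else 0, ?_⟩
  filter_upwards [hF.basis] with y ⟨b, hb⟩
  rw [← hb, ← hb, b.inner_eq_ite]

/-- The derivative of a smooth function along a smooth vector field is smooth. -/
theorem contMDiffAt_mvfderiv {f : M → ℝ} {X : ∀ y : M, TangentSpace I y} (hf : CMDiffAt ∞ f x)
    (hX : CMDiffAt ∞ (T% X) x) : CMDiffAt ∞ (fun y ↦ mvfderiv I f y (X y)) x := by
  obtain ⟨F, hF⟩ := exists_orthonormalFrameAt (I := I) x
  rcases isEmpty_or_nonempty (Fin (Module.finrank ℝ E)) with he | ⟨⟨i⟩⟩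
  · refine (contMDiffAt_const (c := (0 : ℝ))).congr_of_eventuallyEq ?_
    filter_upwards [hF.expand] with y hy
    rw [hy (X y)]
    simp
  -- For a unit field `W`, `[X, f W] = X(f) W + f [X, W]`, so `X(f)` is an expression in inner
  -- products and brackets of smooth fields.
  have hi := hF.contMDiffAt i
  have hfi : CMDiffAt ∞ (T% (f • F i)) x := hf.smul_section hi
  have h1 := contMDiffAt_inner hi (contMDiffAt_mlieBracket hX hfi)
  have h2 := contMDiffAt_inner hi (contMDiffAt_mlieBracket hX hi)
  refine (h1.sub (hf.mul h2)).congr_of_eventuallyEq ?_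
  filter_upwards [hF.basis, eventually_mdifferentiableAt hi, eventually_mdifferentiableAt_fun hf]
    with y ⟨b, hb⟩ hy hfy
  have h3 : (inner ℝ (F i y) (F i y) : ℝ) = 1 := by rw [← hb, b.inner_eq_one]
  change _ = inner ℝ (F i y) _ - f y * inner ℝ (F i y) _
  rw [VectorField.mlieBracket_smul_right hfy hy, inner_add_right, real_inner_smul_right,
    real_inner_smul_right, h3]
  ring

/-- The Koszul formula: the frame has constant inner products near `x`, so only brackets remain, and
these are smooth. The regularity of `∇`, and hence of `ξ`, is obtained here. -/
theorem contMDiffAt_nabla_frame_frame (h : IsLeviCivita nabla) (hF : IsOrthonormalFrameAt F x)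
    (i j : κ) : CMDiffAt ∞ (T% (fun y ↦ nabla (F j) y (F i y))) x := by
  refine hF.contMDiffAt_of_inner fun k ↦ ?_
  have hb : ∀ i j k, CMDiffAt ∞
      (fun y ↦ (inner ℝ (VectorField.mlieBracket I (F i) (F j) y) (F k y) : ℝ)) x := fun i j k ↦
    contMDiffAt_inner (contMDiffAt_mlieBracket (hF.contMDiffAt i) (hF.contMDiffAt j))
      (hF.contMDiffAt k)
  refine ((contMDiffAt_const (c := (1 / 2 : ℝ))).mul
    (((hb i j k).sub (hb i k j)).sub (hb j k i))).congr_of_eventuallyEq ?_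
  have hd : ∀ᶠ y in 𝓝 x, ∀ i, MDiffAt (T% (F i)) y :=
    eventually_all.2 fun i ↦ eventually_mdifferentiableAt (hF.contMDiffAt i)
  have hc : ∀ᶠ y in 𝓝 x, ∀ i j k, (inner ℝ (nabla (F j) y (F i y)) (F k y) : ℝ)
      + inner ℝ (F j y) (nabla (F k) y (F i y)) = 0 := by
    have : ∀ᶠ y in 𝓝 x, ∀ j k, ∃ c : ℝ, ∀ᶠ z in 𝓝 y, (inner ℝ (F j z) (F k z) : ℝ) = c := by
      refine eventually_all.2 fun j ↦ eventually_all.2 fun k ↦ ?_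
      obtain ⟨c, hc⟩ := hF.inner_eventuallyEq j k
      filter_upwards [hc.eventually_nhds] with y hy using ⟨c, hy⟩
    filter_upwards [this, hd] with y hy hdy i j k
    rw [← h.metric (F j) (F k) y (hdy j) (hdy k)]
    obtain ⟨c, hc⟩ := hy j k
    rw [mvfderiv_congr hc, mvfderiv_const]
    rfl
  filter_upwards [hd, hc] with y hdy hcy
  change _ = 1 / 2 * (inner ℝ (VectorField.mlieBracket I (F i) (F j) y) _
    - inner ℝ (VectorField.mlieBracket I (F i) (F k) y) _
    - inner ℝ (VectorField.mlieBracket I (F j) (F k) y) _)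
  rw [mlieBracket_eq h (hdy i) (hdy j), mlieBracket_eq h (hdy i) (hdy k),
    mlieBracket_eq h (hdy j) (hdy k)]
  simp only [inner_sub_left]
  have e1 := hcy i j k
  have e2 := hcy j i k
  have e3 := hcy k i j
  simp only [real_inner_comm (nabla _ y _) (F _ y)] at e1 e2 e3 ⊢
  linarith

theorem contMDiffAt_nabla_frame (h : IsLeviCivita nabla) (hF : IsOrthonormalFrameAt F x)
    {Y : ∀ y : M, TangentSpace I y} (hY : CMDiffAt ∞ (T% Y) x) (i : κ) :
    CMDiffAt ∞ (T% (fun y ↦ nabla Y y (F i y))) x := by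
  refine hF.contMDiffAt_of_inner fun k ↦ ?_
  have h1 := contMDiffAt_mvfderiv (contMDiffAt_inner hY (hF.contMDiffAt k)) (hF.contMDiffAt i)
  have h2 := contMDiffAt_inner hY (contMDiffAt_nabla_frame_frame h hF i k)
  refine (h1.sub h2).congr_of_eventuallyEq ?_
  filter_upwards [eventually_mdifferentiableAt hY,
    eventually_mdifferentiableAt (hF.contMDiffAt k)] with y hy hk
  rw [h.metric _ _ y hy hk, real_inner_comm]
  ring

/-- A field of bilinear maps that takes differentiable vector fields to differentiable ones. -/
def IsDiffTensorAt
    (S : ∀ x : M, TangentSpace I x →ₗ[ℝ] TangentSpace I x →ₗ[ℝ] TangentSpace I x) (x : M) : Prop :=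
  ∀ V W : ∀ y : M, TangentSpace I y, MDiffAt (T% V) x → MDiffAt (T% W) x →
    MDiffAt (T% (fun y ↦ S y (V y) (W y))) x

theorem isDiffTensorAt_of_frame
    {S : ∀ x : M, TangentSpace I x →ₗ[ℝ] TangentSpace I x →ₗ[ℝ] TangentSpace I x}
    (hF : IsOrthonormalFrameAt F x) (h : ∀ i j, MDiffAt (T% (fun y ↦ S y (F i y) (F j y))) x) :
    IsDiffTensorAt S x := by
  intro V W hV hW
  have hd : ∀ i, MDiffAt (T% (F i)) x := fun i ↦ mdifferentiableAt_of_smooth (hF.contMDiffAt i)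
  have h1 : MDiffAt (T% (fun y ↦ ∑ i, (inner ℝ (F i y) (V y) : ℝ) •
      ∑ j, (inner ℝ (F j y) (W y) : ℝ) • S y (F i y) (F j y))) x :=
    MDifferentiableAt.sum_section fun i _ ↦ (mdifferentiableAt_inner (hd i) hV).smul_section <|
      MDifferentiableAt.sum_section fun j _ ↦
        (mdifferentiableAt_inner (hd j) hW).smul_section (h i j)
  refine h1.congr_of_eventuallyEq ?_
  filter_upwards [hF.expand] with y hy
  refine congrArg _ ?_
  conv_lhs => rw [hy (V y), hy (W y)]
  simp only [map_sum, map_smul, LinearMap.sum_apply, LinearMap.smul_apply, Finset.smul_sum]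
  rw [Finset.sum_comm]
  exact Finset.sum_congr rfl fun i _ ↦ Finset.sum_congr rfl fun j _ ↦ smul_comm ..

theorem isDiffTensorAt_intrinsicTorsion (h : IsLeviCivita nabla) (x : M) :
    IsDiffTensorAt (intrinsicTorsion J nabla) x := by
  obtain ⟨F, hF⟩ := exists_orthonormalFrameAt (I := I) x
  refine isDiffTensorAt_of_frame hF fun i j ↦ ?_
  have hJ := contMDiffAt_J J (hF.contMDiffAt j)
  have h1 := contMDiffAt_J J (contMDiffAt_nabla_frame h hF hJ i)
  have h2 := contMDiffAt_nabla_frame h hF (hF.contMDiffAt j) i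
  have h3 := mdifferentiableAt_of_smooth
    ((h1.add_section h2).const_smul_section (a := (-(1 / 2) : ℝ)))
  refine h3.congr_of_eventuallyEq ?_
  filter_upwards [eventually_mdifferentiableAt (hF.contMDiffAt j)] with y hy
  exact congrArg _ (intrinsicTorsion_apply _ hy)

end Frame

/-! ### Covariant derivatives of tensor fields -/

section TensorCalculus

set_option linter.unusedSectionVars false

open Filter Topology InnerProductSpace

variable {E : Type*} [NormedAddCommGroup E] [NormedSpace ℝ E]
  {H : Type*} [TopologicalSpace H] {I : ModelWithCorners ℝ E H}
  {M : Type*} [TopologicalSpace M] [ChartedSpace H M]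
  [FiniteDimensional ℝ E] [IsManifold I ∞ M]
  [RiemannianBundle (fun x : M ↦ TangentSpace I x)]
  {J : OrthogonalComplexStructure I M}
  {D : CovariantDerivative I E (TangentSpace I : M → Type _)} {x : M}
  {σ τ : ∀ y : M, TangentSpace I y} {σ' τ' : TangentSpace I x → TangentSpace I x}

theorem mvfderiv_mul_sub_add (c : ℝ) {f g h : M → ℝ} (hf : MDiffAt f x) (hg : MDiffAt g x)
    (hh : MDiffAt h x) (u : TangentSpace I x) :
    mvfderiv I (fun y ↦ c * (f y - g y + h y)) x u
      = c * (mvfderiv I f x u - mvfderiv I g x u + mvfderiv I h x u) := by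
  change mvfderiv I ((fun _ ↦ c) * (f - g + h)) x u = _
  rw [mvfderiv_mul mdifferentiableAt_const ((hf.sub hg).add hh), mvfderiv_const,
    mvfderiv_add (hf.sub hg) hh, mvfderiv_sub hf hg, smul_zero, add_zero]
  rfl

/-- The vector field `σ` is differentiable at `x`, with `D_u σ = σ' u` there. -/
structure HasCovDerivAt (D : CovariantDerivative I E (TangentSpace I : M → Type _))
    (σ : ∀ y : M, TangentSpace I y) (x : M) (σ' : TangentSpace I x → TangentSpace I x) :
    Prop where
  mdifferentiableAt : MDiffAt (T% σ) x
  eq : ∀ u, D σ x u = σ' u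

theorem hasCovDerivAt (h : MDiffAt (T% σ) x) : HasCovDerivAt D σ x (fun u ↦ D σ x u) :=
  ⟨h, fun _ ↦ rfl⟩

theorem hasCovDerivAt_extend (v : TangentSpace I x) :
    HasCovDerivAt D (FiberBundle.extend E v) x (fun u ↦ D (FiberBundle.extend E v) x u) :=
  hasCovDerivAt (FiberBundle.mdifferentiableAt_extend ..)

namespace HasCovDerivAt

theorem add (hσ : HasCovDerivAt D σ x σ') (hτ : HasCovDerivAt D τ x τ') :
    HasCovDerivAt D (fun y ↦ σ y + τ y) x (fun u ↦ σ' u + τ' u) :=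
  ⟨mdifferentiableAt_add_section hσ.1 hτ.1, fun u ↦ by
    rw [← hσ.2, ← hτ.2]
    exact congrArg (· u) (D.isCovariantDerivativeOnUniv.add hσ.1 hτ.1)⟩

theorem smul {f : M → ℝ} (hf : MDiffAt f x) (hσ : HasCovDerivAt D σ x σ') :
    HasCovDerivAt D (fun y ↦ f y • σ y) x (fun u ↦ f x • σ' u + mvfderiv I f x u • σ x) :=
  ⟨hf.smul_section hσ.1, fun u ↦ by
    rw [← hσ.2]
    exact congrArg (· u) (D.isCovariantDerivativeOnUniv.leibniz hσ.1 hf)⟩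

theorem const_smul (c : ℝ) (hσ : HasCovDerivAt D σ x σ') :
    HasCovDerivAt D (fun y ↦ c • σ y) x (fun u ↦ c • σ' u) :=
  ⟨hσ.1.smul_const_section, fun u ↦ by
    rw [← hσ.2]
    exact congrArg (· u) (D.isCovariantDerivativeOnUniv.smul_const c hσ.1)⟩

theorem congr_deriv (hσ : HasCovDerivAt D σ x σ') (h : ∀ u, σ' u = τ' u) :
    HasCovDerivAt D σ x τ' :=
  ⟨hσ.1, fun u ↦ (hσ.2 u).trans (h u)⟩

theorem sub (hσ : HasCovDerivAt D σ x σ') (hτ : HasCovDerivAt D τ x τ') :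
    HasCovDerivAt D (fun y ↦ σ y - τ y) x (fun u ↦ σ' u - τ' u) := by
  have := (hσ.add (hτ.const_smul (-1))).congr_deriv (τ' := fun u ↦ σ' u - τ' u)
    fun u ↦ by module
  simpa [sub_eq_add_neg] using this

theorem congr (hσ : HasCovDerivAt D σ x σ') (h : ∀ᶠ y in 𝓝 x, τ y = σ y) :
    HasCovDerivAt D τ x σ' := by
  have hτ : MDiffAt (T% τ) x :=
    hσ.1.congr_of_eventuallyEq (h.mono fun y hy ↦ congrArg _ hy)
  exact ⟨hτ, fun u ↦ by
    rw [← hσ.2]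
    exact congrArg (· u) (D.isCovariantDerivativeOnUniv.congr_of_eventuallyEq hτ hσ.1
      univ_mem h)⟩

theorem sum {κ : Type*} (s : Finset κ) {σ : κ → ∀ y : M, TangentSpace I y}
    {σ' : κ → TangentSpace I x → TangentSpace I x} (h : ∀ i, HasCovDerivAt D (σ i) x (σ' i)) :
    HasCovDerivAt D (fun y ↦ ∑ i ∈ s, σ i y) x (fun u ↦ ∑ i ∈ s, σ' i u) := by
  classical
  induction s using Finset.induction_on with
  | empty =>
    refine ⟨mdifferentiableAt_zeroSection .., fun u ↦ ?_⟩
    simp only [Finset.sum_empty]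
    exact congrArg (· u) (D.isCovariantDerivativeOnUniv.zero (x := x))
  | insert a s ha ih =>
    simp only [Finset.sum_insert ha]
    exact (h a).add ih

theorem toFun (hD : IsComplexConnection J D) (hσ : HasCovDerivAt D σ x σ') :
    HasCovDerivAt D (fun y ↦ J.toFun y (σ y)) x (fun u ↦ J.toFun x (σ' u)) :=
  ⟨mdifferentiableAt_J J hσ.1, fun u ↦ by rw [hD σ x hσ.1, hσ.2]⟩

theorem mvfderiv_inner (hD : IsMetricConnection D) (hσ : HasCovDerivAt D σ x σ')
    (hτ : HasCovDerivAt D τ x τ') (u : TangentSpace I x) :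
    mvfderiv I (fun y ↦ (inner ℝ (σ y) (τ y) : ℝ)) x u
      = inner ℝ (σ' u) (τ x) + inner ℝ (σ x) (τ' u) := by
  rw [hD σ τ x hσ.1 hτ.1, hσ.2, hτ.2]

end HasCovDerivAt

variable {S T : ∀ x : M, TangentSpace I x →ₗ[ℝ] TangentSpace I x →ₗ[ℝ] TangentSpace I x}
  {S' T' : TangentSpace I x → TangentSpace I x →ₗ[ℝ] TangentSpace I x →ₗ[ℝ] TangentSpace I x}

/-- The tensor field `S` is differentiable at `x`, with `D_u S = S' u` there. -/
def HasTensorDerivAt (D : CovariantDerivative I E (TangentSpace I : M → Type _))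
    (S : ∀ x : M, TangentSpace I x →ₗ[ℝ] TangentSpace I x →ₗ[ℝ] TangentSpace I x) (x : M)
    (S' : TangentSpace I x → TangentSpace I x →ₗ[ℝ] TangentSpace I x →ₗ[ℝ] TangentSpace I x) :
    Prop :=
  ∀ ⦃V W : ∀ y : M, TangentSpace I y⦄ ⦃V' W' : TangentSpace I x → TangentSpace I x⦄,
    HasCovDerivAt D V x V' → HasCovDerivAt D W x W' →
    HasCovDerivAt D (fun y ↦ S y (V y) (W y)) x
      (fun u ↦ S' u (V x) (W x) + S x (V' u) (W x) + S x (V x) (W' u))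

theorem HasTensorDerivAt.tensorDeriv_eq (h : HasTensorDerivAt D S x S')
    (u v w : TangentSpace I x) : tensorDeriv D S x u v w = S' u v w := by
  simp only [tensorDeriv]
  rw [(h (hasCovDerivAt_extend v) (hasCovDerivAt_extend w)).eq]
  simp only [FiberBundle.extend_apply_self]
  abel

/-- The defining expression is linear over functions in both fields, so it depends only on their
values at `x`. Having the derivative as a trilinear map is what lets the algebraic lemmas apply to
it. -/
theorem exists_hasTensorDerivAt (D : CovariantDerivative I E (TangentSpace I : M → Type _))
    (hS : IsDiffTensorAt S x) :
    ∃ S' : TangentSpace I x →ₗ[ℝ] TangentSpace I x →ₗ[ℝ] TangentSpace I x →ₗ[ℝ] TangentSpace I x,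
      HasTensorDerivAt D S x (fun u ↦ S' u) := by
  let Φ : TangentSpace I x → (∀ y : M, TangentSpace I y) → (∀ y : M, TangentSpace I y) →
      TangentSpace I x := fun u V W ↦
    D (fun y ↦ S y (V y) (W y)) x u - S x (D V x u) (W x) - S x (V x) (D W x u)
  have h₁ : ∀ u W, MDiffAt (T% W) x → TensorialAt I E (Φ u · W) x := by
    intro u W hW
    constructor
    · intro f V hf hV
      have e1 := ((hasCovDerivAt (D := D) (hS V W hV hW)).smul hf).eq u
      have e2 := ((hasCovDerivAt (D := D) hV).smul hf).eq u
      have e3 : (fun y ↦ S y ((f • V) y) (W y)) = fun y ↦ f y • S y (V y) (W y) := by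
        funext y; simp
      simp only [Φ, e3, e1]
      erw [e2]
      simp only [map_add, map_smul, LinearMap.add_apply, LinearMap.smul_apply, Pi.smul_apply']
      module
    · intro V V₂ hV hV₂
      have e1 := ((hasCovDerivAt (D := D) (hS V W hV hW)).add
        (hasCovDerivAt (hS V₂ W hV₂ hW))).eq u
      have e2 := ((hasCovDerivAt (D := D) hV).add (hasCovDerivAt hV₂)).eq u
      have e3 : (fun y ↦ S y ((V + V₂) y) (W y))
          = fun y ↦ S y (V y) (W y) + S y (V₂ y) (W y) := by
        funext y; simp
      simp only [Φ, e3, e1]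
      erw [e2]
      simp only [map_add, LinearMap.add_apply, Pi.add_apply]
      module
  have h₂ : ∀ u V, MDiffAt (T% V) x → TensorialAt I E (Φ u V ·) x := by
    intro u V hV
    constructor
    · intro f W hf hW
      have e1 := ((hasCovDerivAt (D := D) (hS V W hV hW)).smul hf).eq u
      have e2 := ((hasCovDerivAt (D := D) hW).smul hf).eq u
      have e3 : (fun y ↦ S y (V y) ((f • W) y)) = fun y ↦ f y • S y (V y) (W y) := by
        funext y; simp
      simp only [Φ, e3, e1]
      erw [e2]
      simp only [map_add, map_smul, Pi.smul_apply']
      module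
    · intro W W₂ hW hW₂
      have e1 := ((hasCovDerivAt (D := D) (hS V W hV hW)).add
        (hasCovDerivAt (hS V W₂ hV hW₂))).eq u
      have e2 := ((hasCovDerivAt (D := D) hW).add (hasCovDerivAt hW₂)).eq u
      have e3 : (fun y ↦ S y (V y) ((W + W₂) y))
          = fun y ↦ S y (V y) (W y) + S y (V y) (W₂ y) := by
        funext y; simp
      simp only [Φ, e3, e1]
      erw [e2]
      simp only [map_add, Pi.add_apply]
      module
  let B : TangentSpace I x → TangentSpace I x →ₗ[ℝ] TangentSpace I x →ₗ[ℝ] TangentSpace I x :=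
    fun u ↦ (ContinuousLinearMap.coeLM ℝ).comp
      (TensorialAt.mkHom₂ (Φ u) x (h₁ u) (h₂ u)).toLinearMap
  have hB : ∀ u V W, MDiffAt (T% V) x → MDiffAt (T% W) x → B u (V x) (W x) = Φ u V W :=
    fun u V W hV hW ↦ TensorialAt.mkHom₂_apply (h₁ u) (h₂ u) hV hW
  have hB' : ∀ u v w, B u v w = Φ u (FiberBundle.extend E v) (FiberBundle.extend E w) :=
    fun u v w ↦ rfl
  refine ⟨{ toFun := B, map_add' := fun u u' ↦ ?_, map_smul' := fun c u ↦ ?_ }, ?_⟩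
  · ext v w
    simp only [LinearMap.add_apply, hB', Φ, map_add]
    abel
  · ext v w
    simp only [LinearMap.smul_apply, hB', Φ, map_smul, RingHom.id_apply]
    module
  · intro V W V' W' hV hW
    refine ⟨hS V W hV.1 hW.1, fun u ↦ ?_⟩
    change _ = B u (V x) (W x) + _ + _
    rw [hB u V W hV.1 hW.1, ← hV.2, ← hW.2]
    simp only [Φ]
    abel

namespace HasTensorDerivAt

theorem add (hS : HasTensorDerivAt D S x S') (hT : HasTensorDerivAt D T x T') :
    HasTensorDerivAt D (fun y ↦ S y + T y) x (fun u ↦ S' u + T' u) := fun _ _ _ _ hV hW ↦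
  ((hS hV hW).add (hT hV hW)).congr_deriv fun u ↦ by
    simp only [LinearMap.add_apply]
    abel

theorem const_smul (c : ℝ) (hS : HasTensorDerivAt D S x S') :
    HasTensorDerivAt D (fun y ↦ c • S y) x (fun u ↦ c • S' u) := fun _ _ _ _ hV hW ↦
  ((hS hV hW).const_smul c).congr_deriv fun u ↦ by
    simp only [LinearMap.smul_apply]
    module

theorem sub (hS : HasTensorDerivAt D S x S') (hT : HasTensorDerivAt D T x T') :
    HasTensorDerivAt D (fun y ↦ S y - T y) x (fun u ↦ S' u - T' u) := fun _ _ _ _ hV hW ↦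
  ((hS hV hW).sub (hT hV hW)).congr_deriv fun u ↦ by
    simp only [LinearMap.sub_apply]
    abel

theorem compl₁₂ (hD : IsComplexConnection J D) (hS : HasTensorDerivAt D S x S') :
    HasTensorDerivAt D (fun y ↦ (S y).compl₁₂ (J.at y) (J.at y)) x
      (fun u ↦ (S' u).compl₁₂ (J.at x) (J.at x)) := fun _ _ _ _ hV hW ↦
  hS (hV.toFun hD) (hW.toFun hD)

theorem part₁₂ (hD : IsComplexConnection J D) (hS : HasTensorDerivAt D S x S') :
    HasTensorDerivAt D (fun y ↦ part₁₂ (J.at y) (S y)) x (fun u ↦ part₁₂ (J.at x) (S' u)) :=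
  (hS.sub (hS.compl₁₂ hD)).const_smul _

theorem part₃₄ (hD : IsComplexConnection J D) (hS : HasTensorDerivAt D S x S') :
    HasTensorDerivAt D (fun y ↦ part₃₄ (J.at y) (S y)) x (fun u ↦ part₃₄ (J.at x) (S' u)) :=
  (hS.add (hS.compl₁₂ hD)).const_smul _

variable [IsContMDiffRiemannianBundle I ∞ E (fun x : M ↦ TangentSpace I x)]

/-- The conditions defining the torsion space involve only the metric and `J`, both parallel, so
they can be differentiated. -/
theorem mem_torsionSpace (hm : IsMetricConnection D) (hD : IsComplexConnection J D)
    (hS : HasTensorDerivAt D S x S') (h : ∀ y, S y ∈ torsionSpace (J.at y))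
    (u : TangentSpace I x) : S' u ∈ torsionSpace (J.at x) := by
  refine ⟨fun v w z ↦ ?_, fun v w ↦ ?_⟩
  · have hv := hasCovDerivAt_extend (D := D) v
    have hw := hasCovDerivAt_extend (D := D) w
    have hz := hasCovDerivAt_extend (D := D) z
    have h1 := (hS hv hw).mvfderiv_inner hm hz u
    have h2 := hw.mvfderiv_inner hm (hS hv hz) u
    have h3 : mvfderiv I (fun y ↦ (inner ℝ (S y (FiberBundle.extend E v y)
        (FiberBundle.extend E w y)) (FiberBundle.extend E z y) : ℝ)) x
        = -mvfderiv I (fun y ↦ (inner ℝ (FiberBundle.extend E w y)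
          (S y (FiberBundle.extend E v y) (FiberBundle.extend E z y)) : ℝ)) x := by
      rw [← mvfderiv_fun_neg]
      congr 1
      funext y
      exact (h y).1 _ _ _
    rw [h3, neg_apply, h2] at h1
    simp only [FiberBundle.extend_apply_self, inner_add_left, inner_add_right, (h x).1 v,
      (h x).1 (D (FiberBundle.extend E v) x u)] at h1
    linarith
  · have hv := hasCovDerivAt_extend (D := D) v
    have hw := hasCovDerivAt_extend (D := D) w
    have h1 := (hS hv (hw.toFun hD)).eq u
    have h2 := (((hS hv hw).toFun hD).const_smul (-1)).eq u
    have h3 : (fun y ↦ S y (FiberBundle.extend E v y) (J.toFun y (FiberBundle.extend E w y)))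
        = fun y ↦ (-1 : ℝ) • J.toFun y (S y (FiberBundle.extend E v y)
          (FiberBundle.extend E w y)) := by
      funext y
      rw [neg_one_smul]
      exact (h y).2 _ _
    rw [h3, h2] at h1
    have h4 : ∀ a b, S x a (J.toFun x b) = -J.toFun x (S x a b) := (h x).2
    simp only [FiberBundle.extend_apply_self, h4, map_add] at h1
    have h5 : S' u v (J.toFun x w) = -J.toFun x (S' u v w) := by
      have h6 := sub_eq_zero.2 h1
      rw [← sub_eq_zero, ← neg_eq_zero, ← h6]
      module
    exact h5

/-- The adjoint is removed by pairing with a test field: each inner product is differentiated with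
the metric Leibniz rule, and differentiability is tested against an orthonormal frame. -/
theorem cyclicPart (hm : IsMetricConnection D) (hS : HasTensorDerivAt D S x S') :
    HasTensorDerivAt D (fun y ↦ cyclicPart (S y)) x (fun u ↦ cyclicPart (S' u)) := by
  have key : ∀ {y : M} (T : TangentSpace I y →ₗ[ℝ] TangentSpace I y →ₗ[ℝ] TangentSpace I y)
      (u v w : TangentSpace I y), inner ℝ (AlmostHermitian.cyclicPart T u v) w
        = (1 / 3 : ℝ) * (inner ℝ (T u v) w - inner ℝ (T v u) w + inner ℝ v (T w u)) := by
    intro y T u v w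
    simp only [AlmostHermitian.cyclicPart, LinearMap.mk₂_apply, real_inner_smul_left,
      inner_add_left, inner_sub_left, LinearMap.adjoint_inner_left, LinearMap.flip_apply]
  intro V W V' W' hV hW
  have hd : ∀ {Z : ∀ y : M, TangentSpace I y} {Z' : TangentSpace I x → TangentSpace I x},
      HasCovDerivAt D Z x Z' →
      MDiffAt (fun y ↦ (inner ℝ (S y (V y) (W y)) (Z y) : ℝ)) x ∧
      MDiffAt (fun y ↦ (inner ℝ (S y (W y) (V y)) (Z y) : ℝ)) x ∧
      MDiffAt (fun y ↦ (inner ℝ (W y) (S y (Z y) (V y)) : ℝ)) x := fun hZ ↦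
    ⟨mdifferentiableAt_inner (hS hV hW).1 hZ.1, mdifferentiableAt_inner (hS hW hV).1 hZ.1,
      mdifferentiableAt_inner hW.1 (hS hZ hV).1⟩
  have hdiff : MDiffAt (T% (fun y ↦ AlmostHermitian.cyclicPart (S y) (V y) (W y))) x := by
    obtain ⟨F, hF⟩ := exists_orthonormalFrameAt (I := I) x
    refine hF.mdifferentiableAt fun i ↦ ?_
    obtain ⟨h1, h2, h3⟩ := hd (hasCovDerivAt (mdifferentiableAt_of_smooth (hF.contMDiffAt i)))
    simp_rw [real_inner_comm _ (F i _), key]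
    exact mdifferentiableAt_const.mul ((h1.sub h2).add h3)
  refine ⟨hdiff, fun u ↦ ext_inner_right ℝ fun z ↦ ?_⟩
  have hz := hasCovDerivAt_extend (D := D) z
  obtain ⟨h1, h2, h3⟩ := hd hz
  have e := (hasCovDerivAt (D := D) hdiff).mvfderiv_inner hm hz u
  simp_rw [key] at e
  rw [mvfderiv_mul_sub_add _ h1 h2 h3, (hS hV hW).mvfderiv_inner hm hz, (hS hW hV).mvfderiv_inner hm hz,
    hW.mvfderiv_inner hm (hS hz hV)] at e
  simp only [FiberBundle.extend_apply_self, inner_add_left, inner_add_right] at e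
  simp only [inner_add_left, key]
  linarith

/-- The bases chosen in the definition need not vary smoothly, but the trace is basis independent
and may be taken in a smooth orthonormal frame. The derivatives of the frame cancel because its
connection matrix is skew. -/
theorem traceVector (hm : IsMetricConnection D) (hS : HasTensorDerivAt D S x S') :
    HasCovDerivAt D (fun y ↦ traceVector (S y)) x (fun u ↦ traceVector (S' u)) := by
  obtain ⟨F, hF⟩ := exists_orthonormalFrameAt (I := I) x
  have hd : ∀ i, HasCovDerivAt D (F i) x (fun u ↦ D (F i) x u) := fun i ↦
    hasCovDerivAt (mdifferentiableAt_of_smooth (hF.contMDiffAt i))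
  have h1 := (HasCovDerivAt.sum Finset.univ fun i ↦ hS (hd i) (hd i)).congr
    (τ := fun y ↦ AlmostHermitian.traceVector (S y)) (by
      filter_upwards [hF.basis] with y ⟨b, hb⟩
      simp only [traceVector_eq b, hb])
  refine h1.congr_deriv fun u ↦ ?_
  obtain ⟨b, hb⟩ := hF.basis.self_of_nhds
  have hskew : ∀ i j, (inner ℝ (D (F i) x u) (F j x) : ℝ) = -inner ℝ (D (F j) x u) (F i x) := by
    intro i j
    obtain ⟨c, hc⟩ := hF.inner_eventuallyEq i j
    have := (hd i).mvfderiv_inner hm (hd j) u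
    rw [mvfderiv_congr hc, mvfderiv_const, real_inner_comm (D (F j) x u)] at this
    exact eq_neg_of_add_eq_zero_left this.symm
  have h2 : ∑ i, S x (D (F i) x u) (F i x) = -∑ i, S x (F i x) (D (F i) x u) := by
    have e1 : ∀ i, S x (D (F i) x u) (F i x)
        = ∑ j, (inner ℝ (D (F i) x u) (F j x) : ℝ) • S x (F j x) (F i x) := fun i ↦ by
      have := sum_inner_smul_map b ((S x).flip (F i x)) (D (F i) x u)
      simpa only [hb, LinearMap.flip_apply, real_inner_comm] using this.symm
    have e2 : ∀ i, S x (F i x) (D (F i) x u)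
        = ∑ j, (inner ℝ (D (F i) x u) (F j x) : ℝ) • S x (F i x) (F j x) := fun i ↦ by
      have := sum_inner_smul_map b (S x (F i x)) (D (F i) x u)
      simpa only [hb, real_inner_comm] using this.symm
    simp_rw [e1, e2]
    rw [Finset.sum_comm, ← Finset.sum_neg_distrib]
    refine Finset.sum_congr rfl fun i _ ↦ ?_
    rw [← Finset.sum_neg_distrib]
    refine Finset.sum_congr rfl fun j _ ↦ ?_
    rw [hskew, neg_smul]
  simp only [traceVector_eq b, hb, Finset.sum_add_distrib, h2]
  abel

end HasTensorDerivAt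

variable [IsContMDiffRiemannianBundle I ∞ E (fun x : M ↦ TangentSpace I x)]

theorem HasCovDerivAt.vectorTensor (hm : IsMetricConnection D) (hD : IsComplexConnection J D)
    (hσ : HasCovDerivAt D σ x σ') :
    HasTensorDerivAt D (fun y ↦ vectorTensor (J.at y) (σ y)) x
      (fun u ↦ vectorTensor (J.at x) (σ' u)) := by
  intro V W V' W' hV hW
  have hi := fun {A B : ∀ y : M, TangentSpace I y} (hA : MDiffAt (T% A) x)
    (hB : MDiffAt (T% B) x) ↦ mdifferentiableAt_inner hA hB
  have hJW := hW.toFun hD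
  have h := (((hσ.smul (hi hV.1 hW.1)).sub (hV.smul (hi hσ.1 hW.1))).add
    ((hσ.toFun hD).smul (hi hV.1 hJW.1))).sub ((hV.toFun hD).smul (hi hσ.1 hJW.1))
  refine h.congr_deriv fun u ↦ ?_
  rw [hV.mvfderiv_inner hm hW, hσ.mvfderiv_inner hm hW, hV.mvfderiv_inner hm hJW,
    hσ.mvfderiv_inner hm hJW]
  simp only [vectorTensor_apply, OrthogonalComplexStructure.at,
    ContinuousLinearMap.coe_coe]
  module

namespace HasTensorDerivAt

theorem comp₁ (hm : IsMetricConnection D) (hD : IsComplexConnection J D)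
    (hS : HasTensorDerivAt D S x S') :
    HasTensorDerivAt D (fun y ↦ comp₁ (J.at y) (S y)) x (fun u ↦ comp₁ (J.at x) (S' u)) :=
  (hS.part₁₂ hD).cyclicPart hm

theorem comp₂ (hm : IsMetricConnection D) (hD : IsComplexConnection J D)
    (hS : HasTensorDerivAt D S x S') :
    HasTensorDerivAt D (fun y ↦ comp₂ (J.at y) (S y)) x (fun u ↦ comp₂ (J.at x) (S' u)) :=
  (hS.part₁₂ hD).sub (hS.comp₁ hm hD)

theorem comp₄ (hm : IsMetricConnection D) (hD : IsComplexConnection J D) (n : ℕ)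
    (hS : HasTensorDerivAt D S x S') :
    HasTensorDerivAt D (fun y ↦ comp₄ n (J.at y) (S y)) x (fun u ↦ comp₄ n (J.at x) (S' u)) :=
  ((hS.traceVector hm).vectorTensor hm hD).const_smul _

theorem comp₃ (hm : IsMetricConnection D) (hD : IsComplexConnection J D) (n : ℕ)
    (hS : HasTensorDerivAt D S x S') :
    HasTensorDerivAt D (fun y ↦ comp₃ n (J.at y) (S y)) x (fun u ↦ comp₃ n (J.at x) (S' u)) :=
  (hS.part₃₄ hD).sub (hS.comp₄ hm hD n)

end HasTensorDerivAt

end TensorCalculus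

/-! ### The exterior derivatives of the Kähler form -/

section ExteriorDerivative

set_option linter.unusedSectionVars false

open Filter Topology InnerProductSpace VectorField

variable {E : Type*} [NormedAddCommGroup E] [NormedSpace ℝ E]
  {H : Type*} [TopologicalSpace H] {I : ModelWithCorners ℝ E H}
  {M : Type*} [TopologicalSpace M] [ChartedSpace H M]
  [FiniteDimensional ℝ E] [IsManifold I ∞ M]
  [RiemannianBundle (fun x : M ↦ TangentSpace I x)]
  {J : OrthogonalComplexStructure I M}
  {nabla : CovariantDerivative I E (TangentSpace I : M → Type _)} {x : M}

theorem mvfderiv_mul_add_add (c : ℝ) {f g h : M → ℝ} (hf : MDiffAt f x) (hg : MDiffAt g x)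
    (hh : MDiffAt h x) (u : TangentSpace I x) :
    mvfderiv I (fun y ↦ c * (f y + g y + h y)) x u
      = c * (mvfderiv I f x u + mvfderiv I g x u + mvfderiv I h x u) := by
  change mvfderiv I ((fun _ ↦ c) * (f + g + h)) x u = _
  rw [mvfderiv_mul mdifferentiableAt_const ((hf.add hg).add hh), mvfderiv_const,
    mvfderiv_add (hf.add hg) hh, mvfderiv_add hf hg, smul_zero, add_zero]
  rfl

theorem cyclicForm_swap {V : Type*} [NormedAddCommGroup V] [InnerProductSpace ℝ V]
    {J : V →ₗ[ℝ] V} {S : V →ₗ[ℝ] V →ₗ[ℝ] V} (hJ : IsOrthogonalComplex J)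
    (hS : S ∈ torsionSpace J) (u v w : V) : cyclicForm J S u v w = -cyclicForm J S v u w := by
  have h : ∀ a b c, inner ℝ (S a b) (J c) = -inner ℝ (S a c) (J b) := fun a b c ↦ by
    rw [inner_J_right hJ hS, hS.1, real_inner_comm]
  rw [cyclicForm, cyclicForm, h v u w, h u w v, h w v u]
  ring

/-- The invariant formula for `dω`, for arbitrary vector fields. -/
theorem kahlerForm_extDeriv (h : IsLeviCivita nabla) {U V W : ∀ y : M, TangentSpace I y}
    (hU : MDiffAt (T% U) x) (hV : MDiffAt (T% V) x) (hW : MDiffAt (T% W) x) :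
    mvfderiv I (fun y ↦ kahlerForm J y (V y) (W y)) x (U x)
      - mvfderiv I (fun y ↦ kahlerForm J y (U y) (W y)) x (V x)
      + mvfderiv I (fun y ↦ kahlerForm J y (U y) (V y)) x (W x)
      - kahlerForm J x (mlieBracket I U V x) (W x)
      + kahlerForm J x (mlieBracket I U W x) (V x)
      - kahlerForm J x (mlieBracket I V W x) (U x)
      = cyclicForm (J.at x) (intrinsicTorsion J nabla x) (U x) (V x) (W x) := by
  have hm := isMetricConnection_minimal (J := J) h
  have hD := isComplexConnection_minimal (J := J) (nabla := nabla)
  have hξ := intrinsicTorsion_mem (J := J) h x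
  -- Here `ω` is parallel for `∇̃`, so only the fields are differentiated. These derivatives cancel
  -- against the brackets in `hb`, up to the torsion.
  have hω : ∀ {A B : ∀ y : M, TangentSpace I y}, MDiffAt (T% A) x → MDiffAt (T% B) x → ∀ u,
      mvfderiv I (fun y ↦ kahlerForm J y (A y) (B y)) x u
        = inner ℝ (minimalConnection J nabla A x u) (J.toFun x (B x))
          + inner ℝ (A x) (J.toFun x (minimalConnection J nabla B x u)) := fun hA hB u ↦
    (hasCovDerivAt hA).mvfderiv_inner hm ((hasCovDerivAt hB).toFun hD) u
  have hb : ∀ {A B : ∀ y : M, TangentSpace I y}, MDiffAt (T% A) x → MDiffAt (T% B) x →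
      mlieBracket I A B x = minimalConnection J nabla B x (A x)
        - minimalConnection J nabla A x (B x)
        - (intrinsicTorsion J nabla x (A x) (B x) - intrinsicTorsion J nabla x (B x) (A x)) := by
    intro A B hA hB
    rw [mlieBracket_eq h hA hB, minimalConnection_eq_add, minimalConnection_eq_add]
    abel
  have hJ : ∀ a b c, (inner ℝ (intrinsicTorsion J nabla x a b) (J.toFun x c) : ℝ)
      = -inner ℝ (intrinsicTorsion J nabla x a c) (J.toFun x b) := fun a b c ↦ by
    have := inner_J_right (isOrthogonalComplex_at J x) hξ a b c
    exact this.trans ((hξ.1 _ _ _).trans (by rw [real_inner_comm]; rfl))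
  have hs : ∀ a b : TangentSpace I x, (inner ℝ a (J.toFun x b) : ℝ) = -inner ℝ b (J.toFun x a) :=
    fun a b ↦ by rw [← inner_toFun_left, real_inner_comm]
  rw [hω hV hW, hω hU hW, hω hU hV, hb hU hV, hb hU hW, hb hV hW]
  simp only [kahlerForm, cyclicForm, inner_sub_left]
  change _ = 2 * (inner ℝ _ (J.toFun x (W x)) + inner ℝ _ (J.toFun x (U x))
    + inner ℝ _ (J.toFun x (V x)))
  rw [hs (V x), hs (U x), hs (U x) (minimalConnection J nabla V x (W x)),
    hJ (V x) (U x) (W x), hJ (U x) (W x) (V x), hJ (W x) (V x) (U x)]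
  ring

theorem extDeriv₂_kahlerForm (h : IsLeviCivita nabla) (x : M) :
    extDeriv₂ (kahlerForm J) x = cyclicForm (J.at x) (intrinsicTorsion J nabla x) := by
  funext u v w
  have := kahlerForm_extDeriv (J := J) h (FiberBundle.mdifferentiableAt_extend I E u)
    (FiberBundle.mdifferentiableAt_extend I E v) (FiberBundle.mdifferentiableAt_extend I E w)
  simp only [FiberBundle.extend_apply_self] at this
  exact this

variable [IsContMDiffRiemannianBundle I ∞ E (fun x : M ↦ TangentSpace I x)]

theorem mvfderiv_cyclicForm (h : IsLeviCivita nabla)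
    {D : TangentSpace I x →ₗ[ℝ] TangentSpace I x →ₗ[ℝ] TangentSpace I x →ₗ[ℝ] TangentSpace I x}
    (hD : HasTensorDerivAt (minimalConnection J nabla) (intrinsicTorsion J nabla) x
      (fun u ↦ D u))
    {U V W : ∀ y : M, TangentSpace I y} {U' V' W' : TangentSpace I x → TangentSpace I x}
    (hU : HasCovDerivAt (minimalConnection J nabla) U x U')
    (hV : HasCovDerivAt (minimalConnection J nabla) V x V')
    (hW : HasCovDerivAt (minimalConnection J nabla) W x W') (t : TangentSpace I x) :
    mvfderiv I (fun y ↦ cyclicForm (J.at y) (intrinsicTorsion J nabla y) (U y) (V y) (W y)) x t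
      = cyclicForm (J.at x) (D t) (U x) (V x) (W x)
        + cyclicForm (J.at x) (intrinsicTorsion J nabla x) (U' t) (V x) (W x)
        + cyclicForm (J.at x) (intrinsicTorsion J nabla x) (U x) (V' t) (W x)
        + cyclicForm (J.at x) (intrinsicTorsion J nabla x) (U x) (V x) (W' t) := by
  have hm := isMetricConnection_minimal (J := J) h
  have hc := isComplexConnection_minimal (J := J) (nabla := nabla)
  have key : ∀ {A B C : ∀ y : M, TangentSpace I y} {A' B' C' : TangentSpace I x → TangentSpace I x},
      HasCovDerivAt (minimalConnection J nabla) A x A' →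
      HasCovDerivAt (minimalConnection J nabla) B x B' →
      HasCovDerivAt (minimalConnection J nabla) C x C' →
      MDiffAt (fun y ↦ (inner ℝ (intrinsicTorsion J nabla y (A y) (B y))
        (J.toFun y (C y)) : ℝ)) x ∧
      mvfderiv I (fun y ↦ (inner ℝ (intrinsicTorsion J nabla y (A y) (B y))
        (J.toFun y (C y)) : ℝ)) x t
        = inner ℝ (D t (A x) (B x)) (J.toFun x (C x))
          + inner ℝ (intrinsicTorsion J nabla x (A' t) (B x)) (J.toFun x (C x))
          + inner ℝ (intrinsicTorsion J nabla x (A x) (B' t)) (J.toFun x (C x))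
          + inner ℝ (intrinsicTorsion J nabla x (A x) (B x)) (J.toFun x (C' t)) := by
    intro A B C A' B' C' hA hB hC
    refine ⟨mdifferentiableAt_inner (hD hA hB).1 (mdifferentiableAt_J J hC.1), ?_⟩
    rw [(hD hA hB).mvfderiv_inner hm (hC.toFun hc)]
    simp only [inner_add_left]
  obtain ⟨d1, e1⟩ := key hU hV hW
  obtain ⟨d2, e2⟩ := key hV hW hU
  obtain ⟨d3, e3⟩ := key hW hU hV
  have e := mvfderiv_mul_add_add 2 d1 d2 d3 t
  rw [e1, e2, e3] at e
  refine Eq.trans e ?_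
  simp only [cyclicForm, OrthogonalComplexStructure.at, ContinuousLinearMap.coe_coe]
  ring

theorem extDeriv₃_extDeriv₂_kahlerForm (h : IsLeviCivita nabla)
    {D : TangentSpace I x →ₗ[ℝ] TangentSpace I x →ₗ[ℝ] TangentSpace I x →ₗ[ℝ] TangentSpace I x}
    (hD : HasTensorDerivAt (minimalConnection J nabla) (intrinsicTorsion J nabla) x
      (fun u ↦ D u)) (t u v w : TangentSpace I x) :
    extDeriv₃ (extDeriv₂ (kahlerForm J)) x t u v w
      = cyclicFormDeriv (J.at x) D (intrinsicTorsion J nabla x) t u v w := by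
  have hb : ∀ a b : TangentSpace I x,
      mlieBracket I (FiberBundle.extend E a) (FiberBundle.extend E b) x
        = minimalConnection J nabla (FiberBundle.extend E b) x a
          - minimalConnection J nabla (FiberBundle.extend E a) x b
          - (intrinsicTorsion J nabla x a b - intrinsicTorsion J nabla x b a) := by
    intro a b
    rw [mlieBracket_eq h (FiberBundle.mdifferentiableAt_extend I E a)
      (FiberBundle.mdifferentiableAt_extend I E b), minimalConnection_eq_add,
      minimalConnection_eq_add]
    simp only [FiberBundle.extend_apply_self]
    abel
  have hα : extDeriv₂ (kahlerForm J)
      = fun y ↦ cyclicForm (J.at y) (intrinsicTorsion J nabla y) :=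
    funext fun y ↦ extDeriv₂_kahlerForm h y
  have hd : ∀ a b c z : TangentSpace I x, _ := fun a b c z ↦
    mvfderiv_cyclicForm h hD (hasCovDerivAt_extend a) (hasCovDerivAt_extend b)
      (hasCovDerivAt_extend c) z
  have hsw := cyclicForm_swap (isOrthogonalComplex_at J x) (intrinsicTorsion_mem (J := J) h x)
  have hmid : ∀ a b c, cyclicForm (J.at x) (intrinsicTorsion J nabla x) a b c
      = cyclicForm (J.at x) (intrinsicTorsion J nabla x) c a b := fun a b c ↦
    (cyclicForm_rotate c a b).symm
  have hsub : ∀ a a' b c, cyclicForm (J.at x) (intrinsicTorsion J nabla x) (a - a') b c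
      = cyclicForm (J.at x) (intrinsicTorsion J nabla x) a b c
        - cyclicForm (J.at x) (intrinsicTorsion J nabla x) a' b c := fun a a' b c ↦
    map_sub (cyclicFormLeft (J.at x) (intrinsicTorsion J nabla x) b c) a a'
  rw [hα]
  simp only [extDeriv₃, hd, hb, FiberBundle.extend_apply_self, cyclicFormDeriv, hsub]
  -- Every derivative of an extension field is brought to the first slot, where those from the
  -- Leibniz rule cancel those from the brackets.
  simp only [hsw _ (minimalConnection J nabla (FiberBundle.extend E _) x _) _,
    hmid _ _ (minimalConnection J nabla (FiberBundle.extend E _) x _)]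
  ring

/-! ### Vanishing of `d²ω` -/

/-- Derivatives along commuting vector fields commute. -/
theorem mvfderiv_mvfderiv_comm {U V : ∀ y : M, TangentSpace I y} {f : M → ℝ}
    (hU : CMDiffAt ∞ (T% U) x) (hV : CMDiffAt ∞ (T% V) x) (hf : CMDiffAt ∞ f x)
    (h : ∀ᶠ y in 𝓝 x, mlieBracket I U V y = 0) :
    mvfderiv I (fun y ↦ mvfderiv I f y (V y)) x (U x)
      = mvfderiv I (fun y ↦ mvfderiv I f y (U y)) x (V x) := by
  obtain ⟨F, hF⟩ := exists_orthonormalFrameAt (I := I) x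
  rcases isEmpty_or_nonempty (Fin (Module.finrank ℝ E)) with he | ⟨⟨i⟩⟩
  · have hz := hF.expand.self_of_nhds
    rw [hz (U x), hz (V x)]
    simp
  set W := F i
  have hW : CMDiffAt ∞ (T% W) x := hF.contMDiffAt i
  have hWx : W x ≠ 0 := by
    obtain ⟨b, hb⟩ := hF.basis.self_of_nhds
    change F i x ≠ 0
    rw [← hb]
    exact b.orthonormal.ne_zero i
  have : CompleteSpace E := FiniteDimensional.complete ℝ E
  have : IsManifold I (minSmoothness ℝ 3) M := by
    rw [minSmoothness_of_isRCLikeNormedField]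
    exact IsManifold.of_le (n := ∞) (by norm_cast)
  have hle : (minSmoothness ℝ 2) ≤ (∞ : ℕ∞ω) := by
    rw [minSmoothness_of_isRCLikeNormedField]
    norm_cast
  -- By the Jacobi identity the operators `[U, ·]` and `[V, ·]` commute. Applied to `f W` with `W x
  -- ≠ 0` and expanded by the Leibniz rule, this leaves the commutator of the second derivatives of
  -- `f` as coefficient of `W`.
  have jac : ∀ {Z : ∀ y : M, TangentSpace I y}, CMDiffAt ∞ (T% Z) x →
      mlieBracket I U (mlieBracket I V Z) x = mlieBracket I V (mlieBracket I U Z) x := by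
    intro Z hZ
    rw [leibniz_identity_mlieBracket_apply (hU.of_le hle) (hV.of_le hle) (hZ.of_le hle)]
    have h0 : mlieBracket I (mlieBracket I U V) Z x = mlieBracket I 0 Z x :=
      Filter.EventuallyEq.mlieBracket_vectorField_eq h (Filter.EventuallyEq.refl _ _)
    rw [h0, mlieBracket_zero_left, Pi.zero_apply, zero_add]
  have step : ∀ {A B : ∀ y : M, TangentSpace I y}, CMDiffAt ∞ (T% A) x → CMDiffAt ∞ (T% B) x →
      mlieBracket I A (mlieBracket I B (f • W)) x
        = mvfderiv I (fun y ↦ mvfderiv I f y (B y)) x (A x) • W x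
          + mvfderiv I f x (B x) • mlieBracket I A W x
          + (mvfderiv I f x (A x) • mlieBracket I B W x
            + f x • mlieBracket I A (mlieBracket I B W) x) := by
    intro A B hA hB
    have hfB := contMDiffAt_mvfderiv hf hB
    have hBW := contMDiffAt_mlieBracket hB hW
    have h0 : mlieBracket I A (mlieBracket I B (f • W)) x
        = mlieBracket I A ((fun y ↦ mvfderiv I f y (B y)) • W + f • mlieBracket I B W) x := by
      refine Filter.EventuallyEq.mlieBracket_vectorField_eq (Filter.EventuallyEq.refl _ _) ?_
      filter_upwards [eventually_mdifferentiableAt hW, eventually_mdifferentiableAt_fun hf]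
        with y h1 h2
      exact mlieBracket_smul_right h2 h1
    have dfB := hfB.mdifferentiableAt (by simp)
    have dW := mdifferentiableAt_of_smooth hW
    have df := hf.mdifferentiableAt (by simp)
    have dBW := mdifferentiableAt_of_smooth hBW
    rw [h0, mlieBracket_add_right (dfB.smul_section dW) (df.smul_section dBW),
      mlieBracket_smul_right dfB dW, mlieBracket_smul_right df dBW]
  have key := jac (hf.smul_section hW)
  change mlieBracket I U (mlieBracket I V (f • W)) x
    = mlieBracket I V (mlieBracket I U (f • W)) x at key
  rw [step hU hV, step hV hU, jac hW] at key
  refine sub_eq_zero.1 ((smul_eq_zero.1 (?_ : _ • W x = 0)).resolve_right hWx)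
  have h1 := sub_eq_zero.2 key
  rw [← h1]
  module

/-- The constant vector field on `E` with value `c`. -/
def constantField (c : E) (z : E) : TangentSpace 𝓘(ℝ, E) z := c

theorem mdifferentiableAt_constantField (c z : E) :
    MDifferentiableAt 𝓘(ℝ, E) 𝓘(ℝ, E).tangent
      (fun z ↦ (⟨z, constantField c z⟩ : TangentBundle 𝓘(ℝ, E) E)) z := by
  have h : ContMDiffAt 𝓘(ℝ, E) 𝓘(ℝ, E).tangent 1
      (fun z ↦ (⟨z, constantField c z⟩ : TangentBundle 𝓘(ℝ, E) E)) z :=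
    contMDiffAt_vectorSpace_iff_contDiffAt.2 contDiffAt_const
  exact h.mdifferentiableAt one_ne_zero

theorem mlieBracket_constantField (c d : E) :
    mlieBracket 𝓘(ℝ, E) (constantField c) (constantField d) = 0 := by
  rw [← mlieBracketWithin_univ, mlieBracketWithin_eq_lieBracketWithin]
  funext z
  change fderivWithin ℝ (fun _ ↦ d) Set.univ z c - fderivWithin ℝ (fun _ ↦ c) Set.univ z d = 0
  simp

/-- An extension is constant in the trivialization at `x`, so near `x` it is the pullback of a
constant field under the chart, and pullback respects brackets. -/
theorem mlieBracket_extend (u v : TangentSpace I x) :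
    ∀ᶠ y in 𝓝 x, mlieBracket I (FiberBundle.extend E u) (FiberBundle.extend E v) y = 0 := by
  have : CompleteSpace E := FiniteDimensional.complete ℝ E
  have : IsManifold I (minSmoothness ℝ 2) M := by
    rw [minSmoothness_of_isRCLikeNormedField]; infer_instance
  have hle : (minSmoothness ℝ 2) ≤ (∞ : ℕ∞ω) := by
    rw [minSmoothness_of_isRCLikeNormedField]
    norm_cast
  have hext : ∀ v : TangentSpace I x, ∃ c : E, ∀ᶠ y in 𝓝 x, FiberBundle.extend E v y
      = mpullback I 𝓘(ℝ, E) (extChartAt I x) (constantField c) y := by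
    intro v
    refine ⟨(trivializationAt E (TangentSpace I) x ⟨x, v⟩).2, ?_⟩
    filter_upwards [extChartAt_source_mem_nhds (I := I) x] with y hy
    have hy' : y ∈ (chartAt H x).source := by rwa [extChartAt_source] at hy
    have hinv := isInvertible_mfderiv_extChartAt hy
    refine (hinv.inverse_apply_eq.2 ?_).symm
    rw [← TangentBundle.continuousLinearMapAt_trivializationAt hy']
    have hb : y ∈ (trivializationAt E (TangentSpace I : M → Type _) x).baseSet := by
      simpa using hy'
    have h1 := (trivializationAt E (TangentSpace I : M → Type _) x).continuousLinearMapAt_symmL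
      (R := ℝ) hb (trivializationAt E (TangentSpace I) x ⟨x, v⟩).2
    rw [Trivialization.symmL_apply _ hb] at h1
    exact h1.symm
  obtain ⟨c, hc⟩ := hext u
  obtain ⟨d, hd⟩ := hext v
  filter_upwards [hc.eventually_nhds, hd.eventually_nhds,
    extChartAt_source_mem_nhds (I := I) x] with y hcy hdy hy
  have hy' : y ∈ (chartAt H x).source := by rwa [extChartAt_source] at hy
  rw [Filter.EventuallyEq.mlieBracket_vectorField_eq hcy hdy,
    ← mpullback_mlieBracket (n := ∞) (mdifferentiableAt_constantField c _)
      (mdifferentiableAt_constantField d _) (contMDiffAt_extChartAt' hy') hle,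
    mlieBracket_constantField]
  exact map_zero _

theorem extDeriv₃_extDeriv₂_kahlerForm_eq_zero (h : IsLeviCivita nabla)
    (t u v w : TangentSpace I x) :
    extDeriv₃ (extDeriv₂ (kahlerForm J)) x t u v w = 0 := by
  have hs : ∀ a : TangentSpace I x, CMDiffAt ∞ (T% (FiberBundle.extend E a)) x := fun a ↦
    FiberBundle.contMDiffAt_extend ..
  have hω : ∀ a b : TangentSpace I x, CMDiffAt ∞ (fun y ↦ kahlerForm J y
      (FiberBundle.extend E a y) (FiberBundle.extend E b y)) x := fun a b ↦
    contMDiffAt_inner (hs a) (contMDiffAt_J J (hs b))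
  have hd : ∀ a b c : TangentSpace I x, MDiffAt (fun y ↦ mvfderiv I (fun y ↦ kahlerForm J y
      (FiberBundle.extend E a y) (FiberBundle.extend E b y)) y (FiberBundle.extend E c y)) x :=
    fun a b c ↦ (contMDiffAt_mvfderiv (hω a b) (hs c)).mdifferentiableAt (by simp)
  -- At `y` the definition of `dω` extends vectors from `y`, while the fields here are extended from
  -- `x`; the invariant formula for arbitrary fields bridges the two. The factor `1` only matches
  -- the shape of `mvfderiv_mul_sub_add`.
  have hα : ∀ a b c : TangentSpace I x, ∀ᶠ y in 𝓝 x, extDeriv₂ (kahlerForm J) y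
      (FiberBundle.extend E a y) (FiberBundle.extend E b y) (FiberBundle.extend E c y)
      = 1 * (mvfderiv I (fun y ↦ kahlerForm J y (FiberBundle.extend E b y)
            (FiberBundle.extend E c y)) y (FiberBundle.extend E a y)
          - mvfderiv I (fun y ↦ kahlerForm J y (FiberBundle.extend E a y)
            (FiberBundle.extend E c y)) y (FiberBundle.extend E b y)
          + mvfderiv I (fun y ↦ kahlerForm J y (FiberBundle.extend E a y)
            (FiberBundle.extend E b y)) y (FiberBundle.extend E c y)) := by
    intro a b c
    filter_upwards [mlieBracket_extend a b, mlieBracket_extend a c, mlieBracket_extend b c,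
      eventually_mdifferentiableAt (hs a), eventually_mdifferentiableAt (hs b),
      eventually_mdifferentiableAt (hs c)] with y h1 h2 h3 d1 d2 d3
    rw [extDeriv₂_kahlerForm h, ← kahlerForm_extDeriv h d1 d2 d3, h1, h2, h3]
    simp [kahlerForm]
  have hdα : ∀ a b c z : TangentSpace I x, _ := fun a b c z ↦
    (DFunLike.congr_fun (mvfderiv_congr (hα a b c)) z).trans
      (mvfderiv_mul_sub_add 1 (hd b c a) (hd a c b) (hd a b c) z)
  have hcomm : ∀ a b c z : TangentSpace I x, _ := fun a b c z ↦
    mvfderiv_mvfderiv_comm (hs c) (hs z) (hω a b) (mlieBracket_extend c z)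
  simp only [FiberBundle.extend_apply_self] at hcomm
  have hbr : ∀ a b : TangentSpace I x,
      mlieBracket I (FiberBundle.extend E a) (FiberBundle.extend E b) x = 0 := fun a b ↦
    (mlieBracket_extend a b).self_of_nhds
  have h0 : ∀ a b : TangentSpace I x, extDeriv₂ (kahlerForm J) x 0 a b = 0 := fun a b ↦ by
    rw [extDeriv₂_kahlerForm h]
    exact map_zero (cyclicFormLeft (J.at x) (intrinsicTorsion J nabla x) a b)
  simp only [extDeriv₃, hbr, h0, hdα]
  -- Of the twelve second derivatives, each pair with the same component of `ω` occurs with opposite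
  -- signs.
  rw [hcomm v w t u, hcomm u w t v, hcomm u v t w, hcomm t w u v, hcomm t v u w, hcomm t u v w]
  ring

end ExteriorDerivative

/-! ### The coefficients -/

section Coefficients

variable {n : ℕ}

theorem relationCoeff_eq_zero_iff (hn : 3 ≤ n) (k : Fin 8) :
    relationCoeff n k = 0 ↔ n = 5 ∧ k = 4 := by
  have h3 : (3 : ℝ) ≤ n := by exact_mod_cast hn
  have h1 : (n : ℝ) - 1 ≠ 0 := by linarith
  have h2 : (n : ℝ) - 2 ≠ 0 := by linarith
  have h5 : (n : ℝ) - 5 = 0 ↔ n = 5 := by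
    rw [sub_eq_zero]
    exact_mod_cast Iff.rfl
  fin_cases k <;> simp [relationCoeff, h1, h2, h5]

theorem ricciStarCoeff_sub (hn : 2 ≤ n) (k : Fin 8) :
    ricciStarCoeff n k - ricciStarCoeff' k = relationCoeff n k := by
  have h2 : (2 : ℝ) ≤ n := by exact_mod_cast hn
  have h1 : (n : ℝ) - 1 ≠ 0 := by linarith
  fin_cases k <;> simp [relationCoeff, ricciStarCoeff, ricciStarCoeff'] <;> field_simp <;> ring

/-- The multiple `2 / 3` is forced: `t_1` has coefficient `2` in `A` and `3` in the relation. -/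
theorem ricciStarCoeffElim_eq (hn : 2 ≤ n) (k : Fin 8) :
    ricciStarCoeffElim n k = ricciStarCoeff n k - 2 / 3 * relationCoeff n k := by
  have h2 : (2 : ℝ) ≤ n := by exact_mod_cast hn
  have h1 : (n : ℝ) - 1 ≠ 0 := by linarith
  fin_cases k <;> simp [relationCoeff, ricciStarCoeff, ricciStarCoeffElim] <;> field_simp <;> ring

theorem ricciStarCoeffElim_eq_zero_iff (hn : 2 ≤ n) (k : Fin 8) :
    ricciStarCoeffElim n k = 0 ↔ k = 0 := by
  have h2 : (2 : ℝ) ≤ n := by exact_mod_cast hn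
  have h1 : (n : ℝ) - 1 ≠ 0 := by linarith
  have h3 : (n : ℝ) + 1 ≠ 0 := by linarith
  have h4 : 2 * (n : ℝ) - 1 ≠ 0 := by linarith
  fin_cases k <;> simp [ricciStarCoeffElim, h1, h3, h4]

theorem forall_vec_eight {α : Type*} {p : α → Prop} {a₀ a₁ a₂ a₃ a₄ a₅ a₆ a₇ : α} (h₀ : p a₀)
    (h₁ : p a₁) (h₂ : p a₂) (h₃ : p a₃) (h₄ : p a₄) (h₅ : p a₅) (h₆ : p a₆) (h₇ : p a₇)
    (k : Fin 8) : p (![a₀, a₁, a₂, a₃, a₄, a₅, a₆, a₇] k) := by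
  fin_cases k <;> assumption

theorem sum_vec_eight {α : Type*} (c : Fin 8 → ℝ) (a₀ a₁ a₂ a₃ a₄ a₅ a₆ a₇ : α → α → ℝ) (X Y : α) :
    ∑ k, c k * ![a₀, a₁, a₂, a₃, a₄, a₅, a₆, a₇] k X Y
      = c 0 * a₀ X Y + c 1 * a₁ X Y + c 2 * a₂ X Y + c 3 * a₃ X Y + c 4 * a₄ X Y + c 5 * a₅ X Y
        + c 6 * a₆ X Y + c 7 * a₇ X Y := by
  simp [Fin.sum_univ_eight]

theorem eq_neg_sum_erase {ι : Type*} [Fintype ι] [DecidableEq ι] {c a : ι → ℝ}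
    (h : ∑ k, c k * a k = 0) {k : ι} (hk : c k ≠ 0) :
    a k = -∑ j ∈ Finset.univ.erase k, c j / c k * a j := by
  rw [← Finset.add_sum_erase _ _ (Finset.mem_univ k)] at h
  simp only [div_mul_eq_mul_div, ← Finset.sum_div]
  field_simp
  linarith

end Coefficients

/-! ### The relation on the manifold -/

section Relation

set_option linter.unusedSectionVars false

variable {E : Type*} [NormedAddCommGroup E] [NormedSpace ℝ E]
  {H : Type*} [TopologicalSpace H] {I : ModelWithCorners ℝ E H}
  {M : Type*} [TopologicalSpace M] [ChartedSpace H M]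
  [FiniteDimensional ℝ E] [IsManifold I ∞ M]
  [RiemannianBundle (fun x : M ↦ TangentSpace I x)]
  [IsContMDiffRiemannianBundle I ∞ E (fun x : M ↦ TangentSpace I x)]
  {J : OrthogonalComplexStructure I M}
  {nabla : CovariantDerivative I E (TangentSpace I : M → Type _)} {x : M} {n : ℕ}
  {D : TangentSpace I x →ₗ[ℝ] TangentSpace I x →ₗ[ℝ] TangentSpace I x →ₗ[ℝ] TangentSpace I x}
  {ι : Type*} [Fintype ι] (e : OrthonormalBasis ι ℝ (TangentSpace I x))

theorem exists_hasTensorDerivAt_intrinsicTorsion (J : OrthogonalComplexStructure I M)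
    (h : IsLeviCivita nabla) (x : M) :
    ∃ D : TangentSpace I x →ₗ[ℝ] TangentSpace I x →ₗ[ℝ] TangentSpace I x →ₗ[ℝ] TangentSpace I x,
      HasTensorDerivAt (minimalConnection J nabla) (intrinsicTorsion J nabla) x (fun u ↦ D u) ∧
      ∀ u, D u ∈ torsionSpace (J.at x) := by
  obtain ⟨D, hD⟩ := exists_hasTensorDerivAt (minimalConnection J nabla)
    (isDiffTensorAt_intrinsicTorsion (J := J) h x)
  exact ⟨D, hD, hD.mem_torsionSpace (isMetricConnection_minimal h) isComplexConnection_minimal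
    (intrinsicTorsion_mem h)⟩

/-- Taking components commutes with `∇̃`; from here on only the single tensor `∇̃ξ` at `x` matters.
-/
theorem relationTerm_eq (h : IsLeviCivita nabla)
    (hD : HasTensorDerivAt (minimalConnection J nabla) (intrinsicTorsion J nabla) x
      (fun u ↦ D u)) :
    relationTerm J nabla n x e
      = ![divTerm e (fun u v w ↦ comp₁ (J.at x) (D u) v w),
        divTerm e (fun u v w ↦ comp₃ n (J.at x) (D u) v w),
        divTerm e (fun u v w ↦ comp₄ n (J.at x) (D u) v w),
        mixedTerm e (xi₃ J nabla n x) (xi₁ J nabla x),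
        traceTerm e (xi₁ J nabla x) (xi₄ J nabla n x),
        mixedTerm e (xi₃ J nabla n x) (xi₂ J nabla x),
        traceTerm e (xi₂ J nabla x) (xi₄ J nabla n x),
        traceTerm e (xi₃ J nabla n x) (xi₄ J nabla n x)] := by
  have hm := isMetricConnection_minimal (J := J) h
  have hc := isComplexConnection_minimal (J := J) (nabla := nabla)
  have e1 : tensorDeriv (minimalConnection J nabla) (xi₁ J nabla) x
      = fun u v w ↦ comp₁ (J.at x) (D u) v w := by
    funext u v w
    exact (hD.comp₁ hm hc).tensorDeriv_eq u v w
  have e3 : tensorDeriv (minimalConnection J nabla) (xi₃ J nabla n) x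
      = fun u v w ↦ comp₃ n (J.at x) (D u) v w := by
    funext u v w
    exact (hD.comp₃ hm hc n).tensorDeriv_eq u v w
  have e4 : tensorDeriv (minimalConnection J nabla) (xi₄ J nabla n) x
      = fun u v w ↦ comp₄ n (J.at x) (D u) v w := by
    funext u v w
    exact (hD.comp₄ hm hc n).tensorDeriv_eq u v w
  rw [relationTerm, e1, e3, e4]

theorem divXi₂_eq (h : IsLeviCivita nabla)
    (hD : HasTensorDerivAt (minimalConnection J nabla) (intrinsicTorsion J nabla) x
      (fun u ↦ D u)) :
    divXi₂ J nabla x e = divTerm e (fun u v w ↦ comp₂ (J.at x) (D u) v w) := by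
  have e2 : tensorDeriv (minimalConnection J nabla) (xi₂ J nabla) x
      = fun u v w ↦ comp₂ (J.at x) (D u) v w := by
    funext u v w
    exact (hD.comp₂ (isMetricConnection_minimal h) isComplexConnection_minimal).tensorDeriv_eq
      u v w
  rw [divXi₂, e2]

theorem isLambda20_relationTerm (h : IsLeviCivita nabla) (k : Fin 8) :
    IsLambda20 (J.at x) (relationTerm J nabla n x e k) := by
  obtain ⟨D, hD, hDt⟩ := exists_hasTensorDerivAt_intrinsicTorsion J h x
  have hJ := isOrthogonalComplex_at J x
  have hT := intrinsicTorsion_mem (J := J) h x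
  have h₁ : xi₁ J nabla x ∈ torsionSpace (J.at x) := comp₁_mem hJ hT
  have h₂ : xi₂ J nabla x ∈ torsionSpace (J.at x) := comp₂_mem hJ hT
  have h₃ : xi₃ J nabla n x ∈ torsionSpace (J.at x) := comp₃_mem hJ hT
  have h₃' : ∀ u v, xi₃ J nabla n x (J.at x u) (J.at x v) = xi₃ J nabla n x u v :=
    comp₃_inv hJ
  rw [relationTerm_eq e h hD]
  exact forall_vec_eight
    (isLambda20_divTerm e hJ fun u ↦ comp₁_mem hJ (hDt u))
    (isLambda20_divTerm e hJ fun u ↦ comp₃_mem hJ (hDt u))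
    (isLambda20_divTerm e hJ fun u ↦ comp₄_mem hJ)
    (isLambda20_mixedTerm e hJ h₃ h₃' h₁) (isLambda20_traceTerm e hJ h₁ _)
    (isLambda20_mixedTerm e hJ h₃ h₃' h₂) (isLambda20_traceTerm e hJ h₂ _)
    (isLambda20_traceTerm e hJ h₃ _) k

theorem lambda20Part_extDeriv₃ (h : IsLeviCivita nabla) (hn : 2 ≤ n)
    (hV : Module.finrank ℝ (TangentSpace I x) = 2 * n) (X Y : TangentSpace I x) :
    lambda20Part (J.at x) e (extDeriv₃ (extDeriv₂ (kahlerForm J)) x) X Y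
      = 4 * ∑ k, relationCoeff n k * relationTerm J nabla n x e k X Y := by
  obtain ⟨D, hD, hDt⟩ := exists_hasTensorDerivAt_intrinsicTorsion J h x
  have : extDeriv₃ (extDeriv₂ (kahlerForm J)) x
      = cyclicFormDeriv (J.at x) D (intrinsicTorsion J nabla x) := by
    funext t u v w
    exact extDeriv₃_extDeriv₂_kahlerForm h hD t u v w
  rw [this, lambda20Part_cyclicFormDeriv e (isOrthogonalComplex_at J x) (intrinsicTorsion_mem h x)
    hDt hn hV, relationTerm_eq e h hD, sum_vec_eight]
  simp only [relationCoeff, xi₁, xi₂, xi₃, xi₄]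
  simp only [Matrix.cons_val]
  ring

theorem ricciStarExpr_intrinsicTorsion (h : IsLeviCivita nabla) (hn : 2 ≤ n)
    (hV : Module.finrank ℝ (TangentSpace I x) = 2 * n) (X Y : TangentSpace I x) :
    ricciStarExpr (J.at x) e
        (tensorDeriv (minimalConnection J nabla) (intrinsicTorsion J nabla) x)
        (intrinsicTorsion J nabla x) X Y
      = -divXi₂ J nabla x e X Y
        + ∑ k, ricciStarCoeff n k * relationTerm J nabla n x e k X Y := by
  obtain ⟨D, hD, hDt⟩ := exists_hasTensorDerivAt_intrinsicTorsion J h x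
  have e0 : tensorDeriv (minimalConnection J nabla) (intrinsicTorsion J nabla) x
      = fun u v w ↦ D u v w := by
    funext u v w
    exact hD.tensorDeriv_eq u v w
  rw [e0, ricciStarExpr_eq e (isOrthogonalComplex_at J x) (intrinsicTorsion_mem h x) hDt hn hV,
    divXi₂_eq e h hD, relationTerm_eq e h hD, sum_vec_eight]
  simp only [ricciStarCoeff, xi₁, xi₂, xi₃, xi₄]
  simp only [Matrix.cons_val]
  ring

theorem ricciStarExpr'_intrinsicTorsion (h : IsLeviCivita nabla) (hn : 2 ≤ n)
    (hV : Module.finrank ℝ (TangentSpace I x) = 2 * n) (X Y : TangentSpace I x) :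
    ricciStarExpr' (J.at x) e
        (tensorDeriv (minimalConnection J nabla) (intrinsicTorsion J nabla) x)
        (intrinsicTorsion J nabla x) X Y
      = -divXi₂ J nabla x e X Y
        + ∑ k, ricciStarCoeff' k * relationTerm J nabla n x e k X Y := by
  obtain ⟨D, hD, hDt⟩ := exists_hasTensorDerivAt_intrinsicTorsion J h x
  have e0 : tensorDeriv (minimalConnection J nabla) (intrinsicTorsion J nabla) x
      = fun u v w ↦ D u v w := by
    funext u v w
    exact hD.tensorDeriv_eq u v w
  rw [e0, ricciStarExpr'_eq e (isOrthogonalComplex_at J x) (intrinsicTorsion_mem h x) hDt hn hV,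
    divXi₂_eq e h hD, relationTerm_eq e h hD, sum_vec_eight]
  simp only [ricciStarCoeff', xi₁, xi₂, xi₃, xi₄]
  simp only [Matrix.cons_val]
  ring

theorem sum_relationCoeff_mul_relationTerm (h : IsLeviCivita nabla) (hn : 2 ≤ n)
    (hV : Module.finrank ℝ (TangentSpace I x) = 2 * n) (X Y : TangentSpace I x) :
    ∑ k, relationCoeff n k * relationTerm J nabla n x e k X Y = 0 := by
  have h1 := lambda20Part_extDeriv₃ (J := J) e h hn hV X Y
  simp only [lambda20Part, extDeriv₃_extDeriv₂_kahlerForm_eq_zero h, mul_zero,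
    Finset.sum_const_zero, sub_zero] at h1
  linarith

end Relation

end AlmostHermitian

end


theorem mainTheorem7 (n : ℕ) (hn : 2 ≤ n)
    {M : Type*} [TopologicalSpace M] [T2Space M] [SecondCountableTopology M]
    [ChartedSpace (EuclideanSpace ℝ (Fin (2 * n))) M] [IsManifold (𝓡 (2 * n)) ∞ M]
    [RiemannianBundle (fun x : M ↦ TangentSpace (𝓡 (2 * n)) x)]
    [IsContMDiffRiemannianBundle (𝓡 (2 * n)) ∞ (EuclideanSpace ℝ (Fin (2 * n)))
      (fun x : M ↦ TangentSpace (𝓡 (2 * n)) x)]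
    (J : OrthogonalComplexStructure (𝓡 (2 * n)) M)
    (nabla : CovariantDerivative (𝓡 (2 * n)) (EuclideanSpace ℝ (Fin (2 * n)))
      (TangentSpace (𝓡 (2 * n)) : M → Type _))
    (hnabla : IsLeviCivita nabla)
    (x : M) {ι : Type*} [Fintype ι]
    (e : OrthonormalBasis ι ℝ (TangentSpace (𝓡 (2 * n)) x)) :
    -- `ξ_i` is the component of `ξ` in `𝒲_i`
    (xi₁ J nabla x ∈ W₁ (J.at x) ∧ xi₂ J nabla x ∈ W₂ (J.at x) ∧
      xi₃ J nabla n x ∈ W₃ (J.at x) ∧ xi₄ J nabla n x ∈ W₄ (J.at x) ∧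
      intrinsicTorsion J nabla x
        = xi₁ J nabla x + xi₂ J nabla x + xi₃ J nabla n x + xi₄ J nabla n x) ∧
    -- each term of the relation lies in `⟦λ^{2,0}⟧`
    (∀ k, IsLambda20 (J.at x) (relationTerm J nabla n x e k)) ∧
    -- `d²ω = 0`, and its `⟦λ^{2,0}⟧`-component expressed through the torsion
    (∀ t u v w, extDeriv₃ (extDeriv₂ (kahlerForm J)) x t u v w = 0) ∧
    (∀ X Y, lambda20Part (J.at x) e (extDeriv₃ (extDeriv₂ (kahlerForm J)) x) X Y
      = 4 * ∑ k, relationCoeff n k * relationTerm J nabla n x e k X Y) ∧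
    -- the linear relation
    (∀ X Y, ∑ k, relationCoeff n k * relationTerm J nabla n x e k X Y = 0) ∧
    -- no coefficient vanishes, except for `n = 2` and for that of `ξ_1 ⊙ ξ_4` when `n = 5`
    (3 ≤ n → ∀ k, relationCoeff n k = 0 ↔ n = 5 ∧ k = 4) ∧
    -- so that every term is a linear combination of the others
    (∀ k, relationCoeff n k ≠ 0 → ∀ X Y, relationTerm J nabla n x e k X Y
      = -∑ j ∈ Finset.univ.erase k,
          relationCoeff n j / relationCoeff n k * relationTerm J nabla n x e j X Y) ∧
    -- the two expressions for the `𝒞₆`-component differ exactly by the relation, and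
    -- the relation trades the `∇̃ξ_1`-term for those in `∇̃ξ_3` and `ξ_3 ⊙ ξ_4`
    (∀ X Y,
      let A := ricciStarExpr (J.at x) e
        (tensorDeriv (minimalConnection J nabla) (intrinsicTorsion J nabla) x)
        (intrinsicTorsion J nabla x) X Y
      let B := ricciStarExpr' (J.at x) e
        (tensorDeriv (minimalConnection J nabla) (intrinsicTorsion J nabla) x)
        (intrinsicTorsion J nabla x) X Y
      A = -divXi₂ J nabla x e X Y
          + ∑ k, ricciStarCoeff n k * relationTerm J nabla n x e k X Y ∧
      B = -divXi₂ J nabla x e X Y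
          + ∑ k, ricciStarCoeff' k * relationTerm J nabla n x e k X Y ∧
      (∀ k, ricciStarCoeff n k - ricciStarCoeff' k = relationCoeff n k) ∧
      A = B ∧
      A = -divXi₂ J nabla x e X Y
          + ∑ k, ricciStarCoeffElim n k * relationTerm J nabla n x e k X Y ∧
      (∀ k, ricciStarCoeffElim n k = 0 ↔ k = 0)) := by
  have hJ := isOrthogonalComplex_at J x
  have hT := intrinsicTorsion_mem (J := J) hnabla x
  have hV : Module.finrank ℝ (TangentSpace (𝓡 (2 * n)) x) = 2 * n :=
    finrank_euclideanSpace_fin (𝕜 := ℝ)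
  have hrel := sum_relationCoeff_mul_relationTerm (J := J) e hnabla hn hV
  refine ⟨⟨comp₁_mem_W₁ hJ hT, comp₂_mem_W₂ hJ hT, comp₃_mem_W₃ hJ hT hn hV,
    comp₄_mem_W₄, sum_comp⟩, isLambda20_relationTerm e hnabla,
    extDeriv₃_extDeriv₂_kahlerForm_eq_zero hnabla, lambda20Part_extDeriv₃ e hnabla hn hV, hrel,
    relationCoeff_eq_zero_iff, fun k hk X Y ↦ eq_neg_sum_erase (hrel X Y) hk, fun X Y ↦ ?_⟩
  intro A B
  have hA : A = _ := ricciStarExpr_intrinsicTorsion e hnabla hn hV X Y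
  have hB : B = _ := ricciStarExpr'_intrinsicTorsion e hnabla hn hV X Y
  refine ⟨hA, hB, ricciStarCoeff_sub hn, ?_, ?_, ricciStarCoeffElim_eq_zero_iff hn⟩
  · have h := hrel X Y
    simp only [← ricciStarCoeff_sub hn, sub_mul, Finset.sum_sub_distrib] at h
    rw [hA, hB]
    linarith
  · simp only [ricciStarCoeffElim_eq hn, sub_mul, mul_assoc, Finset.sum_sub_distrib,
      ← Finset.mul_sum, hrel X Y, mul_zero, sub_zero]
    exact hA
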